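/- Let $G$ be a connected real reductive group, that is, a finite cover of a closed connected transpose-stable subgroup of $GL(n,\mathbb R)$; let $\Theta$ be the Cartan involution of $G$ lifting the inverse transpose, $K=G^\Theta$, and let $\mathfrak g=\mathfrak k\oplus\mathfrak p$ be the corresponding decomposition of the complexified Lie algebra, with trace form $B$. Assume that $\mathfrak g$ and $\mathfrak k$ have equal rank. Let $\widetilde K$ be the spin double cover of $K$, let $C(\mathfrak p)$ be the Clifford algebra of $\mathfrak p$ (with $v^2=-B(v,v)$), and let $S=\bigwedge\mathfrak n_{\mathfrak p}=\bigwedge^{\rm even}\mathfrak n_{\mathfrak p}\oplus\bigwedge^{\rm odd}\mathfrak n_{\mathfrak p}=S^+\oplus S^-$ be the spin module of $C(\mathfrak p)$ attached to a maximal isotropic subspace $\mathfrak n_{\mathfrak p}\subset\mathfrak p$ with a complementary isotropic subspace. Let $D=\sum_i b_i\otimes d_i\in U(\mathfrak g)\otimes C(\mathfrak p)$ be the Dirac operator, where $(b_i)$ is any basis of $\mathfrak p$ and $(d_i)$ is the $B$-dual basis. For a $(\mathfrak g,K)$-module $X$, $D$ acts on $X\otimes S$; put $H_D(X)=\operatorname{Ker}D/(\operatorname{Ker}D\cap\operatorname{Im}D)$,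 a $\widetilde K$-module, and let $H_D(X)^\pm$ be the image of $\operatorname{Ker}D\cap(X\otimes S^\pm)$ in $H_D(X)$. An equality $A-A'=C-C'$ of virtual $\widetilde K$-modules means that $A\oplus C'\cong C\oplus A'$ as $\widetilde K$-modules. (1) For every $(\mathfrak g,K)$-module $X$ of finite length with infinitesimal character, there is an equality of virtual $\widetilde K$-modules $$X\otimes S^+-X\otimes S^-=H_D(X)^+-H_D(X)^-.$$ (2) Let $0\to U\to V\to W\to 0$ be a short exact sequence of $(\mathfrak g,K)$-modules of finite length, and assume that $V$ has infinitesimal character $\chi$. Then $U$ and $W$ have infinitesimal character $\chi$, and the Dirac index $I(X)=H_D(X)^+-H_D(X)^-$ satisfies $I(V)=I(U)+I(W)$ as virtual $\widetilde K$-modules. -/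

import Mathlib

open scoped TensorProduct Matrix

noncomputable section

namespace DiracIndex

attribute [local instance] LieRing.ofAssociativeRing

/-! ### The Lie algebra of a linear group -/

section Tangent

variable {n : ℕ}

/-- `A` is the velocity at time `0` of a curve in the linear group `H` through `1`. -/
def IsTangent (H : Subgroup (GL (Fin n) ℝ)) (A : Matrix (Fin n) (Fin n) ℝ) : Prop :=
  ∃ γ : ℝ → GL (Fin n) ℝ, (∀ t, γ t ∈ H) ∧ γ 0 = 1 ∧
    ∀ i j, HasDerivAt (fun t => (γ t : Matrix (Fin n) (Fin n) ℝ) i j) (A i j) 0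

theorem IsTangent.zero (H : Subgroup (GL (Fin n) ℝ)) : IsTangent H 0 :=
  ⟨fun _ => 1, fun _ => H.one_mem, rfl, fun i j => by
    simpa using hasDerivAt_const (0 : ℝ) ((1 : Matrix (Fin n) (Fin n) ℝ) i j)⟩

theorem IsTangent.add {H : Subgroup (GL (Fin n) ℝ)} {A B : Matrix (Fin n) (Fin n) ℝ}
    (hA : IsTangent H A) (hB : IsTangent H B) : IsTangent H (A + B) := by
  obtain ⟨α, hα, hα0, hα'⟩ := hA
  obtain ⟨β, hβ, hβ0, hβ'⟩ := hB
  refine ⟨fun t => α t * β t, fun t => H.mul_mem (hα t) (hβ t), by simp [hα0, hβ0], ?_⟩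
  intro i j
  have h : HasDerivAt (fun t => ∑ k, (α t : Matrix (Fin n) (Fin n) ℝ) i k *
      (β t : Matrix (Fin n) (Fin n) ℝ) k j)
      (∑ k, (A i k * (β 0 : Matrix (Fin n) (Fin n) ℝ) k j +
        (α 0 : Matrix (Fin n) (Fin n) ℝ) i k * B k j)) 0 :=
    HasDerivAt.fun_sum fun k _ => (hα' i k).mul (hβ' k j)
  have e : (∑ k, (A i k * (β 0 : Matrix (Fin n) (Fin n) ℝ) k j +
        (α 0 : Matrix (Fin n) (Fin n) ℝ) i k * B k j)) = (A + B) i j := by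
    rw [hα0, hβ0, Finset.sum_add_distrib]
    have h1 := congrFun (congrFun (mul_one A) i) j
    have h2 := congrFun (congrFun (one_mul B) i) j
    rw [Matrix.mul_apply] at h1 h2
    simp only [Units.val_one, Matrix.add_apply]
    rw [h1, h2]
  rw [e] at h
  simpa [Matrix.mul_apply] using h

theorem IsTangent.smul {H : Subgroup (GL (Fin n) ℝ)} {A : Matrix (Fin n) (Fin n) ℝ}
    (hA : IsTangent H A) (c : ℝ) : IsTangent H (c • A) := by
  obtain ⟨α, hα, hα0, hα'⟩ := hA
  refine ⟨fun t => α (c * t), fun t => hα _, by simp [hα0], ?_⟩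
  intro i j
  have h1 : HasDerivAt (fun t : ℝ => c * t) c 0 := by
    simpa using (hasDerivAt_id (0 : ℝ)).const_mul c
  have h2 : HasDerivAt (fun t => (α t : Matrix (Fin n) (Fin n) ℝ) i j) (A i j) (c * 0) := by
    simpa using hα' i j
  have := h2.comp 0 h1
  simpa [Function.comp_def, mul_comm] using this

/-- Conjugation by an element of the group preserves tangent vectors. -/
theorem IsTangent.conj {H : Subgroup (GL (Fin n) ℝ)} {A : Matrix (Fin n) (Fin n) ℝ}
    (hA : IsTangent H A) {g : GL (Fin n) ℝ} (hg : g ∈ H) :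
    IsTangent H ((g : Matrix (Fin n) (Fin n) ℝ) * A * ((g⁻¹ : GL (Fin n) ℝ) : Matrix _ _ ℝ)) := by
  obtain ⟨α, hα, hα0, hα'⟩ := hA
  refine ⟨fun t => g * α t * g⁻¹, fun t => H.mul_mem (H.mul_mem hg (hα t)) (H.inv_mem hg),
    by simp [hα0], ?_⟩
  intro i j
  simp only [Units.val_mul, Matrix.mul_apply]
  exact HasDerivAt.fun_sum fun k _ =>
    (HasDerivAt.fun_sum fun l _ => (hα' l k).const_mul _).mul_const _

theorem IsTangent.bracket {H : Subgroup (GL (Fin n) ℝ)} {A B : Matrix (Fin n) (Fin n) ℝ}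
    (hA : IsTangent H A) (hB : IsTangent H B) : IsTangent H ⁅A, B⁆ := by
  obtain ⟨α, hα, hα0, hα'⟩ := hA
  let W : Submodule ℝ (Matrix (Fin n) (Fin n) ℝ) :=
    { carrier := {A | IsTangent H A}
      add_mem' := fun h h' => IsTangent.add h h'
      zero_mem' := IsTangent.zero H
      smul_mem' := fun c _ h => IsTangent.smul h c }
  have hWc : IsClosed (W : Set (Matrix (Fin n) (Fin n) ℝ)) := W.closed_of_finiteDimensional
  let a : ℝ → Matrix (Fin n) (Fin n) ℝ := fun t => (α t : Matrix (Fin n) (Fin n) ℝ)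
  let q : ℝ → Matrix (Fin n) (Fin n) ℝ := fun t => t⁻¹ • (a t - 1)
  have hq : Filter.Tendsto q (nhdsWithin 0 {0}ᶜ) (nhds A) := by
    refine tendsto_pi_nhds.2 fun i => tendsto_pi_nhds.2 fun j => ?_
    have := (hasDerivAt_iff_tendsto_slope_zero.1 (hα' i j))
    simpa [q, a, hα0] using this
  have ha : Filter.Tendsto a (nhdsWithin 0 {0}ᶜ) (nhds 1) := by
    refine tendsto_pi_nhds.2 fun i => tendsto_pi_nhds.2 fun j => ?_
    have := (hα' i j).continuousAt.tendsto
    simp only [hα0, Units.val_one] at this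
    exact this.mono_left nhdsWithin_le_nhds
  have hdet : Filter.Tendsto (fun t => (a t).det) (nhdsWithin 0 {0}ᶜ) (nhds 1) := by
    have := ((continuous_id.matrix_det :
      Continuous fun M : Matrix (Fin n) (Fin n) ℝ => M.det).tendsto 1).comp ha
    simpa [Function.comp_def] using this
  have hadj : Filter.Tendsto (fun t => (a t).adjugate) (nhdsWithin 0 {0}ᶜ) (nhds 1) := by
    have := ((continuous_id.matrix_adjugate :
      Continuous fun M : Matrix (Fin n) (Fin n) ℝ => M.adjugate).tendsto 1).comp ha
    simpa [Function.comp_def] using this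
  have hinv : Filter.Tendsto (fun t => ((a t).det)⁻¹ • (a t).adjugate)
      (nhdsWithin 0 {0}ᶜ) (nhds 1) := by
    have := (hdet.inv₀ one_ne_zero).smul hadj
    simpa using this
  have hlim : Filter.Tendsto
      (fun t => (q t * B - B * q t) * (((a t).det)⁻¹ • (a t).adjugate))
      (nhdsWithin 0 {0}ᶜ) (nhds ((A * B - B * A) * 1)) :=
    ((hq.mul_const B).sub (hq.const_mul B)).mul hinv
  rw [mul_one] at hlim
  have hmem : ∀ t, (q t * B - B * q t) * (((a t).det)⁻¹ • (a t).adjugate) ∈ W := by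
    intro t
    have h1 : (a t) * (((a t).det)⁻¹ • (a t).adjugate) = 1 := by
      have hu : IsUnit (a t).det := (Matrix.isUnit_iff_isUnit_det _).1 (α t).isUnit
      rw [Matrix.mul_smul, Matrix.mul_adjugate, smul_smul, inv_mul_cancel₀ hu.ne_zero, one_smul]
    have h2 : (((α t)⁻¹ : GL (Fin n) ℝ) : Matrix (Fin n) (Fin n) ℝ) =
        ((a t).det)⁻¹ • (a t).adjugate := by
      have h3 : (((α t)⁻¹ : GL (Fin n) ℝ) : Matrix (Fin n) (Fin n) ℝ) * a t = 1 :=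
        (α t).inv_mul
      calc _ = (((α t)⁻¹ : GL (Fin n) ℝ) : Matrix (Fin n) (Fin n) ℝ) *
            (a t * (((a t).det)⁻¹ • (a t).adjugate)) := by rw [h1, mul_one]
        _ = _ := by rw [← mul_assoc, h3, one_mul]
    have h4 : (a t * B * (((a t).det)⁻¹ • (a t).adjugate)) ∈ W := by
      rw [← h2]; exact IsTangent.conj hB (hα t)
    have h5 : (q t * B - B * q t) * (((a t).det)⁻¹ • (a t).adjugate) =
        t⁻¹ • (a t * B * (((a t).det)⁻¹ • (a t).adjugate) - B) := by
      have h6 : q t * B - B * q t = t⁻¹ • (a t * B - B * a t) := by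
        simp only [q, Matrix.smul_mul, Matrix.mul_smul, ← smul_sub]
        congr 1
        noncomm_ring
      rw [h6, Matrix.smul_mul, sub_mul, mul_assoc B, h1, mul_one]
    rw [h5]
    exact W.smul_mem _ (W.sub_mem h4 hB)
  exact hWc.mem_of_tendsto hlim (Filter.Eventually.of_forall hmem)

/-- The Lie algebra of a (closed) linear group: the tangent space at the identity. -/
def tangentLie (H : Subgroup (GL (Fin n) ℝ)) : LieSubalgebra ℝ (Matrix (Fin n) (Fin n) ℝ) where
  carrier := {A | IsTangent H A}
  add_mem' h h' := IsTangent.add h h'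
  zero_mem' := IsTangent.zero H
  smul_mem' c _ h := IsTangent.smul h c
  lie_mem' h h' := IsTangent.bracket h h'

end Tangent

/-! ### The spin module of a quadratic space with a polarization -/

/-- Contraction changes the parity in the exterior algebra. -/
theorem contractLeft_mem_evenOdd {V : Type*} [AddCommGroup V] [Module ℂ V] (d : Module.Dual ℂ V)
    (i : ZMod 2) (x : ExteriorAlgebra ℂ V)
    (hx : x ∈ CliffordAlgebra.evenOdd (0 : QuadraticForm ℂ V) i) :
    CliffordAlgebra.contractLeft d x ∈ CliffordAlgebra.evenOdd (0 : QuadraticForm ℂ V) (i + 1) := by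
  have key : ∀ m : ℕ, ∀ y ∈ (LinearMap.range (CliffordAlgebra.ι (0 : QuadraticForm ℂ V))) ^ m,
      CliffordAlgebra.contractLeft d y ∈
        CliffordAlgebra.evenOdd (0 : QuadraticForm ℂ V) ((m : ZMod 2) + 1) := by
    intro m
    induction m with
    | zero =>
      intro y hy
      rw [pow_zero] at hy
      obtain ⟨c, rfl⟩ := Submodule.mem_one.1 hy
      rw [CliffordAlgebra.contractLeft_algebraMap]
      exact Submodule.zero_mem _
    | succ m ih =>
      intro y hy
      rw [pow_succ'] at hy
      refine Submodule.mul_induction_on hy ?_ fun y z hy hz => ?_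
      · rintro _ ⟨a, rfl⟩ z hz
        rw [CliffordAlgebra.contractLeft_ι_mul]
        refine Submodule.sub_mem _ (Submodule.smul_mem _ _ ?_) ?_
        · have e : ((m + 1 : ℕ) : ZMod 2) + 1 = m := by
            push_cast
            rw [add_assoc, show (1 + 1 : ZMod 2) = 0 from rfl, add_zero]
          rw [e]
          exact Submodule.mem_iSup_of_mem (⟨m, rfl⟩ : {k : ℕ // (k : ZMod 2) = m}) hz
        · have e : ((m + 1 : ℕ) : ZMod 2) + 1 = 1 + ((m : ZMod 2) + 1) := by
            push_cast; ring
          rw [e]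
          exact CliffordAlgebra.evenOdd_mul_le _ _ _
            (Submodule.mul_mem_mul (CliffordAlgebra.ι_mem_evenOdd_one _ _) (ih z hz))
      · rw [map_add]; exact Submodule.add_mem _ hy hz
  refine Submodule.iSup_induction _ (motive := fun y => CliffordAlgebra.contractLeft d y ∈
    CliffordAlgebra.evenOdd (0 : QuadraticForm ℂ V) (i + 1)) hx ?_ ?_ ?_
  · rintro ⟨m, rfl⟩ y hy
    exact key m y hy
  · rw [map_zero]; exact Submodule.zero_mem _
  · intro y z hy hz
    rw [map_add]; exact Submodule.add_mem _ hy hz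

/-- Wedging with `a` plus contracting with `d` squares to the scalar `d a`. -/
theorem wedge_add_contract_sq {V : Type*} [AddCommGroup V] [Module ℂ V] (a : V)
    (d : Module.Dual ℂ V) (x : ExteriorAlgebra ℂ V) :
    ExteriorAlgebra.ι ℂ a * (ExteriorAlgebra.ι ℂ a * x + CliffordAlgebra.contractLeft d x) +
      CliffordAlgebra.contractLeft d
        (ExteriorAlgebra.ι ℂ a * x + CliffordAlgebra.contractLeft d x) = d a • x := by
  have h5 : ExteriorAlgebra.ι ℂ a * (ExteriorAlgebra.ι ℂ a * x) = 0 := by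
    rw [← mul_assoc, ExteriorAlgebra.ι_sq_zero, zero_mul]
  have h6 : CliffordAlgebra.contractLeft d (ExteriorAlgebra.ι ℂ a * x) =
      d a • x - ExteriorAlgebra.ι ℂ a * CliffordAlgebra.contractLeft d x :=
    CliffordAlgebra.contractLeft_ι_mul _ _ _
  have h7 : CliffordAlgebra.contractLeft d (CliffordAlgebra.contractLeft d x) = 0 :=
    CliffordAlgebra.contractLeft_contractLeft _ _
  rw [mul_add, map_add, h5, h6, h7]
  abel

/-- A pair of complementary isotropic subspaces of a space with a bilinear form. If the form is
symmetric and nondegenerate, they are maximal isotropic and in duality. -/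
structure Polarization {V : Type*} [AddCommGroup V] [Module ℂ V]
    (B : LinearMap.BilinForm ℂ V) where
  pos : Submodule ℂ V
  neg : Submodule ℂ V
  isCompl : IsCompl pos neg
  pos_isotropic : ∀ x ∈ pos, ∀ y ∈ pos, B x y = 0
  neg_isotropic : ∀ x ∈ neg, ∀ y ∈ neg, B x y = 0

namespace Polarization

variable {V : Type*} [AddCommGroup V] [Module ℂ V] {B : LinearMap.BilinForm ℂ V}
  (P : Polarization B)

/-- The spin module: the exterior algebra of the chosen maximal isotropic subspace. -/
def Spinor : Type _ := ExteriorAlgebra ℂ P.pos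

instance : AddCommGroup P.Spinor := inferInstanceAs (AddCommGroup (ExteriorAlgebra ℂ P.pos))

instance : Module ℂ P.Spinor := inferInstanceAs (Module ℂ (ExteriorAlgebra ℂ P.pos))

/-- The linear form `-2 B(w, ·)` on the chosen maximal isotropic subspace. -/
def contractionForm : V →ₗ[ℂ] Module.Dual ℂ P.pos :=
  (-2 : ℂ) • (B.compl₂ P.pos.subtype)

/-- The action of vectors on the spin module: elements of the chosen maximal isotropic subspace act
by wedging, those of the complementary one by contracting. -/
def vectorAction : V →ₗ[ℂ] Module.End ℂ P.Spinor :=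
  let f : V →ₗ[ℂ] Module.End ℂ (ExteriorAlgebra ℂ P.pos) :=
    (LinearMap.mul ℂ (ExteriorAlgebra ℂ P.pos)) ∘ₗ (ExteriorAlgebra.ι ℂ) ∘ₗ
        (P.pos.projectionOnto P.neg P.isCompl) +
      CliffordAlgebra.contractLeft ∘ₗ P.contractionForm ∘ₗ
        (P.neg.projection P.pos P.isCompl.symm)
  f

theorem vectorAction_apply (v : V) (x : ExteriorAlgebra ℂ P.pos) :
    P.vectorAction v (x : P.Spinor) = (show ExteriorAlgebra ℂ P.pos from
      ExteriorAlgebra.ι ℂ (P.pos.projectionOnto P.neg P.isCompl v) * x +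
      CliffordAlgebra.contractLeft
        (P.contractionForm (P.neg.projection P.pos P.isCompl.symm v)) x) := rfl

theorem contractionForm_projection (hB : ∀ x y, B x y = B y x) (v : V) :
    P.contractionForm (P.neg.projection P.pos P.isCompl.symm v)
      (P.pos.projectionOnto P.neg P.isCompl v) = -B v v := by
  obtain ⟨a, ha⟩ : ∃ a, a = P.pos.projectionOnto P.neg P.isCompl v := ⟨_, rfl⟩
  obtain ⟨w, hw⟩ : ∃ w, w = P.neg.projection P.pos P.isCompl.symm v := ⟨_, rfl⟩
  have hv : v = (a : V) + w := by
    rw [ha, hw]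
    exact (Submodule.projection_add_projection_eq_self P.isCompl v).symm
  have hw' : w ∈ P.neg := hw ▸ Submodule.projection_apply_mem _ _
  rw [← ha, ← hw, hv]
  have h1 := P.pos_isotropic a a.2 a a.2
  have h2 := P.neg_isotropic w hw' w hw'
  have h3 := hB a w
  have h4 : P.contractionForm w a = -2 * B w a := rfl
  rw [h4, map_add, map_add, LinearMap.add_apply, LinearMap.add_apply, h1, h2, h3]
  ring

theorem vectorAction_sq (hB : ∀ x y, B x y = B y x) (v : V) :
    P.vectorAction v * P.vectorAction v = algebraMap ℂ (Module.End ℂ P.Spinor) (-B v v) := by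
  refine LinearMap.ext fun (x : ExteriorAlgebra ℂ P.pos) => ?_
  have h := wedge_add_contract_sq (P.pos.projectionOnto P.neg P.isCompl v)
    (P.contractionForm (P.neg.projection P.pos P.isCompl.symm v)) x
  rw [contractionForm_projection P hB] at h
  exact h

/-- The even (`i = 0`) and odd (`i = 1`) parts of the spin module. -/
def half (i : ZMod 2) : Submodule ℂ P.Spinor :=
  let W : Submodule ℂ (ExteriorAlgebra ℂ P.pos) :=
    CliffordAlgebra.evenOdd (0 : QuadraticForm ℂ P.pos) i
  W

/-- Vectors exchange the two parts of the spin module. -/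
theorem vectorAction_mem_half (v : V) (i : ZMod 2) (x : P.Spinor) (hx : x ∈ P.half i) :
    P.vectorAction v x ∈ P.half (i + 1) := by
  have key : ∀ y : ExteriorAlgebra ℂ P.pos,
      y ∈ CliffordAlgebra.evenOdd (0 : QuadraticForm ℂ P.pos) i →
      ExteriorAlgebra.ι ℂ (P.pos.projectionOnto P.neg P.isCompl v) * y +
      CliffordAlgebra.contractLeft
        (P.contractionForm (P.neg.projection P.pos P.isCompl.symm v)) y ∈
        CliffordAlgebra.evenOdd (0 : QuadraticForm ℂ P.pos) (i + 1) := by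
    intro y hy
    refine Submodule.add_mem _ ?_ (contractLeft_mem_evenOdd _ _ _ hy)
    rw [add_comm i]
    exact CliffordAlgebra.evenOdd_mul_le _ _ _
      (Submodule.mul_mem_mul (CliffordAlgebra.ι_mem_evenOdd_one _ _) hy)
  exact key x hx

end Polarization

/-! ### The group -/

/-- The structure of a connected real reductive group on a topological group `G`: a finite
covering homomorphism `proj` onto a closed transpose-stable subgroup of `GL(n, ℝ)`, and the Cartan
involution `theta` of `G`, which lifts the inverse transpose. -/
structure RealReductiveGroup (n : ℕ) (G : Type*) [Group G] [TopologicalSpace G]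
    [IsTopologicalGroup G] where
  connected : ConnectedSpace G
  proj : G →* GL (Fin n) ℝ
  continuous_proj : Continuous proj
  isClosed_range : IsClosed (proj.range : Set (GL (Fin n) ℝ))
  transpose_mem : ∀ g ∈ proj.range, ∃ h ∈ proj.range,
    (h : Matrix (Fin n) (Fin n) ℝ) = (g : Matrix (Fin n) (Fin n) ℝ)ᵀ
  isCoveringMap : IsCoveringMap proj.rangeRestrict
  finite_ker : Finite proj.ker
  theta : G →* G
  continuous_theta : Continuous theta
  proj_theta : ∀ g, (proj (theta g) : Matrix (Fin n) (Fin n) ℝ) =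
    (((proj g)⁻¹ : GL (Fin n) ℝ) : Matrix (Fin n) (Fin n) ℝ)ᵀ

namespace RealReductiveGroup

variable {n : ℕ} {G : Type*} [Group G] [TopologicalSpace G] [IsTopologicalGroup G]
  (R : RealReductiveGroup n G)

/-- The maximal compact subgroup `K = G^Θ`. -/
def K : Subgroup G := MonoidHom.eqLocus R.theta (MonoidHom.id G)

/-- The real Lie algebra of `G`, realized in the real matrices. -/
def g0 : LieSubalgebra ℝ (Matrix (Fin n) (Fin n) ℝ) := tangentLie R.proj.range

/-- The real form of `𝔭`: the symmetric matrices in the real Lie algebra. -/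
def p0 : Submodule ℝ (Matrix (Fin n) (Fin n) ℝ) where
  carrier := {A | A ∈ R.g0 ∧ Aᵀ = A}
  add_mem' := fun {A B} hA hB =>
    ⟨R.g0.add_mem hA.1 hB.1, by rw [Matrix.transpose_add, hA.2, hB.2]⟩
  zero_mem' := ⟨R.g0.zero_mem, Matrix.transpose_zero⟩
  smul_mem' := fun c A hA => ⟨R.g0.smul_mem c hA.1, by rw [Matrix.transpose_smul, hA.2]⟩

/-- The equal rank condition: there is a Cartan subalgebra of the real Lie algebra of `G` which is
contained in the Lie algebra of `K` (the skew-symmetric matrices). -/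
def EqualRank : Prop :=
  ∃ t : LieSubalgebra ℝ R.g0, t.IsCartanSubalgebra ∧
    ∀ A ∈ t, (A : Matrix (Fin n) (Fin n) ℝ)ᵀ = -(A : Matrix (Fin n) (Fin n) ℝ)

/-- The complexified Lie algebra `𝔤`: the complex matrices whose real and imaginary parts both lie
in the real Lie algebra. -/
def g : LieSubalgebra ℂ (Matrix (Fin n) (Fin n) ℂ) where
  carrier := {Z | Z.map Complex.re ∈ R.g0 ∧ Z.map Complex.im ∈ R.g0}
  add_mem' := fun {Z W} hZ hW => by
    refine ⟨?_, ?_⟩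
    · have e : (Z + W).map Complex.re = Z.map Complex.re + W.map Complex.re := by ext; simp
      exact e ▸ R.g0.add_mem hZ.1 hW.1
    · have e : (Z + W).map Complex.im = Z.map Complex.im + W.map Complex.im := by ext; simp
      exact e ▸ R.g0.add_mem hZ.2 hW.2
  zero_mem' := by
    refine ⟨?_, ?_⟩
    · have e : (0 : Matrix (Fin n) (Fin n) ℂ).map Complex.re = 0 := by ext; simp
      exact e ▸ R.g0.zero_mem
    · have e : (0 : Matrix (Fin n) (Fin n) ℂ).map Complex.im = 0 := by ext; simp
      exact e ▸ R.g0.zero_mem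
  smul_mem' := fun c Z hZ => by
    refine ⟨?_, ?_⟩
    · have e : (c • Z).map Complex.re = c.re • Z.map Complex.re - c.im • Z.map Complex.im := by
        ext; simp
      exact e ▸ R.g0.sub_mem (R.g0.smul_mem _ hZ.1) (R.g0.smul_mem _ hZ.2)
    · have e : (c • Z).map Complex.im = c.re • Z.map Complex.im + c.im • Z.map Complex.re := by
        ext; simp
      exact e ▸ R.g0.add_mem (R.g0.smul_mem _ hZ.2) (R.g0.smul_mem _ hZ.1)
  lie_mem' := fun {Z W} hZ hW => by
    refine ⟨?_, ?_⟩
    · have e : (⁅Z, W⁆).map Complex.re =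
          ⁅Z.map Complex.re, W.map Complex.re⁆ - ⁅Z.map Complex.im, W.map Complex.im⁆ := by
        ext i j
        simp only [Ring.lie_def, Matrix.map_apply, Matrix.sub_apply, Matrix.mul_apply,
          Complex.sub_re, Complex.re_sum, Complex.mul_re, Finset.sum_sub_distrib]
        ring
      exact e ▸ R.g0.sub_mem (R.g0.lie_mem hZ.1 hW.1) (R.g0.lie_mem hZ.2 hW.2)
    · have e : (⁅Z, W⁆).map Complex.im =
          ⁅Z.map Complex.re, W.map Complex.im⁆ + ⁅Z.map Complex.im, W.map Complex.re⁆ := by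
        ext i j
        simp only [Ring.lie_def, Matrix.map_apply, Matrix.sub_apply, Matrix.add_apply,
          Matrix.mul_apply, Complex.sub_im, Complex.im_sum, Complex.mul_im,
          Finset.sum_add_distrib]
        ring
      exact e ▸ R.g0.add_mem (R.g0.lie_mem hZ.1 hW.2) (R.g0.lie_mem hZ.2 hW.1)

/-- The trace form `B(Z, W) = tr(Z W)` on `𝔤`. -/
def B : LinearMap.BilinForm ℂ R.g :=
  LinearMap.mk₂ ℂ
    (fun Z W => Matrix.trace ((Z : Matrix (Fin n) (Fin n) ℂ) * (W : Matrix (Fin n) (Fin n) ℂ)))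
    (fun _ _ _ => by simp [add_mul]) (fun _ _ _ => by simp)
    (fun _ _ _ => by simp [mul_add]) (fun _ _ _ => by simp)

theorem B_comm (Z W : R.g) : R.B Z W = R.B W Z := by
  change Matrix.trace ((Z : Matrix (Fin n) (Fin n) ℂ) * (W : Matrix (Fin n) (Fin n) ℂ)) =
    Matrix.trace ((W : Matrix (Fin n) (Fin n) ℂ) * (Z : Matrix (Fin n) (Fin n) ℂ))
  exact Matrix.trace_mul_comm _ _

/-- The trace form on the real form of `𝔭`. -/
def B0 : LinearMap.BilinForm ℝ R.p0 :=
  LinearMap.mk₂ ℝ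
    (fun A C => Matrix.trace ((A : Matrix (Fin n) (Fin n) ℝ) * (C : Matrix (Fin n) (Fin n) ℝ)))
    (fun _ _ _ => by simp [add_mul]) (fun _ _ _ => by simp)
    (fun _ _ _ => by simp [mul_add]) (fun _ _ _ => by simp)

/-- The complex Cartan complement `𝔭`: the symmetric matrices in `𝔤`. -/
def p : Submodule ℂ (Matrix (Fin n) (Fin n) ℂ) where
  carrier := {Z | Z ∈ R.g ∧ Zᵀ = Z}
  add_mem' := fun {Z W} hZ hW =>
    ⟨R.g.add_mem hZ.1 hW.1, by rw [Matrix.transpose_add, hZ.2, hW.2]⟩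
  zero_mem' := ⟨R.g.zero_mem, Matrix.transpose_zero⟩
  smul_mem' := fun c Z hZ => ⟨R.g.smul_mem c hZ.1, by rw [Matrix.transpose_smul, hZ.2]⟩

/-- The inclusion of `𝔭` in `𝔤`. -/
def pToG : R.p →ₗ[ℂ] R.g where
  toFun Z := ⟨Z, Z.2.1⟩
  map_add' _ _ := rfl
  map_smul' _ _ := rfl

/-- The restriction of the trace form to `𝔭`. -/
def Bp : LinearMap.BilinForm ℂ R.p := R.B.compl₁₂ R.pToG R.pToG

theorem Bp_apply (v w : R.p) : R.Bp v w =
    Matrix.trace ((v : Matrix (Fin n) (Fin n) ℂ) * (w : Matrix (Fin n) (Fin n) ℂ)) := rfl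

theorem Bp_comm (v w : R.p) : R.Bp v w = R.Bp w v := R.B_comm _ _

/-- The inclusion of the real form in `𝔭`. -/
def p0ToP : R.p0 →ₗ[ℝ] R.p where
  toFun A := ⟨(A : Matrix (Fin n) (Fin n) ℝ).map Complex.ofReal, by
    refine ⟨⟨?_, ?_⟩, ?_⟩
    · have e : ((A : Matrix (Fin n) (Fin n) ℝ).map Complex.ofReal).map Complex.re = A := by
        ext; simp
      exact e ▸ A.2.1
    · have e : ((A : Matrix (Fin n) (Fin n) ℝ).map Complex.ofReal).map Complex.im = 0 := by
        ext; simp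
      exact e ▸ R.g0.zero_mem
    · have h : (A : Matrix (Fin n) (Fin n) ℝ)ᵀ = A := A.2.2
      rw [Matrix.transpose_map.symm, h]⟩
  map_add' A C := by
    apply Subtype.ext; ext; simp
  map_smul' c A := by
    apply Subtype.ext; ext; simp

/-! ### The Clifford algebra, the spin group and the spin double cover -/

/-- The quadratic form `v ↦ -B(v, v)` on `𝔭`. -/
def Q : QuadraticForm ℂ R.p :=
  -(LinearMap.BilinMap.toQuadraticMap R.Bp)

/-- The quadratic form `v ↦ -B(v, v)` on the real form of `𝔭`. -/
def Q0 : QuadraticForm ℝ R.p0 :=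
  -(LinearMap.BilinMap.toQuadraticMap R.B0)

theorem Q_apply (v : R.p) : R.Q v = -R.Bp v v := rfl

theorem Q0_apply (v : R.p0) : R.Q0 v = -R.B0 v v := rfl

theorem Q_p0ToP (v : R.p0) : R.Q (R.p0ToP v) = ((R.Q0 v : ℝ) : ℂ) := by
  rw [Q_apply, Q0_apply]
  have : R.Bp (R.p0ToP v) (R.p0ToP v) = ((R.B0 v v : ℝ) : ℂ) := by
    change Matrix.trace (((v : Matrix (Fin n) (Fin n) ℝ).map Complex.ofReal) *
      ((v : Matrix (Fin n) (Fin n) ℝ).map Complex.ofReal)) =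
      ((Matrix.trace ((v : Matrix (Fin n) (Fin n) ℝ) * (v : Matrix (Fin n) (Fin n) ℝ)) : ℝ) : ℂ)
    simp [Matrix.trace, Matrix.mul_apply]
  rw [this]; simp

/-- The Clifford algebra `C(𝔭)`, with relations `v w + w v = -2 B(v, w)`. -/
abbrev Cliff := CliffordAlgebra R.Q

/-- The inclusion of the real Clifford algebra of the real form of `𝔭` in `C(𝔭)`. -/
def realCliff : CliffordAlgebra R.Q0 →ₐ[ℝ] R.Cliff :=
  CliffordAlgebra.lift R.Q0
    ⟨((CliffordAlgebra.ι R.Q).restrictScalars ℝ) ∘ₗ R.p0ToP, fun v => by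
      rw [LinearMap.comp_apply, LinearMap.coe_restrictScalars, CliffordAlgebra.ι_sq_scalar, Q_p0ToP]
      rw [IsScalarTower.algebraMap_apply ℝ ℂ R.Cliff]; rfl⟩

theorem K_orthogonal (k : R.K) :
    (((R.proj k)⁻¹ : GL (Fin n) ℝ) : Matrix (Fin n) (Fin n) ℝ) =
      (R.proj k : Matrix (Fin n) (Fin n) ℝ)ᵀ := by
  have h1 := R.proj_theta k
  have h2 : R.theta (k : G) = k := k.2
  rw [h2] at h1
  rw [h1, Matrix.transpose_transpose]

/-- The adjoint action of `G` on its complexified Lie algebra. -/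
def Ad (x : G) : R.g →ₗ[ℂ] R.g where
  toFun Z := ⟨(R.proj x : Matrix (Fin n) (Fin n) ℝ).map Complex.ofReal * Z *
      (((R.proj x)⁻¹ : GL (Fin n) ℝ) : Matrix (Fin n) (Fin n) ℝ).map Complex.ofReal, by
    refine ⟨?_, ?_⟩
    · have e : ((R.proj x : Matrix (Fin n) (Fin n) ℝ).map Complex.ofReal *
          (Z : Matrix (Fin n) (Fin n) ℂ) *
          (((R.proj x)⁻¹ : GL (Fin n) ℝ) : Matrix (Fin n) (Fin n) ℝ).map Complex.ofReal).map
          Complex.re = (R.proj x : Matrix (Fin n) (Fin n) ℝ) *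
            (Z : Matrix (Fin n) (Fin n) ℂ).map Complex.re *
            (((R.proj x)⁻¹ : GL (Fin n) ℝ) : Matrix (Fin n) (Fin n) ℝ) := by
        ext; simp [Matrix.mul_apply]
      exact e ▸ IsTangent.conj Z.2.1 ⟨x, rfl⟩
    · have e : ((R.proj x : Matrix (Fin n) (Fin n) ℝ).map Complex.ofReal *
          (Z : Matrix (Fin n) (Fin n) ℂ) *
          (((R.proj x)⁻¹ : GL (Fin n) ℝ) : Matrix (Fin n) (Fin n) ℝ).map Complex.ofReal).map
          Complex.im = (R.proj x : Matrix (Fin n) (Fin n) ℝ) *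
            (Z : Matrix (Fin n) (Fin n) ℂ).map Complex.im *
            (((R.proj x)⁻¹ : GL (Fin n) ℝ) : Matrix (Fin n) (Fin n) ℝ) := by
        ext; simp [Matrix.mul_apply]
      exact e ▸ IsTangent.conj Z.2.2 ⟨x, rfl⟩⟩
  map_add' Z W := by apply Subtype.ext; simp [mul_add, add_mul]
  map_smul' c Z := by apply Subtype.ext; simp

/-- The adjoint action of `K` on the real form of `𝔭`. -/
def Ad0 (k : R.K) (v : R.p0) : R.p0 :=
  ⟨(R.proj k : Matrix (Fin n) (Fin n) ℝ) * v *
      (((R.proj k)⁻¹ : GL (Fin n) ℝ) : Matrix (Fin n) (Fin n) ℝ),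
    IsTangent.conj v.2.1 ⟨k, rfl⟩, by
      rw [K_orthogonal, Matrix.transpose_mul, Matrix.transpose_mul, v.2.2,
        Matrix.transpose_transpose, mul_assoc]⟩

/-- The spin double cover of `K`: the fibre product of `K` and `Spin(𝔭₀)` over `SO(𝔭₀)`, that is,
the pairs `(k, s)` with `s v s⁻¹ = Ad(k) v` for `v` in the real form of `𝔭`. -/
def Ktilde : Subgroup (R.K × spinGroup R.Q0) where
  carrier := {x | ∀ v : R.p0, (x.2 : CliffordAlgebra R.Q0) * CliffordAlgebra.ι R.Q0 v =
    CliffordAlgebra.ι R.Q0 (R.Ad0 x.1 v) * (x.2 : CliffordAlgebra R.Q0)}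
  mul_mem' := fun {x y} hx hy v => by
    have e : R.Ad0 (x.1 * y.1) v = R.Ad0 x.1 (R.Ad0 y.1 v) := by
      apply Subtype.ext
      simp [Ad0, mul_assoc]
    have hx' := hx (R.Ad0 y.1 v)
    have hy' := hy v
    simp only [Prod.fst_mul, Prod.snd_mul, e, Submonoid.coe_mul]
    rw [mul_assoc, hy', ← mul_assoc, hx', mul_assoc]
  one_mem' := fun v => by
    have e : R.Ad0 1 v = v := by apply Subtype.ext; simp [Ad0]
    simp [e]
  inv_mem' := fun {x} hx v => by
    have e : R.Ad0 x.1 (R.Ad0 x.1⁻¹ v) = v := by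
      apply Subtype.ext
      simp only [Ad0, InvMemClass.coe_inv, map_inv, inv_inv]
      have h1 : (R.proj x.1 : Matrix (Fin n) (Fin n) ℝ) *
        (((R.proj x.1)⁻¹ : GL (Fin n) ℝ) : Matrix (Fin n) (Fin n) ℝ) = 1 := Units.mul_inv _
      calc _ = ((R.proj x.1 : Matrix (Fin n) (Fin n) ℝ) *
            (((R.proj x.1)⁻¹ : GL (Fin n) ℝ) : Matrix (Fin n) (Fin n) ℝ)) * v *
            ((R.proj x.1 : Matrix (Fin n) (Fin n) ℝ) *
            (((R.proj x.1)⁻¹ : GL (Fin n) ℝ) : Matrix (Fin n) (Fin n) ℝ)) := by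
              simp only [mul_assoc]
        _ = _ := by rw [h1, one_mul, mul_one]
    have h := hx (R.Ad0 x.1⁻¹ v)
    rw [e] at h
    have hl : ((x.2⁻¹ : spinGroup R.Q0) : CliffordAlgebra R.Q0) * (x.2 : CliffordAlgebra R.Q0) = 1 := by
      rw [← Submonoid.coe_mul, inv_mul_cancel]; rfl
    have hr : (x.2 : CliffordAlgebra R.Q0) * ((x.2⁻¹ : spinGroup R.Q0) : CliffordAlgebra R.Q0) = 1 := by
      rw [← Submonoid.coe_mul, mul_inv_cancel]; rfl
    simp only [Prod.fst_inv, Prod.snd_inv]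
    calc _ = ((x.2⁻¹ : spinGroup R.Q0) : CliffordAlgebra R.Q0) * (CliffordAlgebra.ι R.Q0 v *
          (x.2 : CliffordAlgebra R.Q0)) * ((x.2⁻¹ : spinGroup R.Q0) : CliffordAlgebra R.Q0) := by
            rw [mul_assoc, mul_assoc, hr, mul_one]
      _ = _ := by rw [← h, ← mul_assoc, hl, one_mul]

/-- The projection of the spin double cover to `K`. -/
def KtildeToK : R.Ktilde →* R.K := (MonoidHom.fst R.K (spinGroup R.Q0)).comp R.Ktilde.subtype

/-! ### The spin module -/

variable {R} (P : Polarization R.Bp)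

/-- The action of `C(𝔭)` on the spin module. -/
def cliffAction : R.Cliff →ₐ[ℂ] Module.End ℂ P.Spinor :=
  CliffordAlgebra.lift R.Q ⟨P.vectorAction, fun v => P.vectorAction_sq R.Bp_comm v⟩

theorem cliffAction_ι (v : R.p) : cliffAction P (CliffordAlgebra.ι R.Q v) = P.vectorAction v :=
  CliffordAlgebra.lift_ι_apply _ _ _

/-- The spin action of the spin double cover of `K` on the spin module. -/
def spinRep : Representation ℂ R.Ktilde P.Spinor where
  toFun x := cliffAction P (R.realCliff (x.1.2 : CliffordAlgebra R.Q0))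
  map_one' := by simp
  map_mul' x y := by simp

theorem realCliff_ι (v : R.p0) :
    R.realCliff (CliffordAlgebra.ι R.Q0 v) = CliffordAlgebra.ι R.Q (R.p0ToP v) :=
  CliffordAlgebra.lift_ι_apply _ _ _

/-- The spin action preserves the even and odd parts of the spin module. -/
theorem spinRep_mem_half (x : R.Ktilde) (i : ZMod 2) : P.half i ≤ (P.half i).comap (spinRep P x) := by
  have key : ∀ s ∈ CliffordAlgebra.evenOdd R.Q0 0, ∀ y ∈ P.half i,
      cliffAction P (R.realCliff s) y ∈ P.half i := by
    intro s hs
    induction s, hs using CliffordAlgebra.even_induction with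
    | algebraMap r =>
      intro y hy
      rw [AlgHom.commutes, IsScalarTower.algebraMap_apply ℝ ℂ R.Cliff, AlgHom.commutes,
        Module.algebraMap_end_apply]
      exact Submodule.smul_mem _ _ hy
    | add a b ha hb iha ihb =>
      intro y hy
      rw [map_add, map_add, LinearMap.add_apply]
      exact Submodule.add_mem _ (iha y hy) (ihb y hy)
    | ι_mul_ι_mul v w a ha iha =>
      intro y hy
      rw [map_mul, map_mul, map_mul, map_mul, realCliff_ι, realCliff_ι, cliffAction_ι,
        cliffAction_ι, Module.End.mul_apply, Module.End.mul_apply]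
      have h := P.vectorAction_mem_half (R.p0ToP v) _ _
        (P.vectorAction_mem_half (R.p0ToP w) _ _ (iha y hy))
      rwa [add_assoc, show (1 + 1 : ZMod 2) = 0 from rfl, add_zero] at h
  intro y hy
  exact key _ (spinGroup.mem_even x.1.2.2) y hy

/-- The half-spin modules `S⁺` (`i = 0`) and `S⁻` (`i = 1`) of the spin double cover of `K`. -/
def halfSpinRep (i : ZMod 2) : Representation ℂ R.Ktilde (P.half i) :=
  (spinRep P).subrepresentation (P.half i) fun x => spinRep_mem_half P x i

theorem Ad_transpose (k : R.K) (Z : R.g) (hZ : (Z : Matrix (Fin n) (Fin n) ℂ)ᵀ = Z) :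
    (R.Ad k Z : Matrix (Fin n) (Fin n) ℂ)ᵀ = R.Ad k Z := by
  change ((R.proj k : Matrix (Fin n) (Fin n) ℝ).map Complex.ofReal *
      (Z : Matrix (Fin n) (Fin n) ℂ) *
      (((R.proj k)⁻¹ : GL (Fin n) ℝ) : Matrix (Fin n) (Fin n) ℝ).map Complex.ofReal)ᵀ =
      (R.proj k : Matrix (Fin n) (Fin n) ℝ).map Complex.ofReal *
      (Z : Matrix (Fin n) (Fin n) ℂ) *
      (((R.proj k)⁻¹ : GL (Fin n) ℝ) : Matrix (Fin n) (Fin n) ℝ).map Complex.ofReal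
  rw [K_orthogonal, Matrix.transpose_mul, Matrix.transpose_mul, hZ, ← Matrix.transpose_map,
    Matrix.transpose_transpose, ← Matrix.transpose_map, mul_assoc]

/-- The adjoint action of `K` on `𝔭`. -/
def Adp (k : R.K) : R.p →ₗ[ℂ] R.p where
  toFun v := ⟨R.Ad k (R.pToG v), (R.Ad k (R.pToG v)).2, Ad_transpose k _ v.2.2⟩
  map_add' v w := by apply Subtype.ext; simp
  map_smul' c v := by apply Subtype.ext; simp

theorem pToG_Adp (k : R.K) (v : R.p) : R.pToG (Adp k v) = R.Ad k (R.pToG v) := rfl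

theorem Adp_p0ToP (k : R.K) (v : R.p0) : Adp k (R.p0ToP v) = R.p0ToP (R.Ad0 k v) := by
  apply Subtype.ext
  ext i j
  change ((R.proj k : Matrix (Fin n) (Fin n) ℝ).map Complex.ofReal *
      (v : Matrix (Fin n) (Fin n) ℝ).map Complex.ofReal *
      (((R.proj k)⁻¹ : GL (Fin n) ℝ) : Matrix (Fin n) (Fin n) ℝ).map Complex.ofReal) i j =
    (((R.proj k : Matrix (Fin n) (Fin n) ℝ) * v *
      (((R.proj k)⁻¹ : GL (Fin n) ℝ) : Matrix (Fin n) (Fin n) ℝ)).map Complex.ofReal) i j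
  simp [Matrix.mul_apply]

theorem B_Ad (x : G) (Z W : R.g) : R.B (R.Ad x Z) (R.Ad x W) = R.B Z W := by
  have h : (((R.proj x)⁻¹ : GL (Fin n) ℝ) : Matrix (Fin n) (Fin n) ℝ).map Complex.ofReal *
      (R.proj x : Matrix (Fin n) (Fin n) ℝ).map Complex.ofReal = 1 := by
    have h1 : (((R.proj x)⁻¹ : GL (Fin n) ℝ) : Matrix (Fin n) (Fin n) ℝ) *
      (R.proj x : Matrix (Fin n) (Fin n) ℝ) = 1 := Units.inv_mul _
    have h2 := congrArg (fun M : Matrix (Fin n) (Fin n) ℝ => M.map Complex.ofRealHom) h1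
    simp only [Matrix.map_mul] at h2
    rw [Matrix.map_one _ (map_zero _) (map_one _)] at h2
    exact h2
  set a := (R.proj x : Matrix (Fin n) (Fin n) ℝ).map Complex.ofReal
  set b := (((R.proj x)⁻¹ : GL (Fin n) ℝ) : Matrix (Fin n) (Fin n) ℝ).map Complex.ofReal
  change Matrix.trace ((a * (Z : Matrix (Fin n) (Fin n) ℂ) * b) *
    (a * (W : Matrix (Fin n) (Fin n) ℂ) * b)) =
    Matrix.trace ((Z : Matrix (Fin n) (Fin n) ℂ) * (W : Matrix (Fin n) (Fin n) ℂ))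
  calc _ = Matrix.trace ((a * ((Z : Matrix (Fin n) (Fin n) ℂ) * (b * a) * (W : Matrix (Fin n) (Fin n) ℂ))) * b) := by
        simp only [mul_assoc]
    _ = Matrix.trace (b * (a * ((Z : Matrix (Fin n) (Fin n) ℂ) * (b * a) * (W : Matrix (Fin n) (Fin n) ℂ)))) :=
        Matrix.trace_mul_comm _ _
    _ = _ := by rw [h, ← mul_assoc, h, one_mul, mul_one]

theorem Ad_mul (x y : G) (Z : R.g) : R.Ad (x * y) Z = R.Ad x (R.Ad y Z) := by
  apply Subtype.ext
  ext i j
  change ((R.proj (x * y) : Matrix (Fin n) (Fin n) ℝ).map Complex.ofReal * (Z : Matrix (Fin n) (Fin n) ℂ) *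
      (((R.proj (x * y))⁻¹ : GL (Fin n) ℝ) : Matrix (Fin n) (Fin n) ℝ).map Complex.ofReal) i j =
    ((R.proj x : Matrix (Fin n) (Fin n) ℝ).map Complex.ofReal *
      ((R.proj y : Matrix (Fin n) (Fin n) ℝ).map Complex.ofReal * (Z : Matrix (Fin n) (Fin n) ℂ) *
      (((R.proj y)⁻¹ : GL (Fin n) ℝ) : Matrix (Fin n) (Fin n) ℝ).map Complex.ofReal) *
      (((R.proj x)⁻¹ : GL (Fin n) ℝ) : Matrix (Fin n) (Fin n) ℝ).map Complex.ofReal) i j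
  have h1 : (R.proj (x * y) : Matrix (Fin n) (Fin n) ℝ).map Complex.ofReal =
      (R.proj x : Matrix (Fin n) (Fin n) ℝ).map Complex.ofReal *
      (R.proj y : Matrix (Fin n) (Fin n) ℝ).map Complex.ofReal := by
    ext; simp [Matrix.mul_apply]
  have h2 : (((R.proj (x * y))⁻¹ : GL (Fin n) ℝ) : Matrix (Fin n) (Fin n) ℝ).map Complex.ofReal =
      (((R.proj y)⁻¹ : GL (Fin n) ℝ) : Matrix (Fin n) (Fin n) ℝ).map Complex.ofReal *
      (((R.proj x)⁻¹ : GL (Fin n) ℝ) : Matrix (Fin n) (Fin n) ℝ).map Complex.ofReal := by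
    rw [map_mul, mul_inv_rev]
    ext; simp [Matrix.mul_apply]
  rw [h1, h2]
  simp only [mul_assoc]

theorem Ad_one (Z : R.g) : R.Ad 1 Z = Z := by
  apply Subtype.ext
  change ((R.proj 1 : GL (Fin n) ℝ) : Matrix (Fin n) (Fin n) ℝ).map Complex.ofReal * (Z : Matrix (Fin n) (Fin n) ℂ) *
      (((R.proj 1)⁻¹ : GL (Fin n) ℝ) : Matrix (Fin n) (Fin n) ℝ).map Complex.ofReal = Z
  have h : ((1 : GL (Fin n) ℝ) : Matrix (Fin n) (Fin n) ℝ).map Complex.ofReal = 1 := by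
    rw [Units.val_one, Matrix.map_one _ Complex.ofReal_zero Complex.ofReal_one]
  rw [map_one, inv_one, h, one_mul, mul_one]

theorem Adp_mul_inv (k : R.K) (v : R.p) : Adp k (Adp k⁻¹ v) = v := by
  apply Subtype.ext
  change ((R.Ad k (R.Ad (k⁻¹ : R.K) (R.pToG v)) : R.g) : Matrix (Fin n) (Fin n) ℂ) = R.pToG v
  rw [← Ad_mul, ← Subgroup.coe_mul, mul_inv_cancel, Subgroup.coe_one, Ad_one]

/-- Every element of `𝔭` is a complex combination of two elements of the real form. -/
theorem exists_p0 (v : R.p) : ∃ a b : R.p0, v = R.p0ToP a + Complex.I • R.p0ToP b := by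
  have hv : (v : Matrix (Fin n) (Fin n) ℂ)ᵀ = v := v.2.2
  refine ⟨⟨(v : Matrix (Fin n) (Fin n) ℂ).map Complex.re, v.2.1.1, ?_⟩,
    ⟨(v : Matrix (Fin n) (Fin n) ℂ).map Complex.im, v.2.1.2, ?_⟩, ?_⟩
  · rw [Matrix.transpose_map.symm, hv]
  · rw [Matrix.transpose_map.symm, hv]
  · apply Subtype.ext
    ext i j
    change (v : Matrix (Fin n) (Fin n) ℂ) i j =
      (((v : Matrix (Fin n) (Fin n) ℂ) i j).re : ℂ) +
        Complex.I * (((v : Matrix (Fin n) (Fin n) ℂ) i j).im : ℂ)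
    rw [mul_comm]
    exact (Complex.re_add_im _).symm

theorem p_hom_ext {M : Type*} [AddCommGroup M] [Module ℂ M] (f h : R.p →ₗ[ℂ] M)
    (H : ∀ a : R.p0, f (R.p0ToP a) = h (R.p0ToP a)) (v : R.p) : f v = h v := by
  obtain ⟨a, b, rfl⟩ := exists_p0 v
  rw [map_add, map_smul, map_add, map_smul, H, H]

/-- The Clifford action intertwines the adjoint and the spin actions. -/
theorem spinRep_vectorAction (x : R.Ktilde) (v : R.p) :
    spinRep P x * P.vectorAction v = P.vectorAction (Adp (R.KtildeToK x) v) * spinRep P x := by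
  refine p_hom_ext (LinearMap.mulLeft ℂ (spinRep P x) ∘ₗ P.vectorAction)
    (LinearMap.mulRight ℂ (spinRep P x) ∘ₗ P.vectorAction ∘ₗ Adp (R.KtildeToK x)) ?_ v
  intro a
  have h := congrArg (fun s => cliffAction P (R.realCliff s)) (x.2 a)
  simp only [map_mul, realCliff_ι, cliffAction_ι] at h
  rw [LinearMap.comp_apply, LinearMap.comp_apply, LinearMap.comp_apply, Adp_p0ToP]
  exact h

variable (R)

/-! ### `(𝔤, K)`-modules -/

/-- The structure of a `(𝔤, K)`-module on a complex vector space `X`: compatible actions of `𝔤` and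
`K`, where the action of `K` is locally finite and continuous, and its differential is the
restriction of the action of `𝔤` (the one-parameter subgroups of `K` are the continuous homomorphisms
`φ` with `proj (φ t) = exp (t A)`, for `A` skew-symmetric in the real Lie algebra). -/
structure GKModule (X : Type*) [AddCommGroup X] [Module ℂ X] where
  lieAction : R.g →ₗ⁅ℂ⁆ Module.End ℂ X
  rep : Representation ℂ R.K X
  locallyFinite : ∀ x : X, (Submodule.span ℂ (Set.range fun k => rep k x)).FG
  continuous_coeff : ∀ (x : X) (ℓ : Module.Dual ℂ X), Continuous fun k => ℓ (rep k x)
  rep_lieAction : ∀ (k : R.K) (Z : R.g) (x : X),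
    rep k (lieAction Z x) = lieAction (R.Ad k Z) (rep k x)
  hasDerivAt_coeff : ∀ (Z : R.g) (A : Matrix (Fin n) (Fin n) ℝ), Aᵀ = -A →
    (Z : Matrix (Fin n) (Fin n) ℂ) = A.map Complex.ofReal →
    ∀ φ : Multiplicative ℝ →* R.K, Continuous φ →
    (∀ t : ℝ, (R.proj (φ (Multiplicative.ofAdd t)) : Matrix (Fin n) (Fin n) ℝ) =
      NormedSpace.exp (t • A)) →
    ∀ (x : X) (ℓ : Module.Dual ℂ X),
      HasDerivAt (fun t : ℝ => ℓ (rep (φ (Multiplicative.ofAdd t)) x)) (ℓ (lieAction Z x)) 0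

variable {R}

namespace GKModule

variable {X : Type*} [AddCommGroup X] [Module ℂ X] (M : R.GKModule X)

/-- `W` is a `(𝔤, K)`-submodule. -/
def IsSubmodule (W : Submodule ℂ X) : Prop :=
  (∀ Z : R.g, ∀ x ∈ W, M.lieAction Z x ∈ W) ∧ ∀ k : R.K, ∀ x ∈ W, M.rep k x ∈ W

/-- Finite length: there is a finite chain of `(𝔤, K)`-submodules from `0` to `X` which cannot be
refined, that is, whose successive quotients are irreducible. -/
def FiniteLength : Prop :=
  ∃ (m : ℕ) (W : ℕ → Submodule ℂ X), W 0 = ⊥ ∧ W m = ⊤ ∧ (∀ i, i ≤ m → M.IsSubmodule (W i)) ∧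
    ∀ i < m, W i < W (i + 1) ∧
      ∀ Y, M.IsSubmodule Y → W i ≤ Y → Y ≤ W (i + 1) → Y = W i ∨ Y = W (i + 1)

/-- The action of the enveloping algebra `U(𝔤)`. -/
def envAction : UniversalEnvelopingAlgebra ℂ R.g →ₐ[ℂ] Module.End ℂ X :=
  UniversalEnvelopingAlgebra.lift ℂ M.lieAction

/-- `χ` is the infinitesimal character of `X`: every `z` in the center of `U(𝔤)` acts by the scalar
`χ z`. -/
def HasInfChar (χ : Subalgebra.center ℂ (UniversalEnvelopingAlgebra ℂ R.g) →ₐ[ℂ] ℂ) : Prop :=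
  ∀ z : Subalgebra.center ℂ (UniversalEnvelopingAlgebra ℂ R.g), ∀ x : X,
    M.envAction (z : UniversalEnvelopingAlgebra ℂ R.g) x = χ z • x

end GKModule

/-- Homomorphisms of `(𝔤, K)`-modules. -/
def IsGKHom {X Y : Type*} [AddCommGroup X] [Module ℂ X] [AddCommGroup Y] [Module ℂ Y]
    (M : R.GKModule X) (N : R.GKModule Y) (f : X →ₗ[ℂ] Y) : Prop :=
  (∀ (Z : R.g) (x : X), f (M.lieAction Z x) = N.lieAction Z (f x)) ∧
    ∀ (k : R.K) (x : X), f (M.rep k x) = N.rep k (f x)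

/-! ### The Dirac operator -/

variable (R) in
/-- A basis `b` of `𝔭` and the dual basis `d` with respect to the trace form. -/
structure DualBases (ι : Type*) [Fintype ι] [DecidableEq ι] where
  b : Module.Basis ι ℂ R.p
  d : ι → R.p
  dual : ∀ i j, R.Bp (b i) (d j) = if i = j then 1 else 0

variable {ι : Type*} [Fintype ι] [DecidableEq ι] (β : R.DualBases ι)

/-- The Dirac operator `D = ∑ bᵢ ⊗ dᵢ` in `U(𝔤) ⊗ C(𝔭)`. -/
def DualBases.dirac : UniversalEnvelopingAlgebra ℂ R.g ⊗[ℂ] R.Cliff :=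
  ∑ i, UniversalEnvelopingAlgebra.ι ℂ (R.pToG (β.b i)) ⊗ₜ[ℂ] CliffordAlgebra.ι R.Q (β.d i)

theorem DualBases.expand (v : R.p) : v = ∑ j, R.Bp v (β.d j) • β.b j := by
  have h := β.b.sum_repr v
  have h2 : ∀ j, R.Bp v (β.d j) = β.b.repr v j := by
    intro j
    conv_lhs => rw [← h]
    rw [map_sum, LinearMap.sum_apply]
    simp [β.dual]
  simp only [h2]
  exact h.symm

theorem DualBases.expand_dual (v : R.p) : v = ∑ j, R.Bp (β.b j) v • β.d j := by
  let f : R.p →ₗ[ℂ] R.p := ∑ j, (R.Bp (β.b j)).smulRight (β.d j)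
  have hf : ∀ w, f w = ∑ j, R.Bp (β.b j) w • β.d j := fun w => by simp [f]
  have h0 : ∀ w, f w = 0 → w = 0 := by
    intro w hw
    have h1 : ∀ i, R.Bp (β.b i) w = 0 := by
      intro i
      have h := congrArg (R.Bp (β.b i)) hw
      rw [hf, map_sum, map_zero] at h
      simpa [β.dual] using h
    have h2 : ∀ v, R.Bp v w = 0 := by
      intro v
      rw [β.expand v, map_sum, LinearMap.sum_apply]
      simp [h1]
    rw [β.expand w]
    exact Finset.sum_eq_zero fun j _ => by rw [R.Bp_comm, h2, zero_smul]
  have hfix : ∀ i, f (β.d i) = β.d i := by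
    intro i
    rw [hf]; simp [β.dual]
  have hidem : f (f v - v) = 0 := by
    rw [map_sub, hf v, map_sum]
    simp only [map_smul, hfix]
    exact sub_self _
  have := h0 _ hidem
  rw [← hf]
  exact (sub_eq_zero.1 this).symm

/-- A sum `∑ Φ(bᵢ, dᵢ)` is invariant under isometries. -/
theorem DualBases.sum_invariant {M : Type*} [AddCommGroup M] [Module ℂ M]
    (Φ : R.p →ₗ[ℂ] R.p →ₗ[ℂ] M) (k : R.K) :
    ∑ i, Φ (Adp k (β.b i)) (Adp k (β.d i)) = ∑ i, Φ (β.b i) (β.d i) := by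
  have hB : ∀ v w, R.Bp (Adp k v) w = R.Bp v (Adp k⁻¹ w) := by
    intro v w
    have h := B_Ad (R := R) k (R.pToG v) (R.pToG (Adp k⁻¹ w))
    rw [← pToG_Adp, ← pToG_Adp, Adp_mul_inv] at h
    exact h
  calc ∑ i, Φ (Adp k (β.b i)) (Adp k (β.d i))
      = ∑ i, ∑ j, R.Bp (Adp k (β.b i)) (β.d j) • Φ (β.b j) (Adp k (β.d i)) := by
        refine Finset.sum_congr rfl fun i _ => ?_
        conv_lhs => rw [β.expand (Adp k (β.b i))]
        rw [map_sum, LinearMap.sum_apply]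
        simp only [map_smul, LinearMap.smul_apply]
    _ = ∑ j, Φ (β.b j) (Adp k (∑ i, R.Bp (β.b i) (Adp k⁻¹ (β.d j)) • β.d i)) := by
        rw [Finset.sum_comm]
        refine Finset.sum_congr rfl fun j _ => ?_
        simp only [map_sum, map_smul, hB]
    _ = _ := by
        refine Finset.sum_congr rfl fun j _ => ?_
        rw [← β.expand_dual, Adp_mul_inv]

namespace GKModule

variable {X : Type*} [AddCommGroup X] [Module ℂ X] (M : R.GKModule X)

/-- The `K̃`-module `X ⊗ S`. -/
def tensorSpin : Representation ℂ R.Ktilde (X ⊗[ℂ] P.Spinor) :=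
  Representation.tprod (M.rep.comp R.KtildeToK) (spinRep P)

/-- The `K̃`-modules `X ⊗ S⁺` (`i = 0`) and `X ⊗ S⁻` (`i = 1`). -/
def tensorHalfSpin (i : ZMod 2) : Representation ℂ R.Ktilde (X ⊗[ℂ] P.half i) :=
  Representation.tprod (M.rep.comp R.KtildeToK) (halfSpinRep P i)

/-- The action of `U(𝔤) ⊗ C(𝔭)` on `X ⊗ S`. -/
def tensorAction : UniversalEnvelopingAlgebra ℂ R.g ⊗[ℂ] R.Cliff →ₐ[ℂ]
    Module.End ℂ (X ⊗[ℂ] P.Spinor) :=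
  Module.endTensorEndAlgHom.comp (Algebra.TensorProduct.map M.envAction (cliffAction P))

/-- The Dirac operator on `X ⊗ S`. -/
def diracOp : Module.End ℂ (X ⊗[ℂ] P.Spinor) := M.tensorAction P β.dirac

theorem diracOp_eq : M.diracOp P β =
    ∑ i, TensorProduct.map (M.lieAction (R.pToG (β.b i))) (P.vectorAction (β.d i)) := by
  simp only [diracOp, DualBases.dirac, map_sum]
  refine Finset.sum_congr rfl fun i _ => ?_
  simp only [tensorAction, AlgHom.comp_apply, Algebra.TensorProduct.map_tmul,
    Module.endTensorEndAlgHom_apply, cliffAction_ι, envAction,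
    UniversalEnvelopingAlgebra.lift_ι_apply]
  rfl

/-- The Dirac operator commutes with the action of the spin double cover of `K`. -/
theorem diracOp_comm (x : R.Ktilde) :
    M.tensorSpin P x * M.diracOp P β = M.diracOp P β * M.tensorSpin P x := by
  let Φ : R.p →ₗ[ℂ] R.p →ₗ[ℂ] Module.End ℂ (X ⊗[ℂ] P.Spinor) :=
    (TensorProduct.mapBilinear (RingHom.id ℂ) X P.Spinor X P.Spinor).compl₁₂
      ((M.lieAction : R.g →ₗ[ℂ] Module.End ℂ X) ∘ₗ R.pToG) P.vectorAction
  have hΦ : ∀ v w, Φ v w = TensorProduct.map (M.lieAction (R.pToG v)) (P.vectorAction w) :=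
    fun _ _ => rfl
  have hD : M.diracOp P β = ∑ i, Φ (β.b i) (β.d i) := by simp only [hΦ, diracOp_eq]
  have hT : M.tensorSpin P x =
      TensorProduct.map (M.rep (R.KtildeToK x)) (spinRep P x) := rfl
  have hcomm : ∀ v w, M.tensorSpin P x * Φ v w =
      Φ (Adp (R.KtildeToK x) v) (Adp (R.KtildeToK x) w) * M.tensorSpin P x := by
    intro v w
    have h1 : M.rep (R.KtildeToK x) * M.lieAction (R.pToG v) =
        M.lieAction (R.pToG (Adp (R.KtildeToK x) v)) * M.rep (R.KtildeToK x) :=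
      LinearMap.ext fun y => M.rep_lieAction _ _ _
    rw [hT, hΦ, hΦ, ← TensorProduct.map_mul, ← TensorProduct.map_mul, h1, spinRep_vectorAction]
  rw [hD]
  conv_rhs => rw [← β.sum_invariant Φ (R.KtildeToK x)]
  rw [Finset.mul_sum, Finset.sum_mul]
  exact Finset.sum_congr rfl fun i _ => hcomm _ _

/-- The Dirac cohomology `H_D(X) = Ker D / (Ker D ∩ Im D)`. -/
abbrev DiracCohomology : Type _ :=
  LinearMap.ker (M.diracOp P β) ⧸
    (LinearMap.range (M.diracOp P β)).comap (LinearMap.ker (M.diracOp P β)).subtype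

/-- The action of the spin double cover of `K` on the kernel of the Dirac operator. -/
def kerRep : Representation ℂ R.Ktilde (LinearMap.ker (M.diracOp P β)) :=
  (M.tensorSpin P).subrepresentation _ fun x y hy => by
    have hy' : M.diracOp P β y = 0 := hy
    have h := LinearMap.congr_fun (M.diracOp_comm P β x) y
    rw [Module.End.mul_apply, Module.End.mul_apply, hy', map_zero] at h
    exact h.symm

/-- The action of the spin double cover of `K` on the Dirac cohomology. -/
def cohomologyRep : Representation ℂ R.Ktilde (M.DiracCohomology P β) :=
  (M.kerRep P β).quotient _ fun x y hy => by
    obtain ⟨w, hw⟩ := hy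
    refine ⟨M.tensorSpin P x w, ?_⟩
    have h := LinearMap.congr_fun (M.diracOp_comm P β x) w
    rw [Module.End.mul_apply, Module.End.mul_apply, hw] at h
    exact h.symm

/-- The parts `H_D(X)⁺` (`i = 0`) and `H_D(X)⁻` (`i = 1`) of the Dirac cohomology: the classes of the
elements of `Ker D` which lie in `X ⊗ S⁺`, respectively `X ⊗ S⁻`. -/
def cohomologyHalf (i : ZMod 2) : Submodule ℂ (M.DiracCohomology P β) :=
  ((LinearMap.range ((P.half i).subtype.lTensor X)).comap
    (LinearMap.ker (M.diracOp P β)).subtype).map (Submodule.mkQ _)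

/-- `H_D(X)⁺` (`i = 0`) and `H_D(X)⁻` (`i = 1`) as `K̃`-modules. -/
def cohomologyHalfRep (i : ZMod 2) : Representation ℂ R.Ktilde (M.cohomologyHalf P β i) :=
  (M.cohomologyRep P β).subrepresentation _ fun x => by
    rintro _ ⟨y, ⟨w, hw⟩, rfl⟩
    refine ⟨M.kerRep P β x y, ⟨M.tensorHalfSpin P i x w, ?_⟩, rfl⟩
    have h : (P.half i).subtype.lTensor X (M.tensorHalfSpin P i x w) =
        M.tensorSpin P x ((P.half i).subtype.lTensor X w) := by
      clear hw
      induction w with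
      | zero => simp
      | tmul a s => rfl
      | add a b ha hb => rw [map_add, map_add, ha, hb, map_add, map_add]
    rw [h, hw]
    rfl

end GKModule

end RealReductiveGroup

/-! ### Virtual modules -/

/-- The equality `[A] - [A'] = [C] - [C']` of virtual modules, that is, of formal differences of
modules for a group: `A ⊕ C'` and `C ⊕ A'` are isomorphic. For direct sums of finite-dimensional
irreducible modules with finite multiplicities, this says that every irreducible module has the same
multiplicity in `[A] - [A']` as in `[C] - [C']`. -/
def VirtualEq {H A A' C C' : Type*} [Group H] [AddCommGroup A] [Module ℂ A] [AddCommGroup A']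
    [Module ℂ A'] [AddCommGroup C] [Module ℂ C] [AddCommGroup C'] [Module ℂ C']
    (a : Representation ℂ H A) (a' : Representation ℂ H A')
    (c : Representation ℂ H C) (c' : Representation ℂ H C') : Prop :=
  Nonempty ((a.prod c').Equiv (c.prod a'))

end DiracIndex

end

/-! The statement holds because the square of the Dirac operator `D` is, up to a scalar, a
self-adjoint operator with finite-dimensional stable pieces, even though `X` need not be unitary.

Averaging over the compact group `K`, and then over the finitely many Clifford operators of an
orthonormal basis `Zⱼ` of the real form of `𝔭`, gives a positive definite Hermitian form on `X ⊗ S`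
for which `K` acts by isometries and the real vectors of `𝔭` in the Clifford algebra act by
skew-adjoint operators, so that the spin double cover `K̃` acts by isometries
(`exists_invariantForm`, `isIsometry_tensorSpin`). Orthogonal complements in the
finite-dimensional stable subspaces `F ⊗ S` show that `X ⊗ S` is a semisimple `K̃`-module
(`isSemisimpleModule_tensorSpin`). Differentiating along one-parameter subgroups of `K`, which exist
because a tangent vector of a closed linear group exponentiates into the group and the covering
lifts paths (`exists_oneParameter`), shows that the real form of `𝔨` acts by skew-adjoint operators.

Expanding the square in an orthonormal basis gives
`D² = -∑ Zⱼ² ⊗ 1 + ½ ∑ [Zᵢ, Zⱼ] ⊗ Zᵢ Zⱼ`. The Casimir element `∑ Zⱼ² - ∑ Wₖ²` is central, so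
it acts by a scalar, and up to this scalar `D²` is
`-∑ Wₖ² ⊗ 1 + ½ ∑ [Zᵢ, Zⱼ] ⊗ Zᵢ Zⱼ` (`diracOp_sq`). This involves only `𝔨` and the Clifford
algebra, hence is self-adjoint and preserves every `F ⊗ S`. The scalar may be complex, but a scalar
translate of a self-adjoint operator is normal; therefore the kernel and the image of `D²` are
complementary (`GKModule.isOddOperator`).

The rest is algebra of odd operators on graded semisimple modules. The image of `D²` contributes
equally to `X ⊗ S⁺` and `X ⊗ S⁻`, and on the kernel of `D²` the cancellation is that of the Euler
characteristic, which gives the first part (`IsOddOperator.exists_equiv_index`). For a short exact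
sequence, taking kernels of `D²` is exact, so there is a six-term exact sequence in Dirac
cohomology; it splits by semisimplicity (`IsOddExact.exists_equiv_index`). The isomorphisms
are written down directly, so no finiteness of multiplicities enters. -/

open scoped TensorProduct Matrix

noncomputable section

namespace DiracIndex

attribute [local instance] LieRing.ofAssociativeRing

/-! ### Two-periodic operators on semisimple modules -/

section Semisimple

variable {R : Type*} [Ring R]

/-- A semisimple module is the direct sum of the kernel and the image of any linear map out of
it. -/
theorem exists_equiv_ker_prod_range {M N : Type*} [AddCommGroup M] [Module R M] [AddCommGroup N]
    [Module R N] [IsSemisimpleModule R M] (f : M →ₗ[R] N) :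
    Nonempty (M ≃ₗ[R] LinearMap.ker f × LinearMap.range f) := by
  obtain ⟨q, hq⟩ := exists_isCompl (LinearMap.ker f)
  exact ⟨(Submodule.prodEquivOfIsCompl _ _ hq).symm.trans
    ((LinearEquiv.refl R _).prodCongr
      ((Submodule.quotientEquivOfIsCompl _ _ hq).symm.trans f.quotKerEquivRange))⟩

theorem exists_equiv_prod_quotient {M : Type*} [AddCommGroup M] [Module R M]
    [IsSemisimpleModule R M] (N : Submodule R M) : Nonempty (M ≃ₗ[R] N × (M ⧸ N)) := by
  obtain ⟨q, hq⟩ := exists_isCompl N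
  exact ⟨(Submodule.prodEquivOfIsCompl _ _ hq).symm.trans
    ((LinearEquiv.refl R _).prodCongr (Submodule.quotientEquivOfIsCompl _ _ hq).symm)⟩

theorem exists_equiv_inf_ker_prod_map {V W : Type*} [AddCommGroup V] [Module R V] [AddCommGroup W]
    [Module R W] [IsSemisimpleModule R V] (D : V →ₗ[R] W) (N : Submodule R V) :
    Nonempty (N ≃ₗ[R] (N ⊓ LinearMap.ker D : Submodule R V) × N.map D) := by
  obtain ⟨e⟩ := exists_equiv_ker_prod_range (D.domRestrict N)
  have h1 : (LinearMap.ker (D.domRestrict N)).map N.subtype = N ⊓ LinearMap.ker D := by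
    ext x
    simp [and_comm]
  have h2 : LinearMap.range (D.domRestrict N) = N.map D := by
    rw [LinearMap.domRestrict, LinearMap.range_comp, Submodule.range_subtype]
  exact ⟨e.trans (LinearEquiv.prodCongr
    ((Submodule.equivMapOfInjective N.subtype N.injective_subtype _).trans
      (LinearEquiv.ofEq _ _ h1)) (LinearEquiv.ofEq _ _ h2))⟩

/-- An odd operator `D` on a `ZMod 2`-graded module whose square is semisimple at the eigenvalue
zero, in the sense that kernel and image of `D²` are complementary. -/
structure IsOddOperator {V : Type*} [AddCommGroup V] [Module R V] (D : V →ₗ[R] V)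
    (A : ZMod 2 → Submodule R V) : Prop where
  odd : ∀ i, ∀ x ∈ A i, D x ∈ A (i + 1)
  decomp : ∀ i x, ∃ y ∈ A i, ∃ z ∈ A (i + 1), x = y + z
  disjoint : ∀ i, ∀ x ∈ A i, x ∈ A (i + 1) → x = 0
  ker_sq : ∀ x, D (D (D (D x))) = 0 → D (D x) = 0
  sq_decomp : ∀ x, ∃ y z, D (D y) = 0 ∧ x = y + D (D z)

/-- The degree `i` part of the cohomology `Ker D / (Ker D ∩ Im D)` of an odd operator. -/
abbrev OddCohomology {V : Type*} [AddCommGroup V] [Module R V] (D : V →ₗ[R] V)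
    (A : ZMod 2 → Submodule R V) (i : ZMod 2) : Type _ :=
  (A i ⊓ LinearMap.ker D : Submodule R V) ⧸
    (LinearMap.range D).comap (A i ⊓ LinearMap.ker D).subtype

theorem add_one_add_one (i : ZMod 2) : i + 1 + 1 = i := by
  rw [add_assoc, show (1 + 1 : ZMod 2) = 0 from rfl, add_zero]

namespace IsOddOperator

variable {V : Type*} [AddCommGroup V] [Module R V] {D : V →ₗ[R] V} {A : ZMod 2 → Submodule R V}

theorem exists_of_mem (h : IsOddOperator D A) {i : ZMod 2} {x y : V} (hx : x ∈ A i)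
    (hy : D y = x) : ∃ z ∈ A (i + 1), D z = x := by
  obtain ⟨u, hu, v, hv, rfl⟩ := h.decomp i y
  refine ⟨v, hv, ?_⟩
  have hDu := h.odd i u hu
  have hDv := h.odd _ v hv
  rw [add_one_add_one] at hDv
  have : D u = 0 := by
    refine h.disjoint i _ ?_ hDu
    have : D u = x - D v := by rw [← hy, map_add]; abel
    rw [this]
    exact Submodule.sub_mem _ hx hDv
  rw [← hy, map_add, this, zero_add]

theorem map_eq (h : IsOddOperator D A) (i : ZMod 2) :
    (A (i + 1)).map D = A i ⊓ LinearMap.range D := by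
  ext x
  constructor
  · rintro ⟨y, hy, rfl⟩
    have := h.odd _ y hy
    rw [add_one_add_one] at this
    exact ⟨this, y, rfl⟩
  · rintro ⟨hx, y, hy⟩
    obtain ⟨z, hz, hz'⟩ := h.exists_of_mem hx hy
    exact ⟨z, hz, hz'⟩

/-- On the image of `D²` the operator `D` is invertible, so it identifies the two halves. -/
theorem exists_equiv_map_map (h : IsOddOperator D A) (i : ZMod 2) :
    Nonempty (((A i).map D).map D ≃ₗ[R] ((A (i + 1)).map D).map D) := by
  have hmaps : ∀ x ∈ ((A i).map D).map D, D x ∈ ((A (i + 1)).map D).map D := by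
    rintro _ ⟨_, ⟨y, hy, rfl⟩, rfl⟩
    exact ⟨_, ⟨_, h.odd _ y hy, rfl⟩, rfl⟩
  refine ⟨LinearEquiv.ofBijective (D.restrict hmaps) ⟨?_, ?_⟩⟩
  · rw [injective_iff_map_eq_zero]
    rintro ⟨_, _, ⟨y, hy, rfl⟩, rfl⟩ h0
    have h1 : D (D (D y)) = 0 := congrArg Subtype.val h0
    exact Subtype.ext (h.ker_sq y (by rw [h1, map_zero]))
  · rintro ⟨_, _, ⟨y, hy, rfl⟩, rfl⟩
    obtain ⟨u, v, hu, hv⟩ := h.sq_decomp y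
    have e : D (D y) = D (D (D (D v))) := by rw [hv, map_add, map_add, hu, zero_add]
    obtain ⟨a, ha, b, hb, rfl⟩ := h.decomp (i + 1) v
    have hb0 : D (D (D (D b))) = 0 := by
      refine h.disjoint (i + 1) _ ?_ ?_
      · have : D (D (D (D b))) = D (D y) - D (D (D (D a))) := by
          rw [e]; simp only [map_add]; abel
        rw [this]
        have hy2 := h.odd _ _ (h.odd _ y hy)
        have ha2 := h.odd _ _ (h.odd _ _ (h.odd _ _ (h.odd _ a ha)))
        simp only [add_one_add_one] at hy2 ha2
        exact Submodule.sub_mem _ hy2 ha2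
      · have hb2 := h.odd _ _ (h.odd _ _ (h.odd _ _ (h.odd _ b hb)))
        simp only [add_one_add_one] at hb2 ⊢
        exact hb2
    have hDa := h.odd _ a ha
    rw [add_one_add_one] at hDa
    refine ⟨⟨D (D (D a)), ⟨_, ⟨_, hDa, rfl⟩, rfl⟩⟩, Subtype.ext ?_⟩
    change D (D (D (D a))) = D (D y)
    rw [e]
    simp only [map_add, hb0, add_zero]

/-- The kernel of `D` is the sum of the cohomology and the boundaries among the cycles. -/
theorem exists_equiv_ker [IsSemisimpleModule R V] (D : V →ₗ[R] V) (A : ZMod 2 → Submodule R V)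
    (i : ZMod 2) : Nonempty ((A i ⊓ LinearMap.ker D : Submodule R V) ≃ₗ[R]
      OddCohomology D A i × (A i ⊓ LinearMap.range D ⊓ LinearMap.ker D : Submodule R V)) := by
  obtain ⟨e⟩ := exists_equiv_prod_quotient
    ((LinearMap.range D).comap (A i ⊓ LinearMap.ker D).subtype)
  have h1 : ((LinearMap.range D).comap (A i ⊓ LinearMap.ker D).subtype).map
      (A i ⊓ LinearMap.ker D).subtype = A i ⊓ LinearMap.range D ⊓ LinearMap.ker D := by
    rw [Submodule.map_comap_subtype, inf_right_comm]
  exact ⟨e.trans ((LinearEquiv.prodComm R _ _).trans (LinearEquiv.prodCongr (LinearEquiv.refl R _)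
    ((Submodule.equivMapOfInjective _ (Submodule.injective_subtype _) _).trans
      (LinearEquiv.ofEq _ _ h1))))⟩

/-- `A i` is the sum of the cohomology in degree `i`, the boundaries among the cycles in both
degrees, and the part on which `D²` is invertible. -/
theorem exists_equiv_component [IsSemisimpleModule R V] (h : IsOddOperator D A) (i : ZMod 2) :
    Nonempty (A i ≃ₗ[R] (OddCohomology D A i ×
      (A i ⊓ LinearMap.range D ⊓ LinearMap.ker D : Submodule R V)) ×
      ((A (i + 1) ⊓ LinearMap.range D ⊓ LinearMap.ker D : Submodule R V) ×
        ((A i).map D).map D)) := by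
  obtain ⟨e1⟩ := exists_equiv_inf_ker_prod_map D (A i)
  obtain ⟨e2⟩ := exists_equiv_ker D A i
  obtain ⟨e3⟩ := exists_equiv_inf_ker_prod_map D ((A i).map D)
  have h3 : (A i).map D = A (i + 1) ⊓ LinearMap.range D := by
    have := h.map_eq (i + 1)
    rwa [add_one_add_one] at this
  have h4 : (A i).map D ⊓ LinearMap.ker D = A (i + 1) ⊓ LinearMap.range D ⊓ LinearMap.ker D := by
    rw [h3]
  exact ⟨e1.trans (e2.prodCongr (e3.trans ((LinearEquiv.ofEq _ _ h4).prodCongr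
    (LinearEquiv.refl R _))))⟩

/-- The Euler-Poincaré principle for an odd operator, without any finiteness of multiplicities. -/
theorem exists_equiv_index [IsSemisimpleModule R V] (h : IsOddOperator D A) :
    Nonempty ((A 0 × OddCohomology D A 1) ≃ₗ[R] (OddCohomology D A 0 × A 1)) := by
  obtain ⟨e0⟩ := h.exists_equiv_component 0
  obtain ⟨e1⟩ := h.exists_equiv_component 1
  obtain ⟨e⟩ := h.exists_equiv_map_map 0
  rw [zero_add] at e0 e
  rw [show (1 + 1 : ZMod 2) = 0 from rfl] at e1
  let s : ∀ {H H' C C' I I' : Type _} [AddCommGroup H] [AddCommGroup H'] [AddCommGroup C]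
      [AddCommGroup C'] [AddCommGroup I] [AddCommGroup I'] [Module R H] [Module R H']
      [Module R C] [Module R C'] [Module R I] [Module R I'] (_ : I ≃ₗ[R] I'),
      (((H × C) × (C' × I)) × H') ≃ₗ[R] (H × ((H' × C') × (C × I'))) := fun e =>
    { toFun := fun x => (x.1.1.1, ((x.2, x.1.2.1), (x.1.1.2, e x.1.2.2)))
      invFun := fun x => (((x.1, x.2.2.1), (x.2.1.2, e.symm x.2.2.2)), x.2.1.1)
      map_add' := fun x y => by simp
      map_smul' := fun c x => by simp
      left_inv := fun x => by simp
      right_inv := fun x => by simp }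
  exact ⟨(e0.prodCongr (LinearEquiv.refl R _)).trans ((s e).trans
    ((LinearEquiv.refl R _).prodCongr e1.symm))⟩

end IsOddOperator

end Semisimple

/-! ### The index in short exact sequences -/

section ExactSequence

variable {R : Type*} [Ring R]
variable {U V W : Type*} [AddCommGroup U] [Module R U] [AddCommGroup V] [Module R V]
  [AddCommGroup W] [Module R W]

/-- The map induced on cohomology by a graded linear map which commutes with the operators. -/
def OddCohomology.map {D : U →ₗ[R] U} {E : V →ₗ[R] V} {A : ZMod 2 → Submodule R U}
    {B : ZMod 2 → Submodule R V} (f : U →ₗ[R] V) (hf : ∀ x, f (D x) = E (f x))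
    (hA : ∀ i, ∀ x ∈ A i, f x ∈ B i) (i : ZMod 2) : OddCohomology D A i →ₗ[R] OddCohomology E B i :=
  Submodule.mapQ _ _ (f.restrict (p := A i ⊓ LinearMap.ker D) (q := B i ⊓ LinearMap.ker E)
    fun x hx => ⟨hA i x hx.1, by
      have h : D x = 0 := hx.2
      rw [SetLike.mem_coe, LinearMap.mem_ker, ← hf, h, map_zero]⟩) (by
    rintro ⟨_, hx⟩ ⟨y, rfl⟩
    exact ⟨f y, (hf y).symm⟩)

theorem OddCohomology.mk_eq_zero {D : U →ₗ[R] U} {A : ZMod 2 → Submodule R U} {i : ZMod 2}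
    (x : (A i ⊓ LinearMap.ker D : Submodule R U)) :
    (Submodule.Quotient.mk x : OddCohomology D A i) = 0 ↔ ∃ y, D y = x :=
  Submodule.Quotient.mk_eq_zero _

/-- A short exact sequence of modules with odd operators. -/
structure IsOddExact (DU : U →ₗ[R] U) (DV : V →ₗ[R] V) (DW : W →ₗ[R] W)
    (AU : ZMod 2 → Submodule R U) (AV : ZMod 2 → Submodule R V) (AW : ZMod 2 → Submodule R W)
    (f : U →ₗ[R] V) (g : V →ₗ[R] W) : Prop where
  left : IsOddOperator DU AU
  middle : IsOddOperator DV AV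
  right : IsOddOperator DW AW
  f_comm : ∀ x, f (DU x) = DV (f x)
  g_comm : ∀ x, g (DV x) = DW (g x)
  f_mem : ∀ i, ∀ x ∈ AU i, f x ∈ AV i
  g_mem : ∀ i, ∀ x ∈ AV i, g x ∈ AW i
  inj : Function.Injective f
  exact : Function.Exact f g
  surj : Function.Surjective g

namespace IsOddExact

variable {DU : U →ₗ[R] U} {DV : V →ₗ[R] V} {DW : W →ₗ[R] W}
    {AU : ZMod 2 → Submodule R U} {AV : ZMod 2 → Submodule R V} {AW : ZMod 2 → Submodule R W}
    {f : U →ₗ[R] V} {g : V →ₗ[R] W}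

theorem mem_of_f_mem (h : IsOddExact DU DV DW AU AV AW f g)
    {i : ZMod 2} {a : U} (ha : f a ∈ AV i) : a ∈ AU i := by
  obtain ⟨y, hy, z, hz, rfl⟩ := h.left.decomp i a
  have : f z = 0 := by
    refine h.middle.disjoint i _ ?_ (h.f_mem _ z hz)
    have e : f z = f (y + z) - f y := by rw [map_add]; abel
    rw [e]
    exact Submodule.sub_mem _ ha (h.f_mem i y hy)
  have hz0 : z = 0 := h.inj (by rw [this, map_zero])
  rwa [hz0, add_zero]

theorem exists_f (h : IsOddExact DU DV DW AU AV AW f g)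
    {i : ZMod 2} {b : V} (hb : b ∈ AV i) (hg : g b = 0) : ∃ a ∈ AU i, f a = b := by
  obtain ⟨a, rfl⟩ := (h.exact b).1 hg
  exact ⟨a, h.mem_of_f_mem hb, rfl⟩

theorem exists_g (h : IsOddExact DU DV DW AU AV AW f g)
    {i : ZMod 2} {c : W} (hc : c ∈ AW i) : ∃ b ∈ AV i, g b = c := by
  obtain ⟨b, rfl⟩ := h.surj c
  obtain ⟨y, hy, z, hz, rfl⟩ := h.middle.decomp i b
  refine ⟨y, hy, ?_⟩
  have : g z = 0 := by
    refine h.right.disjoint i _ ?_ (h.g_mem _ z hz)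
    have e : g z = g (y + z) - g y := by rw [map_add]; abel
    rw [e]
    exact Submodule.sub_mem _ hc (h.g_mem i y hy)
  rw [map_add, this, add_zero]

/-- Taking kernels of the squares of the operators is exact. -/
theorem exists_g_of_sq (h : IsOddExact DU DV DW AU AV AW f g)
    {i : ZMod 2} {c : W} (hc : c ∈ AW i) (hc2 : DW (DW c) = 0) :
    ∃ b ∈ AV i, DV (DV b) = 0 ∧ g b = c := by
  obtain ⟨b, hb, rfl⟩ := h.exists_g hc
  obtain ⟨y, z, hy, rfl⟩ := h.middle.sq_decomp b
  have e : g (y + DV (DV z)) = g y := by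
    have h1 : DW (DW (DW (DW (g z)))) = 0 := by
      have h2 : DW (DW (g y)) = 0 := by rw [← h.g_comm, ← h.g_comm, hy, map_zero]
      rw [map_add, map_add, map_add, h2, zero_add] at hc2
      rwa [h.g_comm, h.g_comm] at hc2
    rw [map_add, h.g_comm, h.g_comm, h.right.ker_sq _ h1, add_zero]
  obtain ⟨u, hu, v, hv, rfl⟩ := h.middle.decomp i y
  have hu2 := h.middle.odd _ _ (h.middle.odd _ u hu)
  have hv2 := h.middle.odd _ _ (h.middle.odd _ v hv)
  rw [add_one_add_one] at hu2 hv2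
  have hsum : DV (DV u) + DV (DV v) = 0 := by rw [← map_add, ← map_add, hy]
  have hu0 : DV (DV u) = 0 := by
    refine h.middle.disjoint i _ hu2 ?_
    rw [eq_neg_of_add_eq_zero_left hsum]
    exact Submodule.neg_mem _ hv2
  have hv0 : g v = 0 := by
    refine h.right.disjoint i _ ?_ (h.g_mem _ v hv)
    have e2 : g v = g (u + v + DV (DV z)) - g u := by rw [e, map_add]; abel
    rw [e2]
    exact Submodule.sub_mem _ (h.g_mem _ _ hb) (h.g_mem _ _ hu)
  exact ⟨u, hu, hu0, by rw [e, map_add, hv0, add_zero]⟩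

theorem range_map_eq_ker_map (h : IsOddExact DU DV DW AU AV AW f g) (i : ZMod 2) :
    LinearMap.range (OddCohomology.map f h.f_comm h.f_mem i) =
      LinearMap.ker (OddCohomology.map g h.g_comm h.g_mem i) := by
  ext x
  constructor
  · rintro ⟨y, rfl⟩
    obtain ⟨⟨a, ha⟩, rfl⟩ := Submodule.Quotient.mk_surjective _ y
    refine (OddCohomology.mk_eq_zero _).2 ⟨0, ?_⟩
    rw [map_zero]
    exact ((h.exact _).2 ⟨a, rfl⟩).symm
  · obtain ⟨⟨b, hb, hb0⟩, rfl⟩ := Submodule.Quotient.mk_surjective _ x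
    intro hx
    obtain ⟨c', hc'⟩ := (OddCohomology.mk_eq_zero _).1 hx
    change DW c' = g b at hc'
    rw [SetLike.mem_coe, LinearMap.mem_ker] at hb0
    obtain ⟨c, hc, hcb⟩ := h.right.exists_of_mem (h.g_mem i b hb) hc'
    have hc2 : DW (DW c) = 0 := by rw [hcb, ← h.g_comm, hb0, map_zero]
    obtain ⟨b', hb', hb2, rfl⟩ := h.exists_g_of_sq hc hc2
    have hDb' := h.middle.odd _ _ hb'
    rw [add_one_add_one] at hDb'
    obtain ⟨a, ha, hab⟩ := h.exists_f (Submodule.sub_mem _ hb hDb')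
      (by rw [map_sub, h.g_comm, hcb, sub_self])
    have haD : DU a = 0 := h.inj (by rw [h.f_comm, hab, map_sub, hb0, hb2, sub_zero, map_zero])
    refine ⟨Submodule.Quotient.mk ⟨a, ha, haD⟩, ?_⟩
    refine (Submodule.Quotient.eq _).2 ⟨-b', ?_⟩
    change DV (-b') = f a - b
    rw [hab, map_neg]
    abel

/-- The connecting homomorphism identifies the cokernel of `H(V) → H(W)` with the kernel of
`H(U) → H(V)` in the other degree. -/
theorem exists_equiv_coker_ker (h : IsOddExact DU DV DW AU AV AW f g) (i : ZMod 2) :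
    Nonempty ((OddCohomology DW AW i ⧸
        LinearMap.range (OddCohomology.map g h.g_comm h.g_mem i)) ≃ₗ[R]
      LinearMap.ker (OddCohomology.map f h.f_comm h.f_mem (i + 1))) := by
  -- the connecting homomorphism is induced by the correspondence between `g b` and `f⁻¹ (D b)`
  let M : Submodule R V := AV i ⊓ LinearMap.ker (DV ∘ₗ DV) ⊓ LinearMap.ker (g ∘ₗ DV)
  let p : M →ₗ[R] (AW i ⊓ LinearMap.ker DW : Submodule R W) :=
    g.restrict fun b hb => ⟨h.g_mem i b hb.1.1, by
      have : g (DV b) = 0 := hb.2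
      rw [SetLike.mem_coe, LinearMap.mem_ker, ← h.g_comm, this]⟩
  let j := LinearEquiv.ofInjective f h.inj
  have hM : ∀ b ∈ M, DV b ∈ LinearMap.range f := fun b hb => (h.exact _).1 hb.2
  have hj : ∀ b : M, f (j.symm ⟨DV b, hM b b.2⟩) = DV b := fun b =>
    congrArg Subtype.val (j.apply_symm_apply ⟨DV b, hM b b.2⟩)
  let q : M →ₗ[R] (AU (i + 1) ⊓ LinearMap.ker DU : Submodule R U) :=
    LinearMap.codRestrict _ (j.symm.toLinearMap ∘ₗ DV.restrict hM) fun b => by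
      refine ⟨h.mem_of_f_mem ?_, h.inj ?_⟩
      · have e : f ((j.symm.toLinearMap ∘ₗ DV.restrict hM) b) = DV b := hj b
        rw [e]
        exact h.middle.odd _ _ b.2.1.1
      · have e : f ((j.symm.toLinearMap ∘ₗ DV.restrict hM) b) = DV b := hj b
        rw [h.f_comm, e, map_zero]
        exact b.2.1.2
  have hq : ∀ b : M, f (q b) = DV b := hj
  let P : M →ₗ[R] (OddCohomology DW AW i ⧸
      LinearMap.range (OddCohomology.map g h.g_comm h.g_mem i)) :=
    Submodule.mkQ _ ∘ₗ Submodule.mkQ _ ∘ₗ p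
  let Q : M →ₗ[R] OddCohomology DU AU (i + 1) := Submodule.mkQ _ ∘ₗ q
  have hP : Function.Surjective P := by
    intro x
    obtain ⟨x, rfl⟩ := Submodule.Quotient.mk_surjective _ x
    obtain ⟨⟨c, hc, hc0⟩, rfl⟩ := Submodule.Quotient.mk_surjective _ x
    rw [SetLike.mem_coe, LinearMap.mem_ker] at hc0
    obtain ⟨b, hb, hb2, rfl⟩ := h.exists_g_of_sq hc (by rw [hc0, map_zero])
    exact ⟨⟨b, ⟨hb, hb2⟩, by
      rw [SetLike.mem_coe, LinearMap.mem_ker, LinearMap.comp_apply, h.g_comm, hc0]⟩, rfl⟩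
  have hQ : LinearMap.range Q = LinearMap.ker (OddCohomology.map f h.f_comm h.f_mem (i + 1)) := by
    ext x
    constructor
    · rintro ⟨b, rfl⟩
      exact (OddCohomology.mk_eq_zero _).2 ⟨b, (hq b).symm⟩
    · obtain ⟨⟨a, ha, ha0⟩, rfl⟩ := Submodule.Quotient.mk_surjective _ x
      intro hx
      obtain ⟨b', hb'⟩ := (OddCohomology.mk_eq_zero _).1 hx
      change DV b' = f a at hb'
      rw [SetLike.mem_coe, LinearMap.mem_ker] at ha0
      obtain ⟨b, hb, hba⟩ := h.middle.exists_of_mem (h.f_mem _ a ha) hb'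
      rw [add_one_add_one] at hb
      have hbM : b ∈ M := by
        refine ⟨⟨hb, ?_⟩, ?_⟩
        · rw [SetLike.mem_coe, LinearMap.mem_ker, LinearMap.comp_apply, hba, ← h.f_comm, ha0,
            map_zero]
        · rw [SetLike.mem_coe, LinearMap.mem_ker, LinearMap.comp_apply, hba]
          exact (h.exact _).2 ⟨a, rfl⟩
      refine ⟨⟨b, hbM⟩, congrArg _ (Subtype.ext (h.inj ?_))⟩
      rw [hq]
      exact hba
  have hker : LinearMap.ker P = LinearMap.ker Q := by
    ext ⟨b, ⟨hb, hb2⟩, hgb⟩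
    have hb2' : DV (DV b) = 0 := hb2
    have hgb' : g (DV b) = 0 := hgb
    constructor
    · intro hx
      obtain ⟨y, hy⟩ := (Submodule.Quotient.mk_eq_zero _).1 hx
      obtain ⟨⟨z, hz, hz0⟩, rfl⟩ := Submodule.Quotient.mk_surjective _ y
      obtain ⟨c', hc'⟩ := (Submodule.Quotient.eq _).1 hy
      change DW c' = g z - g b at hc'
      rw [SetLike.mem_coe, LinearMap.mem_ker] at hz0
      obtain ⟨c, hc, hcb⟩ := h.right.exists_of_mem
        (Submodule.sub_mem _ (h.g_mem i z hz) (h.g_mem i b hb)) hc'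
      obtain ⟨b', hb', hb'2, rfl⟩ := h.exists_g_of_sq hc (by
        rw [hcb, map_sub, ← h.g_comm, ← h.g_comm, hz0, hgb', map_zero, sub_zero])
      obtain ⟨a, ha⟩ := (h.exact (b - z + DV b')).1 (by
        rw [map_add, map_sub, h.g_comm, hcb]; abel)
      refine (OddCohomology.mk_eq_zero _).2 ⟨a, h.inj ?_⟩
      rw [hq, h.f_comm, ha, map_add, map_sub, hz0, hb'2, sub_zero, add_zero]
    · intro hx
      obtain ⟨a', ha'⟩ := (OddCohomology.mk_eq_zero _).1 hx
      obtain ⟨a, ha, haa⟩ := h.left.exists_of_mem (q ⟨b, ⟨hb, hb2⟩, hgb⟩).2.1 ha'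
      rw [add_one_add_one] at ha
      have hfa : DV (f a) = DV b := by rw [← h.f_comm, haa, hq]
      refine (Submodule.Quotient.mk_eq_zero _).2 ⟨Submodule.Quotient.mk
        ⟨b - f a, Submodule.sub_mem _ hb (h.f_mem _ a ha), ?_⟩, congrArg _ (Subtype.ext ?_)⟩
      · rw [SetLike.mem_coe, LinearMap.mem_ker, map_sub, hfa, sub_self]
      · change g (b - f a) = g b
        rw [map_sub, (h.exact _).2 ⟨a, rfl⟩, sub_zero]
  exact ⟨((P.quotKerEquivOfSurjective hP).symm.trans (Submodule.quotEquivOfEq _ _ hker)).trans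
    (Q.quotKerEquivRange.trans (LinearEquiv.ofEq _ _ hQ))⟩

/-- The index is additive in short exact sequences: the six-term exact sequence in cohomology
splits, and each kernel and image in it occurs once in an even and once in an odd place. -/
theorem exists_equiv_index (h : IsOddExact DU DV DW AU AV AW f g)
    [IsSemisimpleModule R U] [IsSemisimpleModule R V] [IsSemisimpleModule R W] :
    Nonempty ((OddCohomology DV AV 0 × (OddCohomology DU AU 1 × OddCohomology DW AW 1)) ≃ₗ[R]
      ((OddCohomology DU AU 0 × OddCohomology DW AW 0) × OddCohomology DV AV 1)) := by
  let α := OddCohomology.map f h.f_comm h.f_mem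
  let β := OddCohomology.map g h.g_comm h.g_mem
  have hαβ : ∀ i, LinearMap.range (α i) = LinearMap.ker (β i) := h.range_map_eq_ker_map
  obtain ⟨a0⟩ := exists_equiv_ker_prod_range (α 0)
  obtain ⟨a1⟩ := exists_equiv_ker_prod_range (α 1)
  obtain ⟨b0⟩ := exists_equiv_ker_prod_range (β 0)
  obtain ⟨b1⟩ := exists_equiv_ker_prod_range (β 1)
  rw [← hαβ] at b0 b1
  obtain ⟨c0⟩ := exists_equiv_prod_quotient (LinearMap.range (β 0))
  obtain ⟨c1⟩ := exists_equiv_prod_quotient (LinearMap.range (β 1))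
  obtain ⟨d0⟩ : Nonempty ((OddCohomology DW AW 0 ⧸ LinearMap.range (β 0)) ≃ₗ[R]
    LinearMap.ker (α (0 + 1))) := h.exists_equiv_coker_ker 0
  obtain ⟨d1⟩ : Nonempty ((OddCohomology DW AW 1 ⧸ LinearMap.range (β 1)) ≃ₗ[R]
    LinearMap.ker (α (1 + 1))) := h.exists_equiv_coker_ker 1
  rw [zero_add] at d0
  rw [show (1 + 1 : ZMod 2) = 0 from rfl] at d1
  let e0 := c0.trans ((LinearEquiv.refl R _).prodCongr d0)
  let e1 := c1.trans ((LinearEquiv.refl R _).prodCongr d1)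
  let s : ∀ {k0 k1 m0 m1 n0 n1 : Type _} [AddCommGroup k0] [AddCommGroup k1] [AddCommGroup m0]
      [AddCommGroup m1] [AddCommGroup n0] [AddCommGroup n1] [Module R k0] [Module R k1]
      [Module R m0] [Module R m1] [Module R n0] [Module R n1],
      ((m0 × n0) × ((k1 × m1) × (n1 × k0))) ≃ₗ[R] (((k0 × m0) × (n0 × k1)) × (m1 × n1)) :=
    { toFun := fun x => (((x.2.2.2, x.1.1), (x.1.2, x.2.1.1)), (x.2.1.2, x.2.2.1))
      invFun := fun x => ((x.1.1.2, x.1.2.1), ((x.1.2.2, x.2.1), (x.2.2, x.1.1.1)))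
      map_add' := fun x y => rfl
      map_smul' := fun c x => rfl
      left_inv := fun x => rfl
      right_inv := fun x => rfl }
  exact ⟨(b0.prodCongr (a1.prodCongr e1)).trans
    (s.trans ((a0.prodCongr e0).prodCongr b1).symm)⟩

end IsOddExact

end ExactSequence

/-! ### Representations as modules over the group algebra -/

section Bridge

variable {H : Type*} [Group H]

/-- The module of a direct sum of representations is the direct sum of the modules. -/
def asModuleProd {A C : Type*} [AddCommGroup A] [Module ℂ A] [AddCommGroup C] [Module ℂ C]
    (a : Representation ℂ H A) (c : Representation ℂ H C) :
    (a.prod c).asModule ≃ₗ[MonoidAlgebra ℂ H] a.asModule × c.asModule :=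
  LinearEquiv.ofBijective
    (LinearMap.prod
      (Representation.IntertwiningMap.equivLinearMapAsModule _ _
        (Representation.IntertwiningMap.fst ℂ a c))
      (Representation.IntertwiningMap.equivLinearMapAsModule _ _
        (Representation.IntertwiningMap.snd ℂ a c)))
    ⟨fun _ _ h => Prod.ext (congrArg Prod.fst h) (congrArg Prod.snd h), fun x => ⟨x, rfl⟩⟩

/-- Additive maps which commute with the elements `a • g` are linear over the group algebra. -/
def linearMapOfSingle {A C : Type*} [AddCommGroup A] [Module (MonoidAlgebra ℂ H) A]
    [AddCommGroup C] [Module (MonoidAlgebra ℂ H) C] (f : A →+ C)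
    (hf : ∀ (g : H) (a : ℂ) (v : A),
      f (MonoidAlgebra.single g a • v) = MonoidAlgebra.single g a • f v) :
    A →ₗ[MonoidAlgebra ℂ H] C where
  toFun := f
  map_add' := f.map_add
  map_smul' r v := by
    rw [RingHom.id_apply]
    induction r using MonoidAlgebra.induction_linear with
    | zero => rw [zero_smul, zero_smul, map_zero]
    | add r s hr hs => rw [add_smul, add_smul, map_add, hr, hs]
    | single g a => exact hf g a v

theorem nonempty_equiv_of_asModule {A C : Type*} [AddCommGroup A] [Module ℂ A] [AddCommGroup C]
    [Module ℂ C] {a : Representation ℂ H A} {c : Representation ℂ H C}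
    (e : a.asModule ≃ₗ[MonoidAlgebra ℂ H] c.asModule) : Nonempty (a.Equiv c) :=
  ⟨Representation.IntertwiningMap.ofBijective
    ((Representation.IntertwiningMap.equivLinearMapAsModule a c).symm e.toLinearMap) e.bijective⟩

theorem virtualEq_of_asModule {A A' C C' : Type*} [AddCommGroup A] [Module ℂ A] [AddCommGroup A']
    [Module ℂ A'] [AddCommGroup C] [Module ℂ C] [AddCommGroup C'] [Module ℂ C']
    {a : Representation ℂ H A} {a' : Representation ℂ H A'}
    {c : Representation ℂ H C} {c' : Representation ℂ H C'}
    (e : (a.asModule × c'.asModule) ≃ₗ[MonoidAlgebra ℂ H] (c.asModule × a'.asModule)) :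
    VirtualEq a a' c c' :=
  nonempty_equiv_of_asModule ((asModuleProd a c').trans (e.trans (asModuleProd c a').symm))

end Bridge

/-- A surjection from the cycles which kills exactly the boundaries computes the cohomology. -/
def OddCohomology.equivOfSurjective {R : Type*} [Ring R] {V C : Type*} [AddCommGroup V] [Module R V]
    [AddCommGroup C] [Module R C] {D : V →ₗ[R] V} {A : ZMod 2 → Submodule R V} {i : ZMod 2}
    (f : (A i ⊓ LinearMap.ker D : Submodule R V) →ₗ[R] C) (hf : Function.Surjective f)
    (h : ∀ v, f v = 0 ↔ ∃ y, D y = v.1) : OddCohomology D A i ≃ₗ[R] C :=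
  (Submodule.quotEquivOfEq _ (LinearMap.ker f) (by ext v; exact (h v).symm)).trans
    (f.quotKerEquivOfSurjective hf)

namespace RealReductiveGroup

variable {n : ℕ} {G : Type*} [Group G] [TopologicalSpace G] [IsTopologicalGroup G]
  {R : RealReductiveGroup n G} (P : Polarization R.Bp) {ι : Type*} [Fintype ι] [DecidableEq ι]
  (β : R.DualBases ι)

namespace GKModule

variable {X : Type*} [AddCommGroup X] [Module ℂ X] (M : R.GKModule X)

/-- The Dirac operator as an endomorphism of a module over the group algebra of `K̃`. -/
def diracMod : (M.tensorSpin P).asModule →ₗ[MonoidAlgebra ℂ R.Ktilde] (M.tensorSpin P).asModule :=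
  Representation.IntertwiningMap.equivLinearMapAsModule _ _
    ⟨M.diracOp P β, fun x => (M.diracOp_comm P β x).symm⟩

theorem lTensor_tensorHalfSpin (i : ZMod 2) (x : R.Ktilde) (w : X ⊗[ℂ] P.half i) :
    (P.half i).subtype.lTensor X (M.tensorHalfSpin P i x w) =
      M.tensorSpin P x ((P.half i).subtype.lTensor X w) := by
  induction w with
  | zero => simp
  | tmul a s => rfl
  | add a b ha hb => rw [map_add, map_add, ha, hb, map_add, map_add]

/-- The inclusion of `X ⊗ S±` in `X ⊗ S`, as a map of modules over the group algebra of `K̃`. -/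
def halfInclusion (i : ZMod 2) : (M.tensorHalfSpin P i).asModule →ₗ[MonoidAlgebra ℂ R.Ktilde]
    (M.tensorSpin P).asModule :=
  Representation.IntertwiningMap.equivLinearMapAsModule _ _
    ⟨(P.half i).subtype.lTensor X, fun x => LinearMap.ext (M.lTensor_tensorHalfSpin P i x)⟩

theorem halfInclusion_injective (i : ZMod 2) : Function.Injective (M.halfInclusion P i) :=
  Module.Flat.lTensor_preserves_injective_linearMap (M := X) (P.half i).subtype
    (P.half i).injective_subtype

/-- The image of `X ⊗ S±` in `X ⊗ S`, as a submodule over the group algebra of `K̃`. -/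
def halfMod (i : ZMod 2) : Submodule (MonoidAlgebra ℂ R.Ktilde) (M.tensorSpin P).asModule :=
  LinearMap.range (M.halfInclusion P i)

/-- The module `X ⊗ S±` is isomorphic to its image in `X ⊗ S`. -/
def halfModEquiv (i : ZMod 2) : (M.tensorHalfSpin P i).asModule ≃ₗ[MonoidAlgebra ℂ R.Ktilde]
    M.halfMod P i :=
  LinearEquiv.ofInjective _ (M.halfInclusion_injective P i)

/-- The map from the cycles in `X ⊗ S±` to the Dirac cohomology, as an additive map. -/
def cycleAddHom (i : ZMod 2) : (M.halfMod P i ⊓ LinearMap.ker (M.diracMod P β) :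
      Submodule (MonoidAlgebra ℂ R.Ktilde) (M.tensorSpin P).asModule)
    →+ M.cohomologyHalf P β i where
  toFun v := ⟨Submodule.Quotient.mk ⟨v.1, v.2.2⟩, ⟨v.1, v.2.2⟩, v.2.1, rfl⟩
  map_zero' := rfl
  map_add' _ _ := rfl

theorem cycleAddHom_smul (i : ZMod 2) (x : R.Ktilde) (a : ℂ)
    (v : (M.halfMod P i ⊓ LinearMap.ker (M.diracMod P β) :
      Submodule (MonoidAlgebra ℂ R.Ktilde) (M.tensorSpin P).asModule)) :
    M.cycleAddHom P β i (MonoidAlgebra.single x a • v) =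
      a • M.cohomologyHalfRep P β i x (M.cycleAddHom P β i v) := by
  have h : (MonoidAlgebra.single x a • v.1 : (M.tensorSpin P).asModule) =
      (a • M.tensorSpin P x v.1 : X ⊗[ℂ] P.Spinor) :=
    Representation.single_smul _ _ _ _
  refine Subtype.ext ?_
  change (Submodule.Quotient.mk _ : M.DiracCohomology P β) = Submodule.Quotient.mk _
  exact congrArg _ (Subtype.ext h)

/-- The map from the cycles in `X ⊗ S±` to the Dirac cohomology. -/
def cycleMap (i : ZMod 2) : (M.halfMod P i ⊓ LinearMap.ker (M.diracMod P β) :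
      Submodule (MonoidAlgebra ℂ R.Ktilde) (M.tensorSpin P).asModule)
    →ₗ[MonoidAlgebra ℂ R.Ktilde] (M.cohomologyHalfRep P β i).asModule :=
  linearMapOfSingle (C := (M.cohomologyHalfRep P β i).asModule) (M.cycleAddHom P β i)
    fun x a v => (M.cycleAddHom_smul P β i x a v).trans
      (Representation.single_smul (M.cohomologyHalfRep P β i) _ _ _).symm

theorem cycleMap_surjective (i : ZMod 2) : Function.Surjective (M.cycleMap P β i) := by
  rintro ⟨_, ⟨⟨v, hv⟩, hv', rfl⟩⟩
  exact ⟨⟨v, hv', hv⟩, rfl⟩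

theorem cycleAddHom_eq_zero (i : ZMod 2) (v : (M.halfMod P i ⊓ LinearMap.ker (M.diracMod P β) :
      Submodule (MonoidAlgebra ℂ R.Ktilde) (M.tensorSpin P).asModule)) :
    M.cycleAddHom P β i v = 0 ↔ ∃ y, M.diracMod P β y = v.1 := by
  rw [← Submodule.coe_eq_zero]
  exact Submodule.Quotient.mk_eq_zero _

/-- The Dirac cohomology of `X` is the cohomology of the odd operator `D`. -/
def cohomologyEquiv (i : ZMod 2) : OddCohomology (M.diracMod P β) (M.halfMod P) i
    ≃ₗ[MonoidAlgebra ℂ R.Ktilde] (M.cohomologyHalfRep P β i).asModule :=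
  OddCohomology.equivOfSurjective (C := (M.cohomologyHalfRep P β i).asModule) (M.cycleMap P β i)
    (M.cycleMap_surjective P β i)
    (M.cycleAddHom_eq_zero P β i)

/-- The Euler-Poincaré principle for the Dirac operator. -/
theorem virtualEq_of_isOddOperator
    [IsSemisimpleModule (MonoidAlgebra ℂ R.Ktilde) (M.tensorSpin P).asModule]
    (h : IsOddOperator (M.diracMod P β) (M.halfMod P)) :
    VirtualEq (M.tensorHalfSpin P 0) (M.tensorHalfSpin P 1)
        (M.cohomologyHalfRep P β 0) (M.cohomologyHalfRep P β 1) := by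
  obtain ⟨e⟩ := h.exists_equiv_index
  exact virtualEq_of_asModule
    (((M.halfModEquiv P 0).prodCongr (M.cohomologyEquiv P β 1).symm).trans
      (e.trans ((M.cohomologyEquiv P β 0).prodCongr (M.halfModEquiv P 1).symm)))

variable {M} in
/-- The map `X ⊗ S → Y ⊗ S` induced by a homomorphism of `(𝔤, K)`-modules, over the group algebra
of `K̃`. -/
def homMod {Y : Type*} [AddCommGroup Y] [Module ℂ Y] {N : R.GKModule Y} {f : X →ₗ[ℂ] Y}
    (hf : IsGKHom M N f) : (M.tensorSpin P).asModule →ₗ[MonoidAlgebra ℂ R.Ktilde]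
      (N.tensorSpin P).asModule :=
  Representation.IntertwiningMap.equivLinearMapAsModule _ _
    ⟨f.rTensor P.Spinor, fun x => TensorProduct.ext' fun y s => by
      have h : (f.rTensor P.Spinor) (M.tensorSpin P x (y ⊗ₜ s)) =
          f (M.rep (R.KtildeToK x) y) ⊗ₜ[ℂ] spinRep P x s := rfl
      change (f.rTensor P.Spinor) (M.tensorSpin P x (y ⊗ₜ s)) =
          N.rep (R.KtildeToK x) (f y) ⊗ₜ[ℂ] spinRep P x s
      rw [h, hf.2]⟩

theorem homMod_diracMod {Y : Type*} [AddCommGroup Y] [Module ℂ Y] {N : R.GKModule Y}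
    {f : X →ₗ[ℂ] Y} (hf : IsGKHom M N f) (v : (M.tensorSpin P).asModule) :
    homMod P hf (M.diracMod P β v) = N.diracMod P β (homMod P hf v) := by
  change (f.rTensor P.Spinor ∘ₗ M.diracOp P β) v = (N.diracOp P β ∘ₗ f.rTensor P.Spinor) v
  refine LinearMap.congr_fun (TensorProduct.ext' fun y s => ?_) v
  simp only [diracOp_eq, LinearMap.comp_apply, LinearMap.sum_apply, TensorProduct.map_tmul,
    LinearMap.rTensor_tmul, map_sum, hf.1]

theorem homMod_mem {Y : Type*} [AddCommGroup Y] [Module ℂ Y] {N : R.GKModule Y}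
    {f : X →ₗ[ℂ] Y} (hf : IsGKHom M N f) (i : ZMod 2) (v : (M.tensorSpin P).asModule)
    (hv : v ∈ M.halfMod P i) : homMod P hf v ∈ N.halfMod P i := by
  obtain ⟨w, rfl⟩ := hv
  refine ⟨f.rTensor (P.half i) w, ?_⟩
  change ((P.half i).subtype.lTensor Y ∘ₗ f.rTensor (P.half i)) w =
    (f.rTensor P.Spinor ∘ₗ (P.half i).subtype.lTensor X) w
  rw [LinearMap.lTensor_comp_rTensor, LinearMap.rTensor_comp_lTensor]

theorem isOddExact {U V W : Type*} [AddCommGroup U] [Module ℂ U] [AddCommGroup V] [Module ℂ V]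
    [AddCommGroup W] [Module ℂ W] {MU : R.GKModule U} {MV : R.GKModule V} {MW : R.GKModule W}
    {f : U →ₗ[ℂ] V} {g : V →ₗ[ℂ] W} (hf : IsGKHom MU MV f) (hg : IsGKHom MV MW g)
    (hi : Function.Injective f) (he : Function.Exact f g) (hs : Function.Surjective g)
    (hU : IsOddOperator (MU.diracMod P β) (MU.halfMod P))
    (hV : IsOddOperator (MV.diracMod P β) (MV.halfMod P))
    (hW : IsOddOperator (MW.diracMod P β) (MW.halfMod P)) :
    IsOddExact (MU.diracMod P β) (MV.diracMod P β) (MW.diracMod P β) (MU.halfMod P)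
      (MV.halfMod P) (MW.halfMod P) (homMod P hf) (homMod P hg) where
  left := hU
  middle := hV
  right := hW
  f_comm := MU.homMod_diracMod P β hf
  g_comm := MV.homMod_diracMod P β hg
  f_mem := MU.homMod_mem P hf
  g_mem := MV.homMod_mem P hg
  inj := Module.Flat.rTensor_preserves_injective_linearMap (M := P.Spinor) f hi
  exact := rTensor_exact P.Spinor he hs
  surj := LinearMap.rTensor_surjective P.Spinor hs

/-- The six-term exact sequence for the Dirac operators of a short exact sequence gives the
additivity of the Dirac index. -/
theorem virtualEq_of_isOddExact {U V W : Type*} [AddCommGroup U] [Module ℂ U] [AddCommGroup V]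
    [Module ℂ V] [AddCommGroup W] [Module ℂ W] {MU : R.GKModule U} {MV : R.GKModule V}
    {MW : R.GKModule W} {f : U →ₗ[ℂ] V} {g : V →ₗ[ℂ] W} {hf : IsGKHom MU MV f}
    {hg : IsGKHom MV MW g}
    [IsSemisimpleModule (MonoidAlgebra ℂ R.Ktilde) (MU.tensorSpin P).asModule]
    [IsSemisimpleModule (MonoidAlgebra ℂ R.Ktilde) (MV.tensorSpin P).asModule]
    [IsSemisimpleModule (MonoidAlgebra ℂ R.Ktilde) (MW.tensorSpin P).asModule]
    (h : IsOddExact (MU.diracMod P β) (MV.diracMod P β) (MW.diracMod P β) (MU.halfMod P)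
      (MV.halfMod P) (MW.halfMod P) (homMod P hf) (homMod P hg)) :
    VirtualEq (MV.cohomologyHalfRep P β 0) (MV.cohomologyHalfRep P β 1)
        ((MU.cohomologyHalfRep P β 0).prod (MW.cohomologyHalfRep P β 0))
        ((MU.cohomologyHalfRep P β 1).prod (MW.cohomologyHalfRep P β 1)) := by
  obtain ⟨e⟩ := h.exists_equiv_index
  let eU := MU.cohomologyEquiv P β
  let eV := MV.cohomologyEquiv P β
  let eW := MW.cohomologyEquiv P β
  exact virtualEq_of_asModule
    (((LinearEquiv.refl _ _).prodCongr (asModuleProd _ _)).trans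
      ((((eV 0).prodCongr ((eU 1).prodCongr (eW 1))).symm.trans
        (e.trans (((eU 0).prodCongr (eW 0)).prodCongr (eV 1)))).trans
        ((asModuleProd _ _).symm.prodCongr (LinearEquiv.refl _ _))))

end GKModule
end RealReductiveGroup

/-! ### One-parameter subgroups and compactness of `K` -/

section Exponential

open Filter Topology

theorem norm_pow_sub_pow_le {𝔸 : Type*} [NormedRing 𝔸] [NormOneClass 𝔸] {a b : 𝔸} {r : ℝ}
    (hr : 1 ≤ r) (ha : ‖a‖ ≤ r) (hb : ‖b‖ ≤ r) (m : ℕ) :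
    ‖a ^ m - b ^ m‖ ≤ m * ‖a - b‖ * r ^ m := by
  induction m with
  | zero => simp
  | succ m ih =>
    have e : a ^ (m + 1) - b ^ (m + 1) = a ^ m * (a - b) + (a ^ m - b ^ m) * b := by
      rw [pow_succ, pow_succ]; noncomm_ring
    have h1 : ‖a ^ m * (a - b)‖ ≤ r ^ m * ‖a - b‖ :=
      (norm_mul_le _ _).trans (mul_le_mul_of_nonneg_right
        ((norm_pow_le a m).trans (pow_le_pow_left₀ (norm_nonneg _) ha m)) (norm_nonneg _))
    have h2 : ‖(a ^ m - b ^ m) * b‖ ≤ (m * ‖a - b‖ * r ^ m) * r :=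
      (norm_mul_le _ _).trans (mul_le_mul ih hb (norm_nonneg _) (by positivity))
    have h3 : r ^ m * ‖a - b‖ ≤ r ^ m * r * ‖a - b‖ :=
      mul_le_mul_of_nonneg_right (le_mul_of_one_le_right (by positivity) hr) (norm_nonneg _)
    rw [e, pow_succ]
    push_cast
    refine (norm_add_le _ _).trans ?_
    linarith

theorem norm_exp_le_exp_norm {𝔸 : Type*} [NormedRing 𝔸] [NormOneClass 𝔸] [NormedAlgebra ℝ 𝔸]
    [CompleteSpace 𝔸] (x : 𝔸) : ‖NormedSpace.exp x‖ ≤ Real.exp ‖x‖ := by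
  have h1 := NormedSpace.exp_series_hasSum_exp' (𝕂 := ℝ) x
  have h2 := NormedSpace.exp_series_hasSum_exp' (𝕂 := ℝ) ‖x‖
  rw [← Real.exp_eq_exp_ℝ] at h2
  rw [← h1.tsum_eq]
  refine tsum_of_norm_bounded h2 fun m => ?_
  rw [norm_smul, smul_eq_mul, norm_inv, Real.norm_natCast]
  exact mul_le_mul_of_nonneg_left (norm_pow_le x m) (by positivity)

/-- If `m (aₘ - 1)` tends to `A`, then `aₘ ^ m` tends to `exp A`. -/
theorem tendsto_pow_exp {𝔸 : Type*} [NormedRing 𝔸] [NormOneClass 𝔸] [NormedAlgebra ℝ 𝔸]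
    [CompleteSpace 𝔸] {a : ℕ → 𝔸} {A : 𝔸}
    (h : Tendsto (fun m : ℕ => (m : ℝ) • (a m - 1)) atTop (𝓝 A)) :
    Tendsto (fun m : ℕ => a m ^ m) atTop (𝓝 (NormedSpace.exp A)) := by
  have hinv : Tendsto (fun m : ℕ => ((m : ℝ))⁻¹) atTop (𝓝[≠] 0) :=
    tendsto_nhdsWithin_iff.2 ⟨tendsto_inv_atTop_zero.comp tendsto_natCast_atTop_atTop,
      (eventually_gt_atTop 0).mono fun m hm => by simpa using hm.ne'⟩
  let b : ℕ → 𝔸 := fun m => NormedSpace.exp (((m : ℝ))⁻¹ • A)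
  have hb : Tendsto (fun m : ℕ => (m : ℝ) • (b m - 1)) atTop (𝓝 A) := by
    have h1 : HasDerivAt (fun t : ℝ => NormedSpace.exp (t • A)) A 0 := by
      simpa using hasDerivAt_exp_smul_const (𝕂 := ℝ) A (0 : ℝ)
    have h2 := (hasDerivAt_iff_tendsto_slope_zero.1 h1).comp hinv
    simpa [Function.comp_def, b] using h2
  have hd : Tendsto (fun m : ℕ => (m : ℝ) * ‖a m - b m‖) atTop (𝓝 0) := by
    have h1 := (h.sub hb).norm
    rw [sub_self, norm_zero] at h1
    refine h1.congr fun m => ?_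
    rw [← smul_sub, norm_smul, sub_sub_sub_cancel_right, Real.norm_natCast]
  have hbm : ∀ m : ℕ, m ≠ 0 → b m ^ m = NormedSpace.exp A := by
    intro m hm
    let := NormedAlgebra.restrictScalars ℚ ℝ 𝔸
    rw [← NormedSpace.exp_nsmul, ← Nat.cast_smul_eq_nsmul ℝ, smul_smul,
      mul_inv_cancel₀ (by exact_mod_cast hm), one_smul]
  have hle : ∀ᶠ m : ℕ in atTop,
      ‖a m ^ m - NormedSpace.exp A‖ ≤ (m * ‖a m - b m‖) * Real.exp (‖A‖ + 1) := by
    filter_upwards [eventually_gt_atTop 0, hd.eventually (gt_mem_nhds (zero_lt_one' ℝ))]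
      with m hm hm1
    have hm0 : (0 : ℝ) < m := by exact_mod_cast hm
    have hbn : ‖b m‖ ≤ Real.exp (‖A‖ / m) := by
      refine (norm_exp_le_exp_norm _).trans (Real.exp_le_exp.2 ?_)
      rw [norm_smul, norm_inv, Real.norm_natCast, inv_mul_eq_div]
    have hmono : Real.exp (‖A‖ / m) ≤ Real.exp ((‖A‖ + 1) / m) :=
      Real.exp_le_exp.2 (by gcongr; linarith)
    have h1 : 1 ≤ Real.exp (‖A‖ / m) := Real.one_le_exp (by positivity)
    have han : ‖a m‖ ≤ Real.exp ((‖A‖ + 1) / m) := by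
      have h2 : ‖a m - b m‖ ≤ 1 / m := by
        rw [le_div_iff₀ hm0, mul_comm]; exact hm1.le
      have h3 : 1 + 1 / (m : ℝ) ≤ Real.exp (1 / m) := by
        rw [add_comm]; exact Real.add_one_le_exp _
      calc ‖a m‖ ≤ ‖b m‖ + ‖a m - b m‖ := by
            simpa using norm_add_le (b m) (a m - b m)
        _ ≤ Real.exp (‖A‖ / m) + Real.exp (‖A‖ / m) * (1 / m) := by
            refine add_le_add hbn (h2.trans ?_)
            exact le_mul_of_one_le_left (by positivity) h1
        _ = Real.exp (‖A‖ / m) * (1 + 1 / m) := by ring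
        _ ≤ Real.exp (‖A‖ / m) * Real.exp (1 / m) := by gcongr
        _ = Real.exp ((‖A‖ + 1) / m) := by rw [← Real.exp_add, add_div]
    have h4 := norm_pow_sub_pow_le (h1.trans hmono) han (hbn.trans hmono) m
    rw [hbm m hm.ne', ← Real.exp_nat_mul, mul_div_cancel₀ _ hm0.ne'] at h4
    exact h4
  rw [tendsto_iff_norm_sub_tendsto_zero]
  have h0 := hd.mul_const (Real.exp (‖A‖ + 1))
  rw [zero_mul] at h0
  exact squeeze_zero' (Eventually.of_forall fun _ => norm_nonneg _) hle h0

variable {n : ℕ}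

attribute [local instance] Matrix.linftyOpNormedRing Matrix.linftyOpNormedAlgebra

/-- The exponential of a real matrix, as an invertible matrix. -/
def expUnit (A : Matrix (Fin n) (Fin n) ℝ) : GL (Fin n) ℝ where
  val := NormedSpace.exp A
  inv := NormedSpace.exp (-A)
  val_inv := by
    rw [← Matrix.exp_add_of_commute _ _ (Commute.neg_right (Commute.refl A)), add_neg_cancel,
      NormedSpace.exp_zero]
  inv_val := by
    rw [← Matrix.exp_add_of_commute _ _ (Commute.neg_left (Commute.refl A)), neg_add_cancel,
      NormedSpace.exp_zero]

theorem expUnit_add_smul (A : Matrix (Fin n) (Fin n) ℝ) (s t : ℝ) :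
    expUnit ((s + t) • A) = expUnit (s • A) * expUnit (t • A) := by
  apply Units.ext
  change NormedSpace.exp _ = NormedSpace.exp _ * NormedSpace.exp _
  rw [add_smul, Matrix.exp_add_of_commute]
  exact ((Commute.refl A).smul_left s).smul_right t

theorem continuous_expUnit_smul (A : Matrix (Fin n) (Fin n) ℝ) :
    Continuous fun t : ℝ => expUnit (t • A) := by
  have h : Continuous fun B : Matrix (Fin n) (Fin n) ℝ => NormedSpace.exp B := by
    let := NormedAlgebra.restrictScalars ℚ ℝ (Matrix (Fin n) (Fin n) ℝ)
    exact NormedSpace.exp_continuous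
  refine Units.continuous_iff.2 ⟨?_, ?_⟩
  · exact h.comp (continuous_id.smul continuous_const)
  · exact h.comp (continuous_id.smul continuous_const).neg

/-- The exponential maps the Lie algebra of a closed linear group to the group. -/
theorem expUnit_mem {H : Subgroup (GL (Fin n) ℝ)} (hH : IsClosed (H : Set (GL (Fin n) ℝ)))
    {A : Matrix (Fin n) (Fin n) ℝ} (hA : IsTangent H A) : expUnit A ∈ H := by
  rcases isEmpty_or_nonempty (Fin n) with hn | hn
  · have : expUnit A = 1 := Units.ext (Subsingleton.elim _ _)
    rw [this]
    exact H.one_mem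
  obtain ⟨γ, hγ, hγ0, hγ'⟩ := hA
  have hinv : Tendsto (fun m : ℕ => ((m : ℝ))⁻¹) atTop (𝓝[≠] 0) :=
    tendsto_nhdsWithin_iff.2 ⟨tendsto_inv_atTop_zero.comp tendsto_natCast_atTop_atTop,
      (eventually_gt_atTop 0).mono fun m hm => by simpa using hm.ne'⟩
  have h1 : Tendsto (fun m : ℕ =>
      (m : ℝ) • ((γ ((m : ℝ)⁻¹) : Matrix (Fin n) (Fin n) ℝ) - 1)) atTop (𝓝 A) := by
    refine tendsto_pi_nhds.2 fun i => tendsto_pi_nhds.2 fun j => ?_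
    have := (hasDerivAt_iff_tendsto_slope_zero.1 (hγ' i j)).comp hinv
    simpa [Function.comp_def, hγ0] using this
  have h2 := tendsto_pow_exp h1
  have h3 : Tendsto (fun m : ℕ => γ ((m : ℝ)⁻¹) ^ m) atTop (𝓝 (expUnit A)) := by
    exact (Units.isOpenEmbedding_val (R := Matrix (Fin n) (Fin n) ℝ)).tendsto_nhds_iff.2 h2
  exact hH.mem_of_tendsto h3 (Eventually.of_forall fun m => H.pow_mem (hγ _) m)

end Exponential

/-- A covering map with finite fibres is proper. -/
theorem _root_.IsCoveringMap.isProperMap_of_finite {E X : Type*} [TopologicalSpace E]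
    [TopologicalSpace X] {f : E → X} (hf : IsCoveringMap f) (hfin : ∀ x, Finite (f ⁻¹' {x})) :
    IsProperMap f := by
  refine isProperMap_iff_ultrafilter.2 ⟨hf.continuous, fun 𝒰 y hy => ?_⟩
  obtain ⟨hdisc, U, hyU, hU, hfU, e, he⟩ := hf y
  have := hfin y
  have hmem : f ⁻¹' U ∈ 𝒰 := hy (hU.mem_nhds hyU)
  -- on an evenly covered neighbourhood, one of the finitely many sheets belongs to the ultrafilter
  have hcover : (⋃ i : f ⁻¹' {y}, {z | ∃ h : z ∈ f ⁻¹' U, (e ⟨z, h⟩).2 = i}) ∈ 𝒰 := by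
    refine Filter.mem_of_superset hmem fun z hz => Set.mem_iUnion.2 ⟨_, hz, rfl⟩
  obtain ⟨i, hi⟩ : ∃ i : f ⁻¹' {y}, {z | ∃ h : z ∈ f ⁻¹' U, (e ⟨z, h⟩).2 = i} ∈ 𝒰 := by
    obtain ⟨_, ⟨i, rfl⟩, hi⟩ := (Ultrafilter.finite_sUnion_mem_iff (Set.finite_range _)).1 hcover
    exact ⟨i, hi⟩
  let s : U → E := fun u => (e.symm (u, i) : f ⁻¹' U)
  have hs : Continuous s := by fun_prop
  refine ⟨s ⟨y, hyU⟩, ?_, ?_⟩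
  · rw [← he]; simp
  · intro N hN
    have h1 : s ⁻¹' N ∈ nhds (⟨y, hyU⟩ : U) := hs.continuousAt hN
    obtain ⟨T, hT, hTN⟩ := mem_nhds_subtype U ⟨y, hyU⟩ _ |>.1 h1
    filter_upwards [hi, hy hT] with z hz hzT
    obtain ⟨h, hz⟩ := hz
    have h2 : s ⟨f z, h⟩ = z := by
      have h3 : ((⟨f z, h⟩ : U), i) = e ⟨z, h⟩ := Prod.ext (Subtype.ext (he ⟨z, h⟩).symm) hz.symm
      simp only [s, h3, Homeomorph.symm_apply_apply]
    rw [← h2]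
    exact hTN (show (⟨f z, h⟩ : U) ∈ _ from hzT)

theorem isCompact_orthogonal (n : ℕ) : IsCompact {g : GL (Fin n) ℝ |
    ((g⁻¹ : GL (Fin n) ℝ) : Matrix (Fin n) (Fin n) ℝ) = (g : Matrix (Fin n) (Fin n) ℝ)ᵀ} := by
  let T : Set (Matrix (Fin n) (Fin n) ℝ) :=
    (Set.univ.pi fun _ => Set.univ.pi fun _ => Set.Icc (-1) 1) ∩ {M | M * Mᵀ = 1 ∧ Mᵀ * M = 1}
  have hT : IsCompact T := by
    refine IsCompact.inter_right
      (isCompact_univ_pi fun _ => isCompact_univ_pi fun _ => isCompact_Icc) ?_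
    exact (isClosed_eq (by fun_prop) continuous_const).inter
      (isClosed_eq (by fun_prop) continuous_const)
  let u : T → GL (Fin n) ℝ := fun M => ⟨M, (M : Matrix _ _ ℝ)ᵀ, M.2.2.1, M.2.2.2⟩
  have hu : Continuous u := by
    refine Units.continuous_iff.2 ⟨continuous_subtype_val, ?_⟩
    exact continuous_subtype_val.matrix_transpose
  have : CompactSpace T := isCompact_iff_compactSpace.1 hT
  refine (isCompact_range hu).of_isClosed_subset ?_ ?_
  · exact isClosed_eq (Units.continuous_val.comp continuous_inv)
      Units.continuous_val.matrix_transpose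
  · intro g hg
    have hg' : ((g⁻¹ : GL (Fin n) ℝ) : Matrix (Fin n) (Fin n) ℝ) =
      (g : Matrix (Fin n) (Fin n) ℝ)ᵀ := hg
    have h1 : (g : Matrix (Fin n) (Fin n) ℝ) * (g : Matrix (Fin n) (Fin n) ℝ)ᵀ = 1 := by
      rw [← hg']; exact g.mul_inv
    have h2 : (g : Matrix (Fin n) (Fin n) ℝ)ᵀ * (g : Matrix (Fin n) (Fin n) ℝ) = 1 := by
      rw [← hg']; exact g.inv_mul
    have hmem : (g : Matrix (Fin n) (Fin n) ℝ) ∈ T := by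
      refine ⟨fun i _ j _ => ?_, h1, h2⟩
      have h3 := congrFun (congrFun h1 i) i
      rw [Matrix.mul_apply, Matrix.one_apply_eq] at h3
      have h4 : (g : Matrix (Fin n) (Fin n) ℝ) i j ^ 2 ≤ 1 := by
        rw [← h3, sq]
        exact Finset.single_le_sum (f := fun j => (g : Matrix (Fin n) (Fin n) ℝ) i j *
          (g : Matrix (Fin n) (Fin n) ℝ)ᵀ j i) (fun k _ => mul_self_nonneg _) (Finset.mem_univ j)
      exact abs_le.1 ((sq_le_one_iff_abs_le_one _).1 h4)
    exact ⟨⟨g, hmem⟩, Units.ext rfl⟩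

namespace RealReductiveGroup

variable {n : ℕ} {G : Type*} [Group G] [TopologicalSpace G] [IsTopologicalGroup G]
  (R : RealReductiveGroup n G)

theorem isProperMap_rangeRestrict : IsProperMap R.proj.rangeRestrict := by
  refine R.isCoveringMap.isProperMap_of_finite fun x => ?_
  obtain ⟨g, rfl⟩ := R.proj.rangeRestrict_surjective x
  have := R.finite_ker
  refine Finite.of_injective (β := R.proj.ker) (fun h => ⟨g⁻¹ * h, ?_⟩) ?_
  · have h1 : R.proj h = R.proj g := congrArg Subtype.val h.2
    rw [MonoidHom.mem_ker, map_mul, map_inv, h1, inv_mul_cancel]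
  · intro h h' e
    exact Subtype.ext (mul_left_cancel (congrArg Subtype.val e))

/-- The group is Hausdorff, being a covering of a Hausdorff group. -/
theorem t2Space (R : RealReductiveGroup n G) : T2Space G :=
  ⟨fun x y hxy => by
    by_cases h : R.proj.rangeRestrict x = R.proj.rangeRestrict y
    · exact R.isCoveringMap.isSeparatedMap x y h hxy
    · exact separated_by_continuous R.isCoveringMap.continuous h⟩

/-- `K` is compact: it is closed in the preimage of the orthogonal group under a proper map. -/
theorem compactSpace_K : CompactSpace R.K := by
  have := R.t2Space
  refine isCompact_iff_compactSpace.1 ?_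
  have h1 : IsCompact (R.proj.rangeRestrict ⁻¹' (Subtype.val ⁻¹' {g : GL (Fin n) ℝ |
      ((g⁻¹ : GL (Fin n) ℝ) : Matrix (Fin n) (Fin n) ℝ) = (g : Matrix (Fin n) (Fin n) ℝ)ᵀ})) :=
    R.isProperMap_rangeRestrict.isCompact_preimage
      (R.isClosed_range.isClosedEmbedding_subtypeVal.isCompact_preimage (isCompact_orthogonal n))
  refine h1.of_isClosed_subset (isClosed_eq R.continuous_theta continuous_id) fun k hk => ?_
  exact R.K_orthogonal ⟨k, hk⟩

/-- Skew-symmetric elements of the real Lie algebra generate one-parameter subgroups of `K`. -/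
theorem exists_oneParameter {A : Matrix (Fin n) (Fin n) ℝ} (hA : A ∈ R.g0) (hskew : Aᵀ = -A) :
    ∃ φ : Multiplicative ℝ →* R.K, Continuous φ ∧ ∀ t : ℝ,
      (R.proj (φ (Multiplicative.ofAdd t)) : Matrix (Fin n) (Fin n) ℝ) =
        NormedSpace.exp (t • A) := by
  let c : C(ℝ, R.proj.range) :=
    ⟨fun t => ⟨expUnit (t • A), expUnit_mem R.isClosed_range (R.g0.smul_mem t hA)⟩,
      (continuous_expUnit_smul A).subtype_mk _⟩
  have h0 : expUnit ((0 : ℝ) • A) = 1 := by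
    apply Units.ext
    change NormedSpace.exp ((0 : ℝ) • A) = 1
    rw [zero_smul, NormedSpace.exp_zero]
  obtain ⟨F, ⟨hF0, hF⟩, -⟩ := R.isCoveringMap.existsUnique_continuousMap_lifts c 0 1
    (Subtype.ext (by rw [map_one]; exact h0.symm))
  have hproj : ∀ t, R.proj (F t) = expUnit (t • A) := fun t => congrArg Subtype.val (congrFun hF t)
  have huniq : ∀ f g : ℝ → G, Continuous f → Continuous g → (∀ t, R.proj (f t) = R.proj (g t)) →
      f 0 = g 0 → f = g := fun f g hf hg h h0 =>
    R.isCoveringMap.eq_of_comp_eq hf hg (funext fun t => Subtype.ext (h t)) 0 h0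
  have hadd : ∀ s t, F (s + t) = F s * F t := by
    intro s t
    refine congrFun (huniq (fun t => F (s + t)) (fun t => F s * F t) (by fun_prop) (by fun_prop)
      (fun t => ?_) ?_) t
    · rw [map_mul, hproj, hproj, hproj, expUnit_add_smul]
    · simp [hF0]
  -- `R.theta ∘ F` lifts the same curve, since `A` is skew-symmetric
  have htheta : ∀ t, R.theta (F t) = F t := by
    intro t
    refine congrFun (huniq (fun t => R.theta (F t)) F
      (R.continuous_theta.comp F.continuous) F.continuous (fun t => Units.ext ?_) ?_) t
    · rw [R.proj_theta, hproj]
      change (NormedSpace.exp (-(t • A)))ᵀ = NormedSpace.exp (t • A)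
      rw [← Matrix.exp_transpose, Matrix.transpose_neg, Matrix.transpose_smul, hskew, smul_neg,
        neg_neg]
    · simp [hF0]
  refine ⟨⟨⟨fun t => ⟨F t.toAdd, htheta _⟩, Subtype.ext hF0⟩, fun s t => Subtype.ext (hadd _ _)⟩,
    ?_, fun t => ?_⟩
  · exact (F.continuous.comp continuous_toAdd).subtype_mk _
  · exact congrArg Units.val (hproj t)

end RealReductiveGroup

/-! ### Invariant Hermitian forms -/

open scoped ComplexConjugate

/-- A positive definite Hermitian form on a complex vector space of arbitrary dimension. -/
structure PosHermitian (V : Type*) [AddCommGroup V] [Module ℂ V] where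
  form : V →ₗ⋆[ℂ] V →ₗ[ℂ] ℂ
  conj_symm : ∀ x y, conj (form x y) = form y x
  pos : ∀ x, x ≠ 0 → 0 < (form x x).re

namespace PosHermitian

variable {V : Type*} [AddCommGroup V] [Module ℂ V]

/-- The operator `T` preserves the form. -/
def IsIsometry (h : PosHermitian V) (T : Module.End ℂ V) : Prop :=
  ∀ x y, h.form (T x) (T y) = h.form x y

/-- The operator `T` is skew-adjoint. -/
def IsSkew (h : PosHermitian V) (T : Module.End ℂ V) : Prop :=
  ∀ x y, h.form (T x) y = -h.form x (T y)

/-- The operator `T` is self-adjoint. -/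
def IsSymm (h : PosHermitian V) (T : Module.End ℂ V) : Prop :=
  ∀ x y, h.form (T x) y = h.form x (T y)

variable (h : PosHermitian V)

theorem eq_zero_of_form_self {x : V} (hx : h.form x x = 0) : x = 0 := by
  by_contra hne
  have := h.pos x hne
  rw [hx] at this
  exact lt_irrefl _ this

theorem re_form_self_nonneg (x : V) : 0 ≤ (h.form x x).re := by
  by_cases hx : x = 0
  · rw [hx, map_zero, Complex.zero_re]
  · exact (h.pos x hx).le

theorem exists_orthogonal (N : Submodule ℂ V) [FiniteDimensional ℂ N] (v : V) :
    ∃ m ∈ N, ∀ w ∈ N, h.form w (v - m) = 0 := by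
  let c : InnerProductSpace.Core ℂ V :=
    { inner := fun x y => h.form x y
      conj_inner_symm := fun x y => h.conj_symm y x
      re_inner_nonneg := fun x => h.re_form_self_nonneg x
      add_left := fun x y z => by simp
      smul_left := fun x y r => by simp
      definite := fun x hx => h.eq_zero_of_form_self hx }
  let := c.toNormedAddCommGroup
  let := InnerProductSpace.ofCore c.toCore
  refine ⟨N.starProjection v, Submodule.starProjection_apply_mem N v, fun w hw => ?_⟩
  exact (N.mem_orthogonal _).1 (N.sub_starProjection_mem_orthogonal v) w hw

/-- Every complex vector space carries a positive definite Hermitian form. -/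
def ofBasis {I : Type*} (b : Module.Basis I ℂ V) : PosHermitian V where
  form := LinearMap.mk₂'ₛₗ (starRingEnd ℂ) (RingHom.id ℂ)
    (fun x y => (b.repr y).sum fun i a => conj (b.repr x i) * a)
    (fun x x' y => by simp [add_mul, Finsupp.sum_add])
    (fun c x y => by simp [mul_assoc, Finsupp.mul_sum])
    (fun x y y' => by
      rw [map_add, Finsupp.sum_add_index'] <;> simp [mul_add])
    (fun c x y => by
      rw [map_smul, Finsupp.sum_smul_index] <;> simp [mul_left_comm, Finsupp.mul_sum])
  conj_symm x y := by
    classical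
    simp only [LinearMap.mk₂'ₛₗ_apply]
    rw [Finsupp.sum_of_support_subset _ (Finset.subset_union_left (s₂ := (b.repr x).support)) _
        (by simp),
      Finsupp.sum_of_support_subset _ (Finset.subset_union_right (s₁ := (b.repr y).support)) _
        (by simp), map_sum]
    exact Finset.sum_congr rfl fun i _ => by simp [mul_comm]
  pos x hx := by
    simp only [LinearMap.mk₂'ₛₗ_apply, Finsupp.sum, Complex.re_sum]
    have e : ∀ i, (conj (b.repr x i) * b.repr x i).re = Complex.normSq (b.repr x i) := by
      intro i
      rw [mul_comm, Complex.mul_conj, Complex.ofReal_re]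
    simp only [e]
    refine Finset.sum_pos (fun i hi => Complex.normSq_pos.2 (Finsupp.mem_support_iff.1 hi)) ?_
    rw [Finsupp.support_nonempty_iff]
    simpa using hx

theorem ofBasis_form {I : Type*} (b : Module.Basis I ℂ V) (x y : V) (T : Finset I)
    (hT : ∀ i ∉ T, b.repr y i = 0) :
    (ofBasis b).form x y = ∑ i ∈ T, conj (b.repr x i) * b.repr y i := by
  refine Finsupp.sum_of_support_subset _ (fun i hi => ?_) _ (by simp)
  by_contra hi'
  exact Finsupp.mem_support_iff.1 hi (hT i hi')

/-! Averaging over a compact group. -/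

section Compact

variable {K : Type*} [Group K] [TopologicalSpace K] (ρ : Representation ℂ K V)

theorem continuous_form_ofBasis {I : Type*} (b : Module.Basis I ℂ V)
    (hfin : ∀ x : V, (Submodule.span ℂ (Set.range fun k => ρ k x)).FG)
    (hcont : ∀ (x : V) (ℓ : Module.Dual ℂ V), Continuous fun k => ℓ (ρ k x)) (x y : V) :
    Continuous fun k => (ofBasis b).form (ρ k x) (ρ k y) := by
  classical
  obtain ⟨s, hs⟩ := hfin y
  have hT : ∀ k, ∀ i ∉ s.biUnion fun v => (b.repr v).support, b.repr (ρ k y) i = 0 := by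
    intro k i hi
    have hle : Submodule.span ℂ (s : Set V) ≤ LinearMap.ker (b.coord i) := by
      refine Submodule.span_le.2 fun v hv => ?_
      by_contra hne
      exact hi (Finset.mem_biUnion.2 ⟨v, hv, Finsupp.mem_support_iff.2 hne⟩)
    rw [hs] at hle
    exact hle (Submodule.subset_span ⟨k, rfl⟩)
  simp only [fun k => ofBasis_form b (ρ k x) (ρ k y) _ (hT k)]
  exact continuous_finsetSum _ fun i _ =>
    (Complex.continuous_conj.comp (hcont x (b.coord i))).mul (hcont y (b.coord i))

open MeasureTheory in
/-- A locally finite continuous representation of a compact group is unitarizable. -/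
theorem exists_isIsometry_of_compact [IsTopologicalGroup K] [CompactSpace K]
    (hfin : ∀ x : V, (Submodule.span ℂ (Set.range fun k => ρ k x)).FG)
    (hcont : ∀ (x : V) (ℓ : Module.Dual ℂ V), Continuous fun k => ℓ (ρ k x)) :
    ∃ h : PosHermitian V, ∀ k, h.IsIsometry (ρ k) := by
  let : MeasurableSpace K := borel K
  have : BorelSpace K := ⟨rfl⟩
  let μ : Measure K := Measure.haar
  let b := Module.Basis.ofVectorSpace ℂ V
  let F : V → V → K → ℂ := fun x y k => (ofBasis b).form (ρ k⁻¹ x) (ρ k⁻¹ y)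
  have hF : ∀ x y, Continuous (F x y) := fun x y =>
    (continuous_form_ofBasis ρ b hfin hcont x y).comp continuous_inv
  have hint : ∀ x y, Integrable (F x y) μ := fun x y =>
    (hF x y).integrable_of_hasCompactSupport (HasCompactSupport.of_compactSpace _)
  let Φ : V →ₗ⋆[ℂ] V →ₗ[ℂ] ℂ := LinearMap.mk₂'ₛₗ (starRingEnd ℂ) (RingHom.id ℂ)
    (fun x y => ∫ k, F x y k ∂μ)
    (fun x x' y => by
      rw [← integral_add (hint x y) (hint x' y)]
      exact integral_congr_ae (.of_forall fun k => by simp [F]))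
    (fun c x y => by
      rw [← integral_smul]
      exact integral_congr_ae (.of_forall fun k => by simp [F]))
    (fun x y y' => by
      rw [← integral_add (hint x y) (hint x y')]
      exact integral_congr_ae (.of_forall fun k => by simp [F]))
    (fun c x y => by
      rw [← integral_smul]
      exact integral_congr_ae (.of_forall fun k => by simp [F]))
  have hΦ : ∀ x y, Φ x y = ∫ k, F x y k ∂μ := fun _ _ => rfl
  refine ⟨⟨Φ, fun x y => ?_, fun x hx => ?_⟩, fun k x y => ?_⟩
  · rw [hΦ, hΦ, ← integral_conj]
    exact integral_congr_ae (.of_forall fun k => (ofBasis b).conj_symm _ _)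
  · rw [hΦ]
    change 0 < RCLike.re (∫ k, F x x k ∂μ)
    rw [← integral_re (hint x x)]
    refine Continuous.integral_pos_of_hasCompactSupport_nonneg_nonzero (x := 1)
      (Complex.continuous_re.comp (hF x x)) (HasCompactSupport.of_compactSpace _)
      (fun k => re_form_self_nonneg _ _) ?_
    have := (ofBasis b).pos x hx
    simpa [F] using this.ne'
  · change Φ _ _ = Φ _ _
    rw [hΦ, hΦ, ← integral_mul_left_eq_self (fun g => F (ρ k x) (ρ k y) g) k]
    refine integral_congr_ae (.of_forall fun g => ?_)
    simp only [F, mul_inv_rev, map_mul, Module.End.mul_apply, Representation.inv_self_apply]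

end Compact

/-! Averaging over a Clifford system. -/

/-- The form `h(x, y) + h(C x, C y)`. -/
def addTwist (C : Module.End ℂ V) : PosHermitian V where
  form := LinearMap.mk₂'ₛₗ (starRingEnd ℂ) (RingHom.id ℂ)
    (fun x y => h.form x y + h.form (C x) (C y))
    (fun x x' y => by simp only [map_add, LinearMap.add_apply]; ring)
    (fun c x y => by simp [mul_add])
    (fun x y y' => by simp only [map_add]; ring)
    (fun c x y => by simp [mul_add])
  conj_symm x y := by
    simp [h.conj_symm]
  pos x hx := by
    simp only [LinearMap.mk₂'ₛₗ_apply, Complex.add_re]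
    exact add_pos_of_pos_of_nonneg (h.pos x hx) (h.re_form_self_nonneg _)

theorem addTwist_form (C : Module.End ℂ V) (x y : V) :
    (h.addTwist C).form x y = h.form x y + h.form (C x) (C y) := rfl

/-- A form can be made invariant under anticommuting complex structures, without losing its
invariance under operators which commute with them. -/
theorem exists_isIsometry_of_clifford {κ : Type*} [DecidableEq κ] (C : κ → Module.End ℂ V)
    (hsq : ∀ i x, C i (C i x) = -x) (hanti : ∀ i j, i ≠ j → ∀ x, C i (C j x) = -C j (C i x))
    (T : Set (Module.End ℂ V)) (hT : ∀ t ∈ T, ∀ i x, C i (t x) = t (C i x))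
    (hiso : ∀ t ∈ T, h.IsIsometry t) (s : Finset κ) :
    ∃ h' : PosHermitian V, (∀ t ∈ T, h'.IsIsometry t) ∧ ∀ i ∈ s, h'.IsIsometry (C i) := by
  induction s using Finset.induction_on with
  | empty => exact ⟨h, hiso, by simp⟩
  | insert a s ha ih =>
    obtain ⟨h', h1, h2⟩ := ih
    refine ⟨h'.addTwist (C a), fun t ht x y => ?_, fun i hi x y => ?_⟩
    · rw [addTwist_form, addTwist_form, h1 t ht, hT t ht, hT t ht, h1 t ht]
    · rw [addTwist_form, addTwist_form]
      rcases Finset.mem_insert.1 hi with rfl | hi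
      · rw [hsq, hsq, map_neg, map_neg, LinearMap.neg_apply, neg_neg, add_comm]
      · have hne : a ≠ i := fun e => ha (e ▸ hi)
        rw [h2 i hi, hanti a i hne, hanti a i hne, map_neg, map_neg, LinearMap.neg_apply, neg_neg,
          h2 i hi]

theorem IsIsometry.isSkew {C : Module.End ℂ V} (hC : h.IsIsometry C) (hsq : ∀ x, C (C x) = -x) :
    h.IsSkew C := by
  intro x y
  rw [← hC x (C y), hsq, map_neg, neg_neg]

variable {h}

theorem IsSymm.add {S T : Module.End ℂ V} (hS : h.IsSymm S) (hT : h.IsSymm T) :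
    h.IsSymm (S + T) := fun x y => by
  rw [LinearMap.add_apply, LinearMap.add_apply, map_add, map_add, LinearMap.add_apply, hS, hT]

theorem IsSymm.real_smul {T : Module.End ℂ V} (hT : h.IsSymm T) (r : ℝ) :
    h.IsSymm ((r : ℂ) • T) := fun x y => by
  rw [LinearMap.smul_apply, LinearMap.smul_apply, map_smulₛₗ, LinearMap.smul_apply, hT, map_smul,
    Complex.conj_ofReal]

theorem IsSymm.sum {κ : Type*} {s : Finset κ} {T : κ → Module.End ℂ V}
    (hT : ∀ i ∈ s, h.IsSymm (T i)) : h.IsSymm (∑ i ∈ s, T i) := fun x y => by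
  simp only [LinearMap.sum_apply, map_sum]
  exact Finset.sum_congr rfl fun i hi => hT i hi x y

theorem IsSkew.add {S T : Module.End ℂ V} (hS : h.IsSkew S) (hT : h.IsSkew T) :
    h.IsSkew (S + T) := fun x y => by
  rw [LinearMap.add_apply, LinearMap.add_apply, map_add, map_add, LinearMap.add_apply, hS, hT,
    neg_add]

theorem IsSkew.real_smul {T : Module.End ℂ V} (hT : h.IsSkew T) (r : ℝ) :
    h.IsSkew ((r : ℂ) • T) := fun x y => by
  rw [LinearMap.smul_apply, LinearMap.smul_apply, map_smulₛₗ, LinearMap.smul_apply, hT, map_smul,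
    Complex.conj_ofReal, smul_neg]

theorem IsSkew.sum {κ : Type*} {s : Finset κ} {T : κ → Module.End ℂ V}
    (hT : ∀ i ∈ s, h.IsSkew (T i)) : h.IsSkew (∑ i ∈ s, T i) := fun x y => by
  simp only [LinearMap.sum_apply, map_sum, ← Finset.sum_neg_distrib]
  exact Finset.sum_congr rfl fun i hi => hT i hi x y

/-- The product of two commuting skew-adjoint operators is self-adjoint. -/
theorem IsSkew.mul {S T : Module.End ℂ V} (hS : h.IsSkew S) (hT : h.IsSkew T)
    (hST : S * T = T * S) : h.IsSymm (S * T) := fun x y => by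
  rw [Module.End.mul_apply, hS, hT, neg_neg, hST]
  rfl

/-- The product of two anticommuting skew-adjoint operators is skew-adjoint. -/
theorem IsSkew.mul_of_anticomm {S T : Module.End ℂ V} (hS : h.IsSkew S) (hT : h.IsSkew T)
    (hST : S * T = -(T * S)) : h.IsSkew (S * T) := fun x y => by
  rw [Module.End.mul_apply, hS, hT, neg_neg, hST, LinearMap.neg_apply, map_neg, neg_neg]
  rfl

/-- A translate `T - c` of a self-adjoint operator is normal, so it is semisimple at the eigenvalue
zero; here `c` need not be real. -/
theorem IsSymm.eq_zero_of_sub_smul_sq {T : Module.End ℂ V} (hT : h.IsSymm T) (c : ℂ) {x : V}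
    (hx : T (T x - c • x) - c • (T x - c • x) = 0) : T x - c • x = 0 := by
  obtain ⟨y, hy⟩ : ∃ y, y = T x - c • x := ⟨_, rfl⟩
  rw [← hy] at hx ⊢
  have hTy : T y = c • y := sub_eq_zero.1 hx
  -- eigenvalues are real
  have h1 : conj c * h.form y y = c * h.form y y := by
    have := hT y y
    rw [hTy, map_smulₛₗ, LinearMap.smul_apply, map_smul] at this
    exact this
  have h2 : h.form y (T x - c • x) = (conj c - c) * h.form y x := by
    rw [map_sub, map_smul, ← hT, hTy, map_smulₛₗ, LinearMap.smul_apply, smul_eq_mul,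
      smul_eq_mul, sub_mul]
  rw [← hy] at h2
  by_contra hne
  have h3 : h.form y y ≠ 0 := fun h0 => hne (h.eq_zero_of_form_self h0)
  rw [mul_right_cancel₀ h3 h1, sub_self, zero_mul] at h2
  exact h3 h2

/-- A self-adjoint operator translated by a scalar has complementary kernel and image on every
stable finite-dimensional subspace. -/
theorem IsSymm.exists_add_of_mem {T : Module.End ℂ V} (hT : h.IsSymm T) (c : ℂ)
    {N : Submodule ℂ V} [FiniteDimensional ℂ N] (hN : ∀ x ∈ N, T x ∈ N) {x : V} (hx : x ∈ N) :
    ∃ y z, T y - c • y = 0 ∧ x = y + (T z - c • z) := by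
  let S : Module.End ℂ N := (T - c • 1).restrict fun x hx =>
    N.sub_mem (hN x hx) (N.smul_mem c hx)
  have hS : ∀ x : N, (S x : V) = T x - c • (x : V) := fun _ => rfl
  have hdisj : Disjoint (LinearMap.ker S) (LinearMap.range S) := by
    rw [Submodule.disjoint_def]
    rintro _ h1 ⟨u, rfl⟩
    refine Subtype.ext ?_
    rw [hS]
    refine hT.eq_zero_of_sub_smul_sq c ?_
    have := congrArg Subtype.val (LinearMap.mem_ker.1 h1)
    rw [hS, hS] at this
    exact this
  have hsup : LinearMap.ker S ⊔ LinearMap.range S = ⊤ := by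
    refine Submodule.eq_top_of_disjoint _ _ ?_ hdisj
    rw [add_comm, LinearMap.finrank_range_add_finrank_ker]
  obtain ⟨y, hy, _, ⟨z, rfl⟩, hyz⟩ := Submodule.mem_sup.1
    (hsup ▸ Submodule.mem_top (x := (⟨x, hx⟩ : N)))
  refine ⟨y, z, ?_, ?_⟩
  · have := congrArg Subtype.val (LinearMap.mem_ker.1 hy)
    rwa [hS] at this
  · have := congrArg Subtype.val hyz
    rw [← hS]
    exact this.symm

end PosHermitian

/-! ### The Casimir element -/

section Orthonormal

variable {n : ℕ}

/-- A space of real matrices has an orthonormal basis for the form `tr(A Cᵀ)`. -/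
theorem exists_orthonormal (E : Submodule ℝ (Matrix (Fin n) (Fin n) ℝ)) :
    ∃ (m : ℕ) (e : Fin m → E),
      (∀ i j, Matrix.trace ((e i : Matrix (Fin n) (Fin n) ℝ) *
        (e j : Matrix (Fin n) (Fin n) ℝ)ᵀ) = if i = j then 1 else 0) ∧
      ∀ A : E, A = ∑ j, Matrix.trace ((A : Matrix (Fin n) (Fin n) ℝ) *
        (e j : Matrix (Fin n) (Fin n) ℝ)ᵀ) • e j := by
  have hsq : ∀ A : Matrix (Fin n) (Fin n) ℝ, 0 ≤ Matrix.trace (A * Aᵀ) := by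
    intro A
    simp only [Matrix.trace, Matrix.diag_apply, Matrix.mul_apply, Matrix.transpose_apply]
    exact Finset.sum_nonneg fun i _ => Finset.sum_nonneg fun j _ => mul_self_nonneg (A i j)
  have hdef : ∀ A : Matrix (Fin n) (Fin n) ℝ, Matrix.trace (A * Aᵀ) = 0 → A = 0 := by
    intro A hA
    rwa [← Matrix.conjTranspose_eq_transpose_of_trivial,
      Matrix.trace_mul_conjTranspose_self_eq_zero_iff] at hA
  have hcomm : ∀ A C : Matrix (Fin n) (Fin n) ℝ,
      Matrix.trace (A * Cᵀ) = Matrix.trace (C * Aᵀ) := by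
    intro A C
    rw [← Matrix.trace_transpose (A * Cᵀ), Matrix.transpose_mul, Matrix.transpose_transpose]
  let c : InnerProductSpace.Core ℝ E :=
    { inner := fun A C => Matrix.trace ((A : Matrix (Fin n) (Fin n) ℝ) *
        (C : Matrix (Fin n) (Fin n) ℝ)ᵀ)
      conj_inner_symm := fun A C => hcomm _ _
      re_inner_nonneg := fun A => hsq A
      add_left := fun A C F => by simp [add_mul]
      smul_left := fun A C r => by simp
      definite := fun A hA => Subtype.ext (hdef A hA) }
  let := c.toNormedAddCommGroup
  let := InnerProductSpace.ofCore c.toCore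
  let b := stdOrthonormalBasis ℝ E
  refine ⟨_, b, fun i j => ?_, fun A => ?_⟩
  · exact orthonormal_iff_ite.1 b.orthonormal i j
  · conv_lhs => rw [← b.sum_repr' A]
    exact Finset.sum_congr rfl fun j _ => congrArg (· • b j) (hcomm _ _)

end Orthonormal

/-- The enveloping algebra is generated by the Lie algebra. -/
theorem universalEnveloping_mem {𝔤 : Type*} [LieRing 𝔤] [LieAlgebra ℂ 𝔤]
    (S : Subalgebra ℂ (UniversalEnvelopingAlgebra ℂ 𝔤))
    (hS : ∀ Z, UniversalEnvelopingAlgebra.ι ℂ Z ∈ S) (u : UniversalEnvelopingAlgebra ℂ 𝔤) :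
    u ∈ S := by
  let f : 𝔤 →ₗ⁅ℂ⁆ S :=
    { toFun := fun Z => ⟨UniversalEnvelopingAlgebra.ι ℂ Z, hS Z⟩
      map_add' := fun Y Z => Subtype.ext (map_add _ _ _)
      map_smul' := fun c Z => Subtype.ext (map_smul _ _ _)
      map_lie' := fun {Y Z} => Subtype.ext (LieHom.map_lie _ _ _) }
  have h : S.val.comp (UniversalEnvelopingAlgebra.lift ℂ f) = AlgHom.id ℂ _ := by
    apply UniversalEnvelopingAlgebra.hom_ext
    ext Z
    change ((UniversalEnvelopingAlgebra.lift ℂ f (UniversalEnvelopingAlgebra.ι ℂ Z) : S) :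
      UniversalEnvelopingAlgebra ℂ 𝔤) = _
    rw [UniversalEnvelopingAlgebra.lift_ι_apply]
    rfl
  have h2 := DFunLike.congr_fun h u
  rw [AlgHom.id_apply] at h2
  rw [← h2]
  exact (UniversalEnvelopingAlgebra.lift ℂ f u).2

/-- The Casimir element `∑ xᵢ xᵢ'` of a pair of dual bases for an invariant form is central. -/
theorem casimir_mem_center {𝔤 : Type*} [LieRing 𝔤] [LieAlgebra ℂ 𝔤] {I : Type*} [Fintype I]
    (B : LinearMap.BilinForm ℂ 𝔤) (hB : ∀ Y a b : 𝔤, B ⁅Y, a⁆ b = -B a ⁅Y, b⁆) (x x' : I → 𝔤)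
    (h : ∀ v, v = ∑ i, B v (x' i) • x i) (h' : ∀ v, v = ∑ i, B (x i) v • x' i) :
    ∑ i, UniversalEnvelopingAlgebra.ι ℂ (x i) * UniversalEnvelopingAlgebra.ι ℂ (x' i) ∈
      Subalgebra.center ℂ (UniversalEnvelopingAlgebra ℂ 𝔤) := by
  obtain ⟨j, hj⟩ : ∃ j : 𝔤 →ₗ⁅ℂ⁆ UniversalEnvelopingAlgebra ℂ 𝔤,
    j = UniversalEnvelopingAlgebra.ι ℂ := ⟨_, rfl⟩
  rw [← hj]
  have hcomm : ∀ Y a : 𝔤, j Y * j a = j ⁅Y, a⁆ + j a * j Y := by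
    intro Y a
    rw [LieHom.map_lie, Ring.lie_def, sub_add_cancel]
  have key : ∀ Y : 𝔤, ∑ i, (j ⁅Y, x i⁆ * j (x' i) + j (x i) * j ⁅Y, x' i⁆) = 0 := by
    intro Y
    rw [Finset.sum_add_distrib]
    have h1 : ∑ i, j ⁅Y, x i⁆ * j (x' i) =
        ∑ i, ∑ k, B ⁅Y, x i⁆ (x' k) • (j (x k) * j (x' i)) := by
      refine Finset.sum_congr rfl fun i _ => ?_
      conv_lhs => rw [h ⁅Y, x i⁆]
      simp only [map_sum, map_smul, Finset.sum_mul, smul_mul_assoc]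
    have h2 : ∑ i, j (x i) * j ⁅Y, x' i⁆ =
        ∑ i, ∑ k, B (x i) ⁅Y, x' k⁆ • (j (x k) * j (x' i)) := by
      rw [Finset.sum_comm]
      refine Finset.sum_congr rfl fun i _ => ?_
      conv_lhs => rw [h' ⁅Y, x' i⁆]
      simp only [map_sum, map_smul, Finset.mul_sum, mul_smul_comm]
    rw [h1, h2, ← Finset.sum_add_distrib]
    refine Finset.sum_eq_zero fun i _ => ?_
    rw [← Finset.sum_add_distrib]
    refine Finset.sum_eq_zero fun k _ => ?_
    rw [← add_smul, hB, neg_add_cancel, zero_smul]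
  have hgen : ∀ Y, j Y * (∑ i, j (x i) * j (x' i)) = (∑ i, j (x i) * j (x' i)) * j Y := by
    intro Y
    have h3 : ∀ i, j Y * (j (x i) * j (x' i)) =
        (j ⁅Y, x i⁆ * j (x' i) + j (x i) * j ⁅Y, x' i⁆) + j (x i) * j (x' i) * j Y := by
      intro i
      rw [← mul_assoc, hcomm Y (x i), add_mul, mul_assoc (j (x i)), hcomm Y (x' i), mul_add,
        ← mul_assoc, add_assoc]
    rw [Finset.mul_sum, Finset.sum_congr rfl fun i _ => h3 i, Finset.sum_add_distrib, key, zero_add,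
      Finset.sum_mul]
  rw [Subalgebra.mem_center_iff]
  intro u
  have hu := universalEnveloping_mem
    (Subalgebra.centralizer ℂ {∑ i, j (x i) * j (x' i)}) (fun Y => by
      rw [Subalgebra.mem_centralizer_iff]
      rintro _ rfl
      rw [← hj]
      exact (hgen Y).symm) u
  exact ((Subalgebra.mem_centralizer_iff ℂ).1 hu _ rfl).symm

namespace RealReductiveGroup

variable {n : ℕ} {G : Type*} [Group G] [TopologicalSpace G] [IsTopologicalGroup G]
  (R : RealReductiveGroup n G)

theorem transpose_mem_g0 {A : Matrix (Fin n) (Fin n) ℝ} (hA : A ∈ R.g0) : Aᵀ ∈ R.g0 := by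
  obtain ⟨γ, hγ, hγ0, hγ'⟩ := hA
  choose δ hδ hδ' using fun t => R.transpose_mem (γ t) (hγ t)
  refine ⟨δ, hδ, Units.ext ?_, fun i j => ?_⟩
  · rw [hδ', hγ0, Units.val_one, Matrix.transpose_one]
  · simp only [hδ', Matrix.transpose_apply]
    exact hγ' j i

/-- The Lie algebra of `K`: the skew-symmetric matrices in the real Lie algebra. -/
def k0 : Submodule ℝ (Matrix (Fin n) (Fin n) ℝ) where
  carrier := {A | A ∈ R.g0 ∧ Aᵀ = -A}
  add_mem' := fun {A B} hA hB =>
    ⟨R.g0.add_mem hA.1 hB.1, by rw [Matrix.transpose_add, hA.2, hB.2, neg_add]⟩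
  zero_mem' := ⟨R.g0.zero_mem, by rw [Matrix.transpose_zero, neg_zero]⟩
  smul_mem' := fun c A hA =>
    ⟨R.g0.smul_mem c hA.1, by rw [Matrix.transpose_smul, hA.2, smul_neg]⟩

/-- The inclusion of the real Lie algebra in its complexification. -/
def g0ToG (A : Matrix (Fin n) (Fin n) ℝ) (hA : A ∈ R.g0) : R.g :=
  ⟨A.map Complex.ofReal, by
    have e : (A.map Complex.ofReal).map Complex.re = A := by ext; simp
    exact e.symm ▸ hA, by
    have e : (A.map Complex.ofReal).map Complex.im = 0 := by ext; simp
    exact e.symm ▸ R.g0.zero_mem⟩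

theorem g_hom_ext {M : Type*} [AddCommGroup M] [Module ℂ M] (f h : R.g →ₗ[ℂ] M)
    (H : ∀ A hA, f (R.g0ToG A hA) = h (R.g0ToG A hA)) (v : R.g) : f v = h v := by
  have e : v = R.g0ToG _ v.2.1 + Complex.I • R.g0ToG _ v.2.2 := by
    apply Subtype.ext
    ext i j
    change (v : Matrix (Fin n) (Fin n) ℂ) i j =
      (((v : Matrix (Fin n) (Fin n) ℂ) i j).re : ℂ) +
        Complex.I * (((v : Matrix (Fin n) (Fin n) ℂ) i j).im : ℂ)
    rw [mul_comm]
    exact (Complex.re_add_im _).symm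
  rw [e, map_add, map_smul, map_add, map_smul, H, H]

theorem B_g0ToG (A C : Matrix (Fin n) (Fin n) ℝ) (hA : A ∈ R.g0) (hC : C ∈ R.g0) :
    R.B (R.g0ToG A hA) (R.g0ToG C hC) = ((Matrix.trace (A * C) : ℝ) : ℂ) := by
  change Matrix.trace (A.map Complex.ofReal * C.map Complex.ofReal) = _
  simp [Matrix.trace, Matrix.mul_apply]

theorem B_lie (Y a b : R.g) : R.B ⁅Y, a⁆ b = -R.B a ⁅Y, b⁆ := by
  change Matrix.trace (((Y : Matrix (Fin n) (Fin n) ℂ) * (a : Matrix (Fin n) (Fin n) ℂ) -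
      (a : Matrix (Fin n) (Fin n) ℂ) * (Y : Matrix (Fin n) (Fin n) ℂ)) *
    (b : Matrix (Fin n) (Fin n) ℂ)) = -Matrix.trace ((a : Matrix (Fin n) (Fin n) ℂ) *
    ((Y : Matrix (Fin n) (Fin n) ℂ) * (b : Matrix (Fin n) (Fin n) ℂ) -
      (b : Matrix (Fin n) (Fin n) ℂ) * (Y : Matrix (Fin n) (Fin n) ℂ)))
  rw [sub_mul, mul_sub, Matrix.trace_sub, Matrix.trace_sub, neg_sub, mul_assoc, mul_assoc,
    Matrix.trace_mul_comm (Y : Matrix (Fin n) (Fin n) ℂ), mul_assoc]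

/-- Orthonormal bases of the real forms of `𝔭` and `𝔨` for the positive definite form `tr(A Cᵀ)`. -/
structure OrthonormalBases (m l : ℕ) where
  e : Fin m → R.p0
  w : Fin l → R.k0
  ortho : ∀ i j, R.Bp (R.p0ToP (e i)) (R.p0ToP (e j)) = if i = j then 1 else 0
  expand_p : ∀ a : R.p0, a = ∑ j, Matrix.trace ((a : Matrix (Fin n) (Fin n) ℝ) *
    (e j : Matrix (Fin n) (Fin n) ℝ)) • e j
  expand_k : ∀ a : R.k0, a = -∑ j, Matrix.trace ((a : Matrix (Fin n) (Fin n) ℝ) *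
    (w j : Matrix (Fin n) (Fin n) ℝ)) • w j

theorem exists_orthonormalBases : ∃ m l, Nonempty (R.OrthonormalBases m l) := by
  obtain ⟨m, e, he, he'⟩ := exists_orthonormal R.p0
  obtain ⟨l, w, -, hw'⟩ := exists_orthonormal R.k0
  have het : ∀ i, (e i : Matrix (Fin n) (Fin n) ℝ)ᵀ = e i := fun i => (e i).2.2
  have hwt : ∀ i, (w i : Matrix (Fin n) (Fin n) ℝ)ᵀ = -w i := fun i => (w i).2.2
  refine ⟨m, l, ⟨e, w, fun i j => ?_, fun a => ?_, fun a => ?_⟩⟩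
  · have h := R.B_g0ToG (e i) (e j) (e i).2.1 (e j).2.1
    have h2 := he i j
    rw [het] at h2
    rw [h2] at h
    refine Eq.trans h ?_
    split_ifs <;> simp
  · conv_lhs => rw [he' a]
    simp only [het]
  · conv_lhs => rw [hw' a]
    rw [← Finset.sum_neg_distrib]
    refine Finset.sum_congr rfl fun j _ => ?_
    rw [hwt, mul_neg, Matrix.trace_neg]
    exact neg_smul (_ : ℝ) (w j)

namespace OrthonormalBases

variable {R} {m l : ℕ} (b : R.OrthonormalBases m l)

/-- The members of the orthonormal basis of `𝔭`. -/
def Z (i : Fin m) : R.p := R.p0ToP (b.e i)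

/-- The members of the basis of `𝔨`. -/
def W (i : Fin l) : R.g := R.g0ToG (b.w i) (b.w i).2.1

/-- The vectors `Zⱼ` form an orthonormal basis of `𝔭` for the trace form. -/
theorem expand_Z (v : R.p) : v = ∑ j, R.Bp v (b.Z j) • b.Z j := by
  have h := p_hom_ext LinearMap.id (∑ j, (R.Bp.flip (b.Z j)).smulRight (b.Z j)) (fun a => ?_) v
  · simpa using h
  · simp only [LinearMap.id_apply, LinearMap.sum_apply, LinearMap.smulRight_apply]
    have h1 : ∀ j, R.Bp (R.p0ToP a) (b.Z j) =
        ((Matrix.trace ((a : Matrix (Fin n) (Fin n) ℝ) *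
          (b.e j : Matrix (Fin n) (Fin n) ℝ)) : ℝ) : ℂ) :=
      fun j => R.B_g0ToG a (b.e j) a.2.1 (b.e j).2.1
    conv_lhs => rw [b.expand_p a]
    rw [map_sum]
    refine Finset.sum_congr rfl fun j _ => ?_
    refine Eq.trans ?_ (congrArg (· • b.Z j) (h1 j).symm)
    rw [map_smul]
    exact (Complex.coe_smul _ (R.p0ToP (b.e j))).symm

/-- The trace form is positive on the `Zⱼ` and negative on the `Wⱼ`, hence the signs. -/
theorem expand_g (v : R.g) :
    v = ∑ j, R.B v (R.pToG (b.Z j)) • R.pToG (b.Z j) - ∑ j, R.B v (b.W j) • b.W j := by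
  have h := R.g_hom_ext LinearMap.id
    (∑ j, (R.B.flip (R.pToG (b.Z j))).smulRight (R.pToG (b.Z j)) -
      ∑ j, (R.B.flip (b.W j)).smulRight (b.W j)) (fun A hA => ?_) v
  · simpa using h
  · simp only [LinearMap.id_apply, LinearMap.sub_apply, LinearMap.sum_apply,
      LinearMap.smulRight_apply]
    have hZ : ∀ j, R.B (R.g0ToG A hA) (R.pToG (b.Z j)) =
        ((Matrix.trace (A * (b.e j : Matrix (Fin n) (Fin n) ℝ)) : ℝ) : ℂ) :=
      fun j => R.B_g0ToG A (b.e j) hA (b.e j).2.1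
    have hW : ∀ j, R.B (R.g0ToG A hA) (b.W j) =
        ((Matrix.trace (A * (b.w j : Matrix (Fin n) (Fin n) ℝ)) : ℝ) : ℂ) :=
      fun j => R.B_g0ToG A (b.w j) hA (b.w j).2.1
    -- the symmetric and the skew-symmetric parts of `A`
    let s : R.p0 := ⟨(1 / 2 : ℝ) • (A + Aᵀ),
      R.g0.smul_mem _ (R.g0.add_mem hA (R.transpose_mem_g0 hA)), by
        rw [Matrix.transpose_smul, Matrix.transpose_add, Matrix.transpose_transpose, add_comm]⟩
    let t : R.k0 := ⟨(1 / 2 : ℝ) • (A - Aᵀ),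
      R.g0.smul_mem _ (R.g0.sub_mem hA (R.transpose_mem_g0 hA)), by
        rw [Matrix.transpose_smul, Matrix.transpose_sub, Matrix.transpose_transpose, ← smul_neg,
          neg_sub]⟩
    have htr : ∀ C : Matrix (Fin n) (Fin n) ℝ, Matrix.trace (Aᵀ * C) = Matrix.trace (A * Cᵀ) := by
      intro C
      rw [← Matrix.trace_transpose (Aᵀ * C), Matrix.transpose_mul, Matrix.transpose_transpose,
        Matrix.trace_mul_comm]
    have hs : ∀ j, Matrix.trace ((s : Matrix (Fin n) (Fin n) ℝ) *
        (b.e j : Matrix (Fin n) (Fin n) ℝ)) =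
        Matrix.trace (A * (b.e j : Matrix (Fin n) (Fin n) ℝ)) := by
      intro j
      have h : (b.e j : Matrix (Fin n) (Fin n) ℝ)ᵀ = b.e j := (b.e j).2.2
      simp only [s, Matrix.smul_mul, Matrix.trace_smul, add_mul, Matrix.trace_add, htr, h,
        smul_eq_mul]
      ring
    have ht : ∀ j, Matrix.trace ((t : Matrix (Fin n) (Fin n) ℝ) *
        (b.w j : Matrix (Fin n) (Fin n) ℝ)) =
        Matrix.trace (A * (b.w j : Matrix (Fin n) (Fin n) ℝ)) := by
      intro j
      have h : (b.w j : Matrix (Fin n) (Fin n) ℝ)ᵀ = -b.w j := (b.w j).2.2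
      simp only [t, Matrix.smul_mul, Matrix.trace_smul, sub_mul, Matrix.trace_sub, htr, h,
        smul_eq_mul, mul_neg, Matrix.trace_neg]
      ring
    have hst : A = (s : Matrix (Fin n) (Fin n) ℝ) + t := by
      simp only [s, t, ← smul_add]
      rw [add_add_sub_cancel, ← two_smul ℝ A, smul_smul]
      norm_num
    have hsum : A = ∑ j, Matrix.trace (A * (b.e j : Matrix (Fin n) (Fin n) ℝ)) •
          (b.e j : Matrix (Fin n) (Fin n) ℝ) -
        ∑ j, Matrix.trace (A * (b.w j : Matrix (Fin n) (Fin n) ℝ)) •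
          (b.w j : Matrix (Fin n) (Fin n) ℝ) := by
      conv_lhs => rw [hst]
      have h1 := congrArg Subtype.val (b.expand_p s)
      have h2 := congrArg Subtype.val (b.expand_k t)
      simp only [hs, ht] at h1 h2
      rw [h1, h2]
      simp [sub_eq_add_neg]
    apply Subtype.ext
    ext i j
    have h := congrArg (fun M : Matrix (Fin n) (Fin n) ℝ => ((M i j : ℝ) : ℂ)) hsum
    simp only [Matrix.sub_apply, Matrix.sum_apply, Matrix.smul_apply, smul_eq_mul,
      Complex.ofReal_sub, Complex.ofReal_sum, Complex.ofReal_mul] at h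
    refine h.trans ?_
    let ev : R.g →ₗ[ℂ] ℂ := (Matrix.entryLinearMap ℂ ℂ i j) ∘ₗ R.g.toSubmodule.subtype
    change _ = ev (_ - _)
    rw [map_sub, map_sum, map_sum]
    refine congrArg₂ _ (Finset.sum_congr rfl fun r _ => ?_) (Finset.sum_congr rfl fun r _ => ?_)
    · rw [map_smul, smul_eq_mul, ← hZ]
      rfl
    · rw [map_smul, smul_eq_mul, ← hW]
      rfl

/-- The Casimir element of the trace form is central. -/
theorem casimir_mem :
    ∑ j, UniversalEnvelopingAlgebra.ι ℂ (R.pToG (b.Z j)) *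
        UniversalEnvelopingAlgebra.ι ℂ (R.pToG (b.Z j)) -
      ∑ j, UniversalEnvelopingAlgebra.ι ℂ (b.W j) * UniversalEnvelopingAlgebra.ι ℂ (b.W j) ∈
      Subalgebra.center ℂ (UniversalEnvelopingAlgebra ℂ R.g) := by
  have h := casimir_mem_center R.B R.B_lie
    (Sum.elim (fun j => R.pToG (b.Z j)) b.W) (Sum.elim (fun j => R.pToG (b.Z j)) fun j => -b.W j)
    (fun v => by
      rw [Fintype.sum_sum_type]
      simp only [Sum.elim_inl, Sum.elim_inr, map_neg, neg_smul, Finset.sum_neg_distrib]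
      rw [← sub_eq_add_neg]
      exact b.expand_g v)
    (fun v => by
      rw [Fintype.sum_sum_type]
      simp only [Sum.elim_inl, Sum.elim_inr, smul_neg, Finset.sum_neg_distrib, R.B_comm _ v]
      rw [← sub_eq_add_neg]
      exact b.expand_g v)
  rw [Fintype.sum_sum_type] at h
  simp only [Sum.elim_inl, Sum.elim_inr, map_neg, mul_neg, Finset.sum_neg_distrib] at h
  rwa [← sub_eq_add_neg] at h

end OrthonormalBases

namespace GKModule

variable {R} {X : Type*} [AddCommGroup X] [Module ℂ X] {M : R.GKModule X}

/-- On a module with infinitesimal character the part of the Casimir element in `𝔭` agrees, up to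
a scalar, with its part in `𝔨`. -/
theorem HasInfChar.exists_casimir
    {χ : Subalgebra.center ℂ (UniversalEnvelopingAlgebra ℂ R.g) →ₐ[ℂ] ℂ} (hχ : M.HasInfChar χ)
    {m l : ℕ} (b : R.OrthonormalBases m l) : ∃ c : ℂ,
      ∑ j, M.lieAction (R.pToG (b.Z j)) * M.lieAction (R.pToG (b.Z j)) =
        c • 1 + ∑ j, M.lieAction (b.W j) * M.lieAction (b.W j) := by
  refine ⟨χ ⟨_, b.casimir_mem⟩, ?_⟩
  rw [← sub_eq_iff_eq_add]
  refine LinearMap.ext fun x => ?_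
  have h := hχ ⟨_, b.casimir_mem⟩ x
  have hι : ∀ Z, M.envAction (UniversalEnvelopingAlgebra.ι ℂ Z) = M.lieAction Z := fun Z =>
    UniversalEnvelopingAlgebra.lift_ι_apply _ _ _
  simp only [map_sub, map_sum, map_mul, hι] at h
  exact h

/-- Homomorphisms of `(𝔤, K)`-modules commute with the enveloping algebra. -/
theorem _root_.DiracIndex.RealReductiveGroup.IsGKHom.map_envAction {Y : Type*} [AddCommGroup Y]
    [Module ℂ Y] {N : R.GKModule Y} {f : X →ₗ[ℂ] Y} (hf : IsGKHom M N f)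
    (u : UniversalEnvelopingAlgebra ℂ R.g) (x : X) :
    f (M.envAction u x) = N.envAction u (f x) := by
  have hιM : ∀ Z, M.envAction (UniversalEnvelopingAlgebra.ι ℂ Z) = M.lieAction Z := fun Z =>
    UniversalEnvelopingAlgebra.lift_ι_apply _ _ _
  have hιN : ∀ Z, N.envAction (UniversalEnvelopingAlgebra.ι ℂ Z) = N.lieAction Z := fun Z =>
    UniversalEnvelopingAlgebra.lift_ι_apply _ _ _
  let S : Subalgebra ℂ (UniversalEnvelopingAlgebra ℂ R.g) :=
    { carrier := {u | ∀ x, f (M.envAction u x) = N.envAction u (f x)}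
      mul_mem' := fun {u v} hu hv x => by
        rw [map_mul, map_mul, Module.End.mul_apply, Module.End.mul_apply, hu, hv]
      add_mem' := fun {u v} hu hv x => by
        rw [map_add, map_add, LinearMap.add_apply, LinearMap.add_apply, map_add, hu, hv]
      algebraMap_mem' := fun c x => by
        rw [AlgHom.commutes, AlgHom.commutes, Module.algebraMap_end_apply,
          Module.algebraMap_end_apply, map_smul] }
  exact universalEnveloping_mem S (fun Z x => by rw [hιM, hιN, hf.1]) u x

theorem HasInfChar.of_injective {Y : Type*} [AddCommGroup Y]
    [Module ℂ Y] {N : R.GKModule Y} {f : X →ₗ[ℂ] Y} (hf : IsGKHom M N f)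
    (hi : Function.Injective f)
    {χ : Subalgebra.center ℂ (UniversalEnvelopingAlgebra ℂ R.g) →ₐ[ℂ] ℂ} (hχ : N.HasInfChar χ) :
    M.HasInfChar χ := fun z x => hi (by rw [hf.map_envAction, hχ, map_smul])

theorem HasInfChar.of_surjective {Y : Type*} [AddCommGroup Y]
    [Module ℂ Y] {N : R.GKModule Y} {f : X →ₗ[ℂ] Y} (hf : IsGKHom M N f)
    (hs : Function.Surjective f)
    {χ : Subalgebra.center ℂ (UniversalEnvelopingAlgebra ℂ R.g) →ₐ[ℂ] ℂ} (hχ : M.HasInfChar χ) :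
    N.HasInfChar χ := fun z y => by
  obtain ⟨x, rfl⟩ := hs y
  rw [← hf.map_envAction, hχ, map_smul]

end GKModule

end RealReductiveGroup

/-! ### The square of the Dirac operator -/

/-- The square of `∑ Aᵢ Cᵢ` for a Clifford system `C` commuting with `A`. -/
theorem sum_mul_sq {E : Type*} [Ring E] {m : ℕ} (A C : Fin m → E)
    (hAC : ∀ i j, C i * A j = A j * C i)
    (hC : ∀ i j, C j * C i = -(C i * C j) - if i = j then 2 else 0) :
    2 * ((∑ i, A i * C i) * ∑ i, A i * C i) =
      ∑ i, ∑ j, (A i * A j - A j * A i) * (C i * C j) - 2 * ∑ i, A i * A i := by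
  have h1 : (∑ i, A i * C i) * ∑ i, A i * C i = ∑ i, ∑ j, A i * A j * (C i * C j) := by
    rw [Finset.sum_mul_sum]
    refine Finset.sum_congr rfl fun i _ => Finset.sum_congr rfl fun j _ => ?_
    rw [mul_assoc, ← mul_assoc (C i), hAC, mul_assoc, mul_assoc]
  have h2 : (∑ i, A i * C i) * ∑ i, A i * C i =
      -(∑ i, ∑ j, A j * A i * (C i * C j)) - 2 * ∑ i, A i * A i := by
    rw [h1, Finset.sum_comm, ← Finset.sum_neg_distrib, Finset.mul_sum, ← Finset.sum_sub_distrib]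
    refine Finset.sum_congr rfl fun i _ => ?_
    have h3 : 2 * (A i * A i) = ∑ j, A j * A i * if i = j then 2 else 0 := by
      rw [Finset.sum_eq_single i]
      · rw [if_pos rfl, two_mul, mul_two]
      · intro j _ hj
        rw [if_neg hj.symm, mul_zero]
      · simp
    rw [h3, ← Finset.sum_neg_distrib, ← Finset.sum_sub_distrib]
    refine Finset.sum_congr rfl fun j _ => ?_
    rw [hC i j, mul_sub, mul_neg]
  rw [two_mul]
  nth_rw 1 [h1]
  rw [h2, ← add_sub_assoc, ← sub_eq_add_neg, ← Finset.sum_sub_distrib]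
  refine congrArg (· - _) (Finset.sum_congr rfl fun i _ => ?_)
  rw [← Finset.sum_sub_distrib]
  exact Finset.sum_congr rfl fun j _ => (sub_mul _ _ _).symm

theorem Polarization.vectorAction_mul_add {V : Type*} [AddCommGroup V] [Module ℂ V]
    {B : LinearMap.BilinForm ℂ V} (P : Polarization B) (hB : ∀ x y, B x y = B y x) (v w : V) :
    P.vectorAction v * P.vectorAction w + P.vectorAction w * P.vectorAction v =
      algebraMap ℂ (Module.End ℂ P.Spinor) (-2 * B v w) := by
  have h := P.vectorAction_sq hB (v + w)
  rw [map_add, mul_add, add_mul, add_mul, P.vectorAction_sq hB, P.vectorAction_sq hB] at h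
  have e : -B (v + w) (v + w) = -B v v + (-2 * B v w) + -B w w := by
    rw [map_add, map_add, LinearMap.add_apply, LinearMap.add_apply, hB w v]
    ring
  rw [e, map_add, map_add] at h
  have h2 : P.vectorAction v * P.vectorAction w + P.vectorAction w * P.vectorAction v =
      (algebraMap ℂ (Module.End ℂ P.Spinor) (-B v v) +
        P.vectorAction w * P.vectorAction v + (P.vectorAction v * P.vectorAction w +
        algebraMap ℂ (Module.End ℂ P.Spinor) (-B w w))) -
      algebraMap ℂ (Module.End ℂ P.Spinor) (-B v v) -
      algebraMap ℂ (Module.End ℂ P.Spinor) (-B w w) := by abel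
  rw [h2, h]
  abel

namespace RealReductiveGroup

variable {n : ℕ} {G : Type*} [Group G] [TopologicalSpace G] [IsTopologicalGroup G]
  {R : RealReductiveGroup n G} (P : Polarization R.Bp) {ι : Type*} [Fintype ι] [DecidableEq ι]
  (β : R.DualBases ι) {m l : ℕ} (b : R.OrthonormalBases m l)

theorem OrthonormalBases.Bp_Z (i j : Fin m) : R.Bp (b.Z i) (b.Z j) = if i = j then 1 else 0 :=
  b.ortho i j

/-- The bracket of two symmetric matrices is skew-symmetric. -/
theorem OrthonormalBases.lie_Z (i j : Fin m) : ∃ A : R.k0,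
    ⁅R.pToG (b.Z i), R.pToG (b.Z j)⁆ = R.g0ToG A A.2.1 := by
  have hi : (b.e i : Matrix (Fin n) (Fin n) ℝ)ᵀ = b.e i := (b.e i).2.2
  have hj : (b.e j : Matrix (Fin n) (Fin n) ℝ)ᵀ = b.e j := (b.e j).2.2
  refine ⟨⟨⁅(b.e i : Matrix (Fin n) (Fin n) ℝ), (b.e j : Matrix (Fin n) (Fin n) ℝ)⁆,
    R.g0.lie_mem (b.e i).2.1 (b.e j).2.1, ?_⟩, ?_⟩
  · rw [Ring.lie_def, Matrix.transpose_sub, Matrix.transpose_mul, Matrix.transpose_mul, hi, hj,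
      neg_sub]
  · apply Subtype.ext
    ext r s
    change ((b.e i : Matrix (Fin n) (Fin n) ℝ).map Complex.ofReal *
        (b.e j : Matrix (Fin n) (Fin n) ℝ).map Complex.ofReal -
      (b.e j : Matrix (Fin n) (Fin n) ℝ).map Complex.ofReal *
        (b.e i : Matrix (Fin n) (Fin n) ℝ).map Complex.ofReal) r s =
      ((((b.e i : Matrix (Fin n) (Fin n) ℝ) * b.e j - (b.e j : Matrix (Fin n) (Fin n) ℝ) * b.e i)
        r s : ℝ) : ℂ)
    simp [Matrix.mul_apply]

namespace GKModule

variable {X : Type*} [AddCommGroup X] [Module ℂ X] (M : R.GKModule X)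

/-- The action of `Z ∈ 𝔤` on the first factor of `X ⊗ S`. -/
def lieTensor (Z : R.g) : Module.End ℂ (X ⊗[ℂ] P.Spinor) :=
  (M.lieAction Z).rTensor P.Spinor

variable (X) in
/-- The Clifford action of `v ∈ 𝔭` on the second factor of `X ⊗ S`. -/
def cliffTensor (v : R.p) : Module.End ℂ (X ⊗[ℂ] P.Spinor) :=
  (P.vectorAction v).lTensor X

theorem cliffTensor_mul_rTensor (v : R.p) (T : Module.End ℂ X) :
    cliffTensor P X v * T.rTensor P.Spinor = T.rTensor P.Spinor * cliffTensor P X v := by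
  rw [cliffTensor, Module.End.mul_eq_comp, Module.End.mul_eq_comp, LinearMap.lTensor_comp_rTensor,
    LinearMap.rTensor_comp_lTensor]

theorem lieTensor_lie (Y Z : R.g) : M.lieTensor P ⁅Y, Z⁆ =
    M.lieTensor P Y * M.lieTensor P Z - M.lieTensor P Z * M.lieTensor P Y := by
  simp only [lieTensor]
  rw [LieHom.map_lie, Ring.lie_def, LinearMap.rTensor_sub, LinearMap.rTensor_mul,
    LinearMap.rTensor_mul]

theorem cliffTensor_Z_mul (i j : Fin m) : cliffTensor P X (b.Z j) * cliffTensor P X (b.Z i) =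
    -(cliffTensor P X (b.Z i) * cliffTensor P X (b.Z j)) - if i = j then 2 else 0 := by
  have h := congrArg (LinearMap.lTensor X) (P.vectorAction_mul_add R.Bp_comm (b.Z i) (b.Z j))
  rw [b.Bp_Z, LinearMap.lTensor_add, LinearMap.lTensor_mul, LinearMap.lTensor_mul] at h
  have e : LinearMap.lTensor X (algebraMap ℂ (Module.End ℂ P.Spinor)
      (-2 * if i = j then 1 else 0)) = -(if i = j then 2 else 0) := by
    split_ifs
    · rw [mul_one, map_neg, map_ofNat, LinearMap.lTensor_neg, ← one_add_one_eq_two,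
        LinearMap.lTensor_add, Module.End.one_eq_id, LinearMap.lTensor_id, ← Module.End.one_eq_id,
        one_add_one_eq_two]
    · rw [mul_zero, map_zero, LinearMap.lTensor_zero, neg_zero]
  rw [e] at h
  rw [sub_eq_add_neg, ← h]
  exact (neg_add_cancel_left _ _).symm

/-- The Dirac operator in an orthonormal basis. -/
theorem diracOp_eq_sum_Z :
    M.diracOp P β = ∑ j, M.lieTensor P (R.pToG (b.Z j)) * cliffTensor P X (b.Z j) := by
  let Φ : R.p →ₗ[ℂ] R.p →ₗ[ℂ] Module.End ℂ (X ⊗[ℂ] P.Spinor) :=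
    (TensorProduct.mapBilinear (RingHom.id ℂ) X P.Spinor X P.Spinor).compl₁₂
      ((M.lieAction : R.g →ₗ[ℂ] Module.End ℂ X) ∘ₗ R.pToG) P.vectorAction
  have hΦ : ∀ v w, Φ v w = M.lieTensor P (R.pToG v) * cliffTensor P X w := by
    intro v w
    rw [lieTensor, cliffTensor, Module.End.mul_eq_comp, LinearMap.rTensor_comp_lTensor]
    rfl
  have hD : M.diracOp P β = ∑ i, Φ (β.b i) (β.d i) := M.diracOp_eq P β
  rw [hD]
  simp only [← hΦ]
  have h1 : ∀ i, Φ (β.b i) (β.d i) = ∑ j, R.Bp (β.b i) (b.Z j) • Φ (b.Z j) (β.d i) := by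
    intro i
    conv_lhs => rw [b.expand_Z (β.b i)]
    rw [map_sum, LinearMap.sum_apply]
    simp only [map_smul, LinearMap.smul_apply]
  rw [Finset.sum_congr rfl fun i _ => h1 i, Finset.sum_comm]
  refine Finset.sum_congr rfl fun j _ => ?_
  refine Eq.trans ?_ (congrArg (Φ (b.Z j)) (β.expand_dual (b.Z j)).symm)
  rw [map_sum]
  simp only [map_smul]

/-- The operator which differs by a scalar from the square of the Dirac operator on a module with
infinitesimal character: it only involves the action of `𝔨` and the Clifford action. -/
def sqOp : Module.End ℂ (X ⊗[ℂ] P.Spinor) :=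
  (((1 / 2 : ℝ)) : ℂ) • ∑ i, ∑ j, M.lieTensor P ⁅R.pToG (b.Z i), R.pToG (b.Z j)⁆ *
      (cliffTensor P X (b.Z i) * cliffTensor P X (b.Z j)) +
    (((-1 : ℝ)) : ℂ) • ∑ j, M.lieTensor P (b.W j) * M.lieTensor P (b.W j)

/-- The formula for the square of the Dirac operator, on modules with infinitesimal character. -/
theorem diracOp_sq {χ : Subalgebra.center ℂ (UniversalEnvelopingAlgebra ℂ R.g) →ₐ[ℂ] ℂ}
    (hχ : M.HasInfChar χ) : ∃ c : ℂ, ∀ x,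
      M.diracOp P β (M.diracOp P β x) = M.sqOp P b x - c • x := by
  obtain ⟨c, hc⟩ := hχ.exists_casimir b
  refine ⟨c, fun x => ?_⟩
  have h := sum_mul_sq (fun j => M.lieTensor P (R.pToG (b.Z j))) (fun j => cliffTensor P X (b.Z j))
    (fun i j => cliffTensor_mul_rTensor P _ _) (cliffTensor_Z_mul P b)
  rw [← M.diracOp_eq_sum_Z P β b] at h
  have hc' : ∑ j, M.lieTensor P (R.pToG (b.Z j)) * M.lieTensor P (R.pToG (b.Z j)) =
      c • 1 + ∑ j, M.lieTensor P (b.W j) * M.lieTensor P (b.W j) := by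
    have h2 := congrArg (LinearMap.rTensorHom P.Spinor) hc
    simp only [map_add, map_sum, map_smul, LinearMap.coe_rTensorHom, LinearMap.rTensor_mul] at h2
    refine h2.trans ?_
    rw [Module.End.one_eq_id, LinearMap.rTensor_id]
    rfl
  rw [hc'] at h
  simp only [← lieTensor_lie] at h
  have h3 := congrArg (((1 / 2 : ℂ)) • ·) h
  have h4 : ∀ T : Module.End ℂ (X ⊗[ℂ] P.Spinor), (1 / 2 : ℂ) • (2 * T) = T := by
    intro T
    rw [two_mul, ← two_smul ℂ T, smul_smul]
    norm_num
  simp only [smul_sub, h4] at h3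
  have h5 := LinearMap.congr_fun h3 x
  rw [Module.End.mul_apply] at h5
  rw [h5, sqOp]
  simp only [LinearMap.sub_apply, LinearMap.add_apply, LinearMap.smul_apply, Module.End.one_apply,
    Complex.ofReal_neg, Complex.ofReal_one, Complex.ofReal_div, Complex.ofReal_ofNat, neg_smul,
    one_smul]
  abel

end GKModule
end RealReductiveGroup

/-! ### The invariant Hermitian form on `X ⊗ S` -/

open scoped ComplexConjugate

/-- A locally finite representation by isometries is semisimple: in a finite-dimensional
subrepresentation, orthogonal complements of subrepresentations are subrepresentations. -/
theorem PosHermitian.isSemisimpleModule_of_isIsometry {H V : Type*} [Group H] [AddCommGroup V]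
    [Module ℂ V] {ρ : Representation ℂ H V} (h : PosHermitian V) (hρ : ∀ x, h.IsIsometry (ρ x))
    (hfin : ∀ v, ∃ N : Subrepresentation ρ, FiniteDimensional ℂ N.toSubmodule ∧
      v ∈ N.toSubmodule) : IsSemisimpleModule (MonoidAlgebra ℂ H) ρ.asModule := by
  let I := {N : Subrepresentation ρ // FiniteDimensional ℂ N.toSubmodule}
  have key : ∀ (N : I) (W : Submodule (MonoidAlgebra ℂ H) ρ.asModule), W ≤ N.1.asSubmodule →
      ∃ C : Submodule (MonoidAlgebra ℂ H) ρ.asModule, C ≤ N.1.asSubmodule ∧ Disjoint W C ∧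
        N.1.asSubmodule ≤ W ⊔ C := by
    rintro ⟨N, hN⟩ W hWN
    let W' := Subrepresentation.ofSubmodule' W
    have hWN' : W'.toSubmodule ≤ N.toSubmodule := fun v hv => hWN hv
    have := Submodule.finiteDimensional_of_le hWN'
    let C : Subrepresentation ρ :=
      { toSubmodule :=
          { carrier := {v | v ∈ N.toSubmodule ∧ ∀ w ∈ W'.toSubmodule, h.form w v = 0}
            add_mem' := fun {u v} hu hv => ⟨Submodule.add_mem _ hu.1 hv.1, fun w hw => by
              rw [map_add, hu.2 w hw, hv.2 w hw, add_zero]⟩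
            zero_mem' := ⟨Submodule.zero_mem _, fun w _ => map_zero _⟩
            smul_mem' := fun c v hv => ⟨Submodule.smul_mem _ _ hv.1, fun w hw => by
              rw [map_smul, hv.2 w hw, smul_zero]⟩ }
        apply_mem_toSubmodule := fun x v hv => ⟨N.apply_mem_toSubmodule x hv.1, fun w hw => by
          rw [← Representation.self_inv_apply ρ x w, hρ]
          exact hv.2 _ (W'.apply_mem_toSubmodule x⁻¹ hw)⟩ }
    refine ⟨C.asSubmodule, fun v hv => hv.1, ?_, fun v hv => ?_⟩
    · rw [Submodule.disjoint_def]
      exact fun v hv1 hv2 => h.eq_zero_of_form_self (hv2.2 v hv1)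
    · replace hv : (v : V) ∈ N.toSubmodule := hv
      obtain ⟨u, hu, huv⟩ := h.exists_orthogonal W'.toSubmodule v
      have hv' : (show V from v) - u ∈ C.toSubmodule := ⟨Submodule.sub_mem _ hv (hWN' hu), huv⟩
      exact Submodule.mem_sup.2 ⟨u, hu, _, hv', add_sub_cancel (G := V) u v⟩
  rw [isSemisimpleModule_iff]
  refine complementedLattice_of_complementedLattice_Iic (s := Set.univ)
    (f := fun N : I => N.1.asSubmodule) (fun N _ => ⟨fun W => ?_⟩) ?_
  · obtain ⟨C, hC, h1, h2⟩ := key N W.1 W.2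
    exact ⟨⟨C, hC⟩, Set.Iic.isCompl_iff.2 ⟨h1, le_antisymm (sup_le W.2 hC) h2⟩⟩
  · rw [eq_top_iff]
    intro v _
    obtain ⟨N, h1, h2⟩ := hfin v
    exact le_iSup₂ (f := fun (N : I) (_ : N ∈ Set.univ) => N.1.asSubmodule) ⟨N, h1⟩
      (Set.mem_univ _) h2

namespace RealReductiveGroup

variable {n : ℕ} {G : Type*} [Group G] [TopologicalSpace G] [IsTopologicalGroup G]
  {R : RealReductiveGroup n G} (P : Polarization R.Bp)

instance : Module.Finite ℂ P.Spinor := by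
  have : Module.Free ℂ P.pos := Module.Free.of_divisionRing ℂ P.pos
  exact Module.Finite.of_basis (Module.Basis.ExteriorAlgebra (Module.finBasis ℂ P.pos))

namespace GKModule

variable {X : Type*} [AddCommGroup X] [Module ℂ X] (M : R.GKModule X)

/-- `K` acting on the first factor of `X ⊗ S`. -/
def repTensor : Representation ℂ R.K (X ⊗[ℂ] P.Spinor) where
  toFun k := (M.rep k).rTensor P.Spinor
  map_one' := by rw [map_one, Module.End.one_eq_id, LinearMap.rTensor_id]; rfl
  map_mul' k k' := by rw [map_mul, LinearMap.rTensor_mul]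

/-- The subspace `F ⊗ S` of `X ⊗ S`. -/
def tensorSub (F : Submodule ℂ X) : Submodule ℂ (X ⊗[ℂ] P.Spinor) :=
  LinearMap.range (F.subtype.rTensor P.Spinor)

theorem tensorSub_mono {F F' : Submodule ℂ X} (h : F ≤ F') : tensorSub P F ≤ tensorSub P F' := by
  rintro _ ⟨x, rfl⟩
  refine ⟨(Submodule.inclusion h).rTensor P.Spinor x, ?_⟩
  rw [← LinearMap.rTensor_comp_apply, Submodule.subtype_comp_inclusion]

instance (F : Submodule ℂ X) [FiniteDimensional ℂ F] : FiniteDimensional ℂ (tensorSub P F) :=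
  by unfold tensorSub; infer_instance

theorem rTensor_mem_tensorSub {F : Submodule ℂ X} {T : Module.End ℂ X} (hT : ∀ x ∈ F, T x ∈ F)
    {x : X ⊗[ℂ] P.Spinor} (hx : x ∈ tensorSub P F) : T.rTensor P.Spinor x ∈ tensorSub P F := by
  obtain ⟨y, rfl⟩ := hx
  refine ⟨(T.restrict hT).rTensor P.Spinor y, ?_⟩
  rw [← LinearMap.rTensor_comp_apply, ← LinearMap.rTensor_comp_apply]
  rfl

theorem lTensor_mem_tensorSub {F : Submodule ℂ X} (T : Module.End ℂ P.Spinor)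
    {x : X ⊗[ℂ] P.Spinor} (hx : x ∈ tensorSub P F) : T.lTensor X x ∈ tensorSub P F := by
  obtain ⟨y, rfl⟩ := hx
  refine ⟨T.lTensor F y, ?_⟩
  rw [← LinearMap.comp_apply, ← LinearMap.comp_apply, LinearMap.rTensor_comp_lTensor,
    LinearMap.lTensor_comp_rTensor]

/-- `X ⊗ S` is the union of the subspaces `F ⊗ S`, for `F` finite-dimensional and `K`-stable. -/
theorem exists_mem_tensorSub (v : X ⊗[ℂ] P.Spinor) : ∃ F : Submodule ℂ X, FiniteDimensional ℂ F ∧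
    (∀ k, ∀ x ∈ F, M.rep k x ∈ F) ∧ v ∈ tensorSub P F := by
  induction v with
  | zero => exact ⟨⊥, inferInstance, fun k x hx => by
      rw [(Submodule.mem_bot ℂ).1 hx, map_zero]; exact Submodule.zero_mem _,
      Submodule.zero_mem _⟩
  | tmul x s =>
    refine ⟨Submodule.span ℂ (Set.range fun k => M.rep k x),
      Module.Finite.iff_fg.2 (M.locallyFinite x), fun k y hy => ?_, ?_⟩
    · have : Submodule.span ℂ (Set.range fun k => M.rep k x) ≤
          (Submodule.span ℂ (Set.range fun k => M.rep k x)).comap (M.rep k) := by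
        refine Submodule.span_le.2 ?_
        rintro _ ⟨k', rfl⟩
        refine Submodule.subset_span ⟨k * k', ?_⟩
        simp only [map_mul, Module.End.mul_apply]
      exact this hy
    · exact ⟨⟨x, Submodule.subset_span ⟨1, by simp⟩⟩ ⊗ₜ s, rfl⟩
  | add v w hv hw =>
    obtain ⟨F, h1, h2, h3⟩ := hv
    obtain ⟨F', h1', h2', h3'⟩ := hw
    refine ⟨F ⊔ F', inferInstance, fun k x hx => ?_, Submodule.add_mem _
      (tensorSub_mono P le_sup_left h3) (tensorSub_mono P le_sup_right h3')⟩
    obtain ⟨y, hy, z, hz, rfl⟩ := Submodule.mem_sup.1 hx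
    rw [map_add]
    exact Submodule.add_mem_sup (h2 k y hy) (h2' k z hz)

theorem repTensor_locallyFinite (v : X ⊗[ℂ] P.Spinor) :
    (Submodule.span ℂ (Set.range fun k => M.repTensor P k v)).FG := by
  obtain ⟨F, hF, hK, hv⟩ := M.exists_mem_tensorSub P v
  have hle : Submodule.span ℂ (Set.range fun k => M.repTensor P k v) ≤ tensorSub P F := by
    refine Submodule.span_le.2 ?_
    rintro _ ⟨k, rfl⟩
    exact rTensor_mem_tensorSub P (hK k) hv
  have := Submodule.finiteDimensional_of_le hle
  exact Module.Finite.iff_fg.1 this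

theorem repTensor_continuous (v : X ⊗[ℂ] P.Spinor) (ℓ : Module.Dual ℂ (X ⊗[ℂ] P.Spinor)) :
    Continuous fun k => ℓ (M.repTensor P k v) := by
  induction v with
  | zero => simpa using continuous_const
  | tmul x s => exact M.continuous_coeff x (ℓ ∘ₗ (TensorProduct.mk ℂ X P.Spinor).flip s)
  | add v w hv hw =>
    simp only [map_add]
    exact hv.add hw

/-- The Lie algebra of `K` preserves the `K`-stable subspaces. -/
theorem lieAction_mem {F : Submodule ℂ X} (hK : ∀ k, ∀ x ∈ F, M.rep k x ∈ F) (A : R.k0) {x : X}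
    (hx : x ∈ F) : M.lieAction (R.g0ToG A A.2.1) x ∈ F := by
  by_contra hne
  -- a functional which vanishes on `F` vanishes along the orbit of `x`
  obtain ⟨ℓ, hℓ, hle⟩ := Submodule.exists_le_ker_of_notMem hne
  obtain ⟨φ, hφ, hφ'⟩ := R.exists_oneParameter A.2.1 A.2.2
  have h := M.hasDerivAt_coeff (R.g0ToG A A.2.1) A A.2.2 rfl φ hφ hφ' x ℓ
  have h0 : (fun t : ℝ => ℓ (M.rep (φ (Multiplicative.ofAdd t)) x)) = fun _ => 0 :=
    funext fun t => hle (hK _ x hx)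
  rw [h0] at h
  exact hℓ (h.unique (hasDerivAt_const _ _))

theorem hasDerivAt_repTensor (A : R.k0) {φ : Multiplicative ℝ →* R.K} (hφ : Continuous φ)
    (hφ' : ∀ t : ℝ, (R.proj (φ (Multiplicative.ofAdd t)) : Matrix (Fin n) (Fin n) ℝ) =
      NormedSpace.exp (t • (A : Matrix (Fin n) (Fin n) ℝ)))
    (v : X ⊗[ℂ] P.Spinor) (ℓ : Module.Dual ℂ (X ⊗[ℂ] P.Spinor)) :
    HasDerivAt (fun t : ℝ => ℓ (M.repTensor P (φ (Multiplicative.ofAdd t)) v))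
      (ℓ (M.lieTensor P (R.g0ToG A A.2.1) v)) 0 := by
  induction v with
  | zero => simpa using hasDerivAt_const (0 : ℝ) (0 : ℂ)
  | tmul x s =>
    exact M.hasDerivAt_coeff (R.g0ToG A A.2.1) A A.2.2 rfl φ hφ hφ' x
      (ℓ ∘ₗ (TensorProduct.mk ℂ X P.Spinor).flip s)
  | add v w hv hw =>
    simp only [map_add]
    exact hv.add hw

/-- The differential of an isometric action is skew-adjoint. -/
theorem isSkew_lieTensor {h : PosHermitian (X ⊗[ℂ] P.Spinor)}
    (hiso : ∀ k, h.IsIsometry (M.repTensor P k)) (A : R.k0) :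
    h.IsSkew (M.lieTensor P (R.g0ToG A A.2.1)) := by
  intro x y
  obtain ⟨φ, hφ, hφ'⟩ := R.exists_oneParameter A.2.1 A.2.2
  have h1 := M.hasDerivAt_repTensor P A hφ hφ' y (h.form x)
  have h2 := M.hasDerivAt_repTensor P A hφ hφ' x (h.form y)
  have h3 : ∀ t : ℝ, conj (h.form y (M.repTensor P (φ (Multiplicative.ofAdd (-t))) x)) =
      h.form x (M.repTensor P (φ (Multiplicative.ofAdd t)) y) := by
    intro t
    rw [h.conj_symm, ← hiso (φ (Multiplicative.ofAdd t)), ← Module.End.mul_apply, ← map_mul,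
      ← map_mul, ← ofAdd_add, add_neg_cancel, ofAdd_zero, map_one, map_one, Module.End.one_apply]
  have h4 : HasDerivAt (fun t : ℝ =>
      h.form y (M.repTensor P (φ (Multiplicative.ofAdd (-t))) x))
      (-h.form y (M.lieTensor P (R.g0ToG A A.2.1) x)) 0 := by
    have h5 : HasDerivAt (fun t : ℝ => h.form y (M.repTensor P (φ (Multiplicative.ofAdd t)) x))
      (h.form y (M.lieTensor P (R.g0ToG A A.2.1) x)) (-0) := by rwa [neg_zero]
    have h6 := h5.scomp (0 : ℝ) (hasDerivAt_neg (0 : ℝ))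
    rw [neg_one_smul] at h6
    exact h6
  have h6 := (h4.star).congr_deriv rfl
  have h7 : (fun t : ℝ => star (h.form y (M.repTensor P (φ (Multiplicative.ofAdd (-t))) x))) =
      fun t : ℝ => h.form x (M.repTensor P (φ (Multiplicative.ofAdd t)) y) := funext h3
  rw [h7] at h6
  have h8 := h6.unique h1
  rw [← h8, star_neg, neg_neg]
  exact (h.conj_symm _ _).symm

/-- The space `X ⊗ S` carries a positive definite Hermitian form which is invariant under `K`
acting on the first factor and under the Clifford action of the real form of `𝔭`, in the sense that
the vectors of the real form act by skew-adjoint operators. -/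
theorem exists_invariantForm {m l : ℕ} (b : R.OrthonormalBases m l) :
    ∃ h : PosHermitian (X ⊗[ℂ] P.Spinor), (∀ k, h.IsIsometry (M.repTensor P k)) ∧
      ∀ a : R.p0, h.IsSkew (cliffTensor P X (R.p0ToP a)) := by
  have := R.compactSpace_K
  obtain ⟨h, hh⟩ := PosHermitian.exists_isIsometry_of_compact (M.repTensor P)
    (M.repTensor_locallyFinite P) (M.repTensor_continuous P)
  have hsq : ∀ i x, cliffTensor P X (b.Z i) (cliffTensor P X (b.Z i) x) = -x := by
    intro i x
    have h1 := LinearMap.congr_fun (congrArg (LinearMap.lTensor X)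
      (P.vectorAction_sq R.Bp_comm (b.Z i))) x
    rw [b.Bp_Z, if_pos rfl, LinearMap.lTensor_mul, map_neg, map_one, LinearMap.lTensor_neg,
      Module.End.one_eq_id, LinearMap.lTensor_id] at h1
    exact h1
  have hanti : ∀ i j, i ≠ j → ∀ x, cliffTensor P X (b.Z i) (cliffTensor P X (b.Z j) x) =
      -cliffTensor P X (b.Z j) (cliffTensor P X (b.Z i) x) := by
    intro i j hij x
    have h1 := LinearMap.congr_fun (cliffTensor_Z_mul (X := X) P b j i) x
    rw [if_neg hij.symm, sub_zero] at h1
    exact h1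
  obtain ⟨h', h1, h2⟩ := h.exists_isIsometry_of_clifford (fun i => cliffTensor P X (b.Z i)) hsq
    hanti (Set.range (M.repTensor P)) (by
      rintro _ ⟨k, rfl⟩ i x
      exact LinearMap.congr_fun (cliffTensor_mul_rTensor P (b.Z i) (M.rep k)) x)
    (by rintro _ ⟨k, rfl⟩; exact hh k) Finset.univ
  refine ⟨h', fun k => h1 _ ⟨k, rfl⟩, fun a => ?_⟩
  have e : cliffTensor P X (R.p0ToP a) = ∑ j, ((Matrix.trace ((a : Matrix (Fin n) (Fin n) ℝ) *
      (b.e j : Matrix (Fin n) (Fin n) ℝ)) : ℝ) : ℂ) • cliffTensor P X (b.Z j) := by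
    conv_lhs => rw [b.expand_p a]
    simp only [cliffTensor]
    rw [map_sum, map_sum, ← LinearMap.coe_lTensorHom, map_sum]
    refine Finset.sum_congr rfl fun j _ => ?_
    have e0 : R.p0ToP (Matrix.trace ((a : Matrix (Fin n) (Fin n) ℝ) *
        (b.e j : Matrix (Fin n) (Fin n) ℝ)) • b.e j) =
        ((Matrix.trace ((a : Matrix (Fin n) (Fin n) ℝ) *
        (b.e j : Matrix (Fin n) (Fin n) ℝ)) : ℝ) : ℂ) • b.Z j := by
      rw [map_smul]
      exact (Complex.coe_smul _ (R.p0ToP (b.e j))).symm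
    rw [e0, map_smul, map_smul]
  rw [e]
  exact PosHermitian.IsSkew.sum fun j _ =>
    ((h2 j (Finset.mem_univ j)).isSkew h' (hsq j)).real_smul _

/-- The spin double cover of `K` acts by isometries. -/
theorem isIsometry_tensorSpin {h : PosHermitian (X ⊗[ℂ] P.Spinor)}
    (hiso : ∀ k, h.IsIsometry (M.repTensor P k))
    (hskew : ∀ a : R.p0, h.IsSkew (cliffTensor P X (R.p0ToP a))) (x : R.Ktilde) :
    h.IsIsometry (M.tensorSpin P x) := by
  -- the Clifford action turns the star operation of the real Clifford algebra into the adjoint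
  let op : CliffordAlgebra R.Q0 → Module.End ℂ (X ⊗[ℂ] P.Spinor) := fun s =>
    (cliffAction P (R.realCliff s)).lTensor X
  have hmul : ∀ s t, op (s * t) = op s * op t := fun s t => by
    simp only [op, map_mul, LinearMap.lTensor_mul]
  have hadj : ∀ s v w, h.form (op s v) w = h.form v (op (star s) w) := by
    intro s
    induction s using CliffordAlgebra.induction with
    | algebraMap r =>
      intro v w
      have e : op (algebraMap ℝ _ r) = (r : ℂ) • 1 := by
        simp only [op]
        rw [AlgHom.commutes, IsScalarTower.algebraMap_apply ℝ ℂ R.Cliff, AlgHom.commutes,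
          Algebra.algebraMap_eq_smul_one, LinearMap.lTensor_smul, Module.End.one_eq_id,
          LinearMap.lTensor_id]
        rfl
      rw [CliffordAlgebra.star_algebraMap, e, LinearMap.smul_apply, LinearMap.smul_apply,
        map_smulₛₗ, LinearMap.smul_apply, map_smul, Complex.conj_ofReal]
      rfl
    | ι a =>
      intro v w
      have e : op (CliffordAlgebra.ι R.Q0 a) = cliffTensor P X (R.p0ToP a) := by
        simp only [op]
        rw [realCliff_ι, cliffAction_ι]
        rfl
      have e' : op (-CliffordAlgebra.ι R.Q0 a) = -cliffTensor P X (R.p0ToP a) := by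
        rw [← e]
        simp only [op]
        rw [map_neg, map_neg, LinearMap.lTensor_neg]
      rw [CliffordAlgebra.star_ι, e, e', hskew, LinearMap.neg_apply, map_neg]
    | mul s t hs ht =>
      intro v w
      rw [star_mul, hmul, hmul, Module.End.mul_apply, Module.End.mul_apply, hs, ht]
    | add s t hs ht =>
      intro v w
      have e : ∀ s t, op (s + t) = op s + op t := fun s t => by
        simp only [op, map_add, LinearMap.lTensor_add]
      rw [star_add, e, e, LinearMap.add_apply, LinearMap.add_apply, map_add, map_add,
        LinearMap.add_apply, hs, ht]
  intro v w
  have hT : M.tensorSpin P x = M.repTensor P (R.KtildeToK x) *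
      op (x.1.2 : CliffordAlgebra R.Q0) :=
    (LinearMap.rTensor_comp_lTensor _ _ _).symm
  rw [hT, Module.End.mul_apply, Module.End.mul_apply, hiso, hadj, ← Module.End.mul_apply, ← hmul,
    spinGroup.star_mul_self_of_mem x.1.2.2]
  simp only [op, map_one, Module.End.one_eq_id, LinearMap.lTensor_id, LinearMap.id_apply]

/-- Only products of two commuting skew-adjoint operators occur: for `i ≠ j`, both `[Zᵢ, Zⱼ] ∈ 𝔨`
and the Clifford product `Zᵢ Zⱼ` act by skew-adjoint operators. -/
theorem isSymm_sqOp {m l : ℕ} (b : R.OrthonormalBases m l) {h : PosHermitian (X ⊗[ℂ] P.Spinor)}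
    (hiso : ∀ k, h.IsIsometry (M.repTensor P k))
    (hskew : ∀ a : R.p0, h.IsSkew (cliffTensor P X (R.p0ToP a))) : h.IsSymm (M.sqOp P b) := by
  refine .add (.real_smul (.sum fun i _ => .sum fun j _ => ?_) _)
    (.real_smul (.sum fun j _ => ?_) _)
  · obtain ⟨A, hA⟩ := b.lie_Z i j
    by_cases hij : i = j
    · subst hij
      intro x y
      have e : M.lieTensor P ⁅R.pToG (b.Z i), R.pToG (b.Z i)⁆ = 0 := by
        rw [lie_self, lieTensor, map_zero, LinearMap.rTensor_zero]
      simp only [e, zero_mul, LinearMap.zero_apply, map_zero]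
    · rw [hA]
      refine (M.isSkew_lieTensor P hiso A).mul ((hskew (b.e i)).mul_of_anticomm (hskew (b.e j)) ?_)
        ?_
      · have := cliffTensor_Z_mul (X := X) P b j i
        rwa [if_neg (Ne.symm hij), sub_zero] at this
      · have e : ∀ v, cliffTensor P X v * M.lieTensor P (R.g0ToG A A.2.1) =
            M.lieTensor P (R.g0ToG A A.2.1) * cliffTensor P X v := fun v =>
          cliffTensor_mul_rTensor P v _
        rw [← mul_assoc, ← e, mul_assoc, ← e, ← mul_assoc]
  · exact (M.isSkew_lieTensor P hiso (b.w j)).mul (M.isSkew_lieTensor P hiso (b.w j)) rfl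

theorem sqOp_mem {m l : ℕ} (b : R.OrthonormalBases m l) {F : Submodule ℂ X}
    (hK : ∀ k, ∀ x ∈ F, M.rep k x ∈ F) {x : X ⊗[ℂ] P.Spinor} (hx : x ∈ tensorSub P F) :
    M.sqOp P b x ∈ tensorSub P F := by
  have hlie : ∀ A : R.k0, ∀ y ∈ tensorSub P F, M.lieTensor P (R.g0ToG A A.2.1) y ∈ tensorSub P F :=
    fun A y hy => rTensor_mem_tensorSub P (fun z hz => M.lieAction_mem hK A hz) hy
  simp only [sqOp, LinearMap.add_apply, LinearMap.smul_apply, LinearMap.sum_apply,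
    Module.End.mul_apply]
  refine Submodule.add_mem _ (Submodule.smul_mem _ _ (Submodule.sum_mem _ fun i _ =>
    Submodule.sum_mem _ fun j _ => ?_)) (Submodule.smul_mem _ _ (Submodule.sum_mem _ fun j _ => ?_))
  · obtain ⟨A, hA⟩ := b.lie_Z i j
    rw [hA]
    exact hlie A _ (lTensor_mem_tensorSub P _ (lTensor_mem_tensorSub P _ hx))
  · exact hlie (b.w j) _ (hlie (b.w j) _ hx)

/-- `X ⊗ S` is a semisimple `K̃`-module. -/
theorem isSemisimpleModule_tensorSpin :
    IsSemisimpleModule (MonoidAlgebra ℂ R.Ktilde) (M.tensorSpin P).asModule := by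
  obtain ⟨m, l, ⟨b⟩⟩ := R.exists_orthonormalBases
  obtain ⟨h, hiso, hskew⟩ := M.exists_invariantForm P b
  have hT : ∀ x, M.tensorSpin P x = M.repTensor P (R.KtildeToK x) * (spinRep P x).lTensor X :=
    fun x => (LinearMap.rTensor_comp_lTensor _ _ _).symm
  refine h.isSemisimpleModule_of_isIsometry (M.isIsometry_tensorSpin P hiso hskew) fun v => ?_
  obtain ⟨F, h1, h2, h3⟩ := M.exists_mem_tensorSub P v
  refine ⟨⟨tensorSub P F, fun x v hv => ?_⟩, inferInstance, h3⟩
  rw [hT]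
  exact rTensor_mem_tensorSub P (h2 _) (lTensor_mem_tensorSub P _ hv)

end GKModule
end RealReductiveGroup

/-! ### The Dirac operator as an odd operator -/

theorem Polarization.isCompl_half {V : Type*} [AddCommGroup V] [Module ℂ V]
    {B : LinearMap.BilinForm ℂ V} (P : Polarization B) (i : ZMod 2) :
    IsCompl (P.half i) (P.half (i + 1)) := by
  have h : IsCompl (P.half 0) (P.half 1) :=
    CliffordAlgebra.evenOdd_isCompl (0 : QuadraticForm ℂ P.pos)
  fin_cases i
  · exact h
  · exact h.symm

namespace RealReductiveGroup

variable {n : ℕ} {G : Type*} [Group G] [TopologicalSpace G] [IsTopologicalGroup G]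
  {R : RealReductiveGroup n G} (P : Polarization R.Bp) {ι : Type*} [Fintype ι] [DecidableEq ι]
  (β : R.DualBases ι)

namespace GKModule

variable {X : Type*} [AddCommGroup X] [Module ℂ X] (M : R.GKModule X)

theorem exists_add_of_half (i : ZMod 2) (v : X ⊗[ℂ] P.Spinor) :
    ∃ y ∈ LinearMap.range ((P.half i).subtype.lTensor X),
      ∃ z ∈ LinearMap.range ((P.half (i + 1)).subtype.lTensor X), v = y + z := by
  have h : v ∈ LinearMap.range ((P.half i).subtype.lTensor X) ⊔
      LinearMap.range ((P.half (i + 1)).subtype.lTensor X) := by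
    induction v with
    | zero => exact Submodule.zero_mem _
    | tmul x s =>
      obtain ⟨a, ha, c, hc, rfl⟩ := Submodule.mem_sup.1
        ((P.isCompl_half i).sup_eq_top ▸ Submodule.mem_top (x := s))
      rw [TensorProduct.tmul_add]
      exact Submodule.add_mem_sup ⟨x ⊗ₜ ⟨a, ha⟩, rfl⟩ ⟨x ⊗ₜ ⟨c, hc⟩, rfl⟩
    | add v w hv hw => exact Submodule.add_mem _ hv hw
  obtain ⟨y, hy, z, hz, h⟩ := Submodule.mem_sup.1 h
  exact ⟨y, hy, z, hz, h.symm⟩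

theorem eq_zero_of_mem_half (i : ZMod 2) {v : X ⊗[ℂ] P.Spinor}
    (h : v ∈ LinearMap.range ((P.half i).subtype.lTensor X))
    (h' : v ∈ LinearMap.range ((P.half (i + 1)).subtype.lTensor X)) : v = 0 := by
  obtain ⟨a, rfl⟩ := h
  obtain ⟨c, hc⟩ := h'
  let q := (P.half i).projection (P.half (i + 1)) (P.isCompl_half i)
  have h1 : q ∘ₗ (P.half i).subtype = (P.half i).subtype := LinearMap.ext fun x =>
    Submodule.projection_apply_left (P.isCompl_half i) x
  have h2 : q ∘ₗ (P.half (i + 1)).subtype = 0 := LinearMap.ext fun x =>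
    Submodule.projection_apply_right (P.isCompl_half i) x
  have h3 := congrArg (q.lTensor X) hc
  rw [← LinearMap.lTensor_comp_apply, ← LinearMap.lTensor_comp_apply, h1, h2,
    LinearMap.lTensor_zero, LinearMap.zero_apply] at h3
  exact h3.symm

theorem diracOp_mem_half (i : ZMod 2) {v : X ⊗[ℂ] P.Spinor}
    (hv : v ∈ LinearMap.range ((P.half i).subtype.lTensor X)) :
    M.diracOp P β v ∈ LinearMap.range ((P.half (i + 1)).subtype.lTensor X) := by
  obtain ⟨w, rfl⟩ := hv
  induction w with
  | zero => rw [map_zero, map_zero]; exact Submodule.zero_mem _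
  | tmul x s =>
    rw [diracOp_eq, LinearMap.sum_apply]
    exact Submodule.sum_mem _ fun j _ => ⟨M.lieAction (R.pToG (β.b j)) x ⊗ₜ
      ⟨_, P.vectorAction_mem_half (β.d j) i s s.2⟩, rfl⟩
  | add v w hv hw => rw [map_add, map_add]; exact Submodule.add_mem _ hv hw

/-- With infinitesimal character, the square of the Dirac operator is a scalar translate of a
self-adjoint operator which preserves the finite-dimensional subspaces `F ⊗ S`, so its kernel and
its image are complementary. -/
theorem isOddOperator {χ : Subalgebra.center ℂ (UniversalEnvelopingAlgebra ℂ R.g) →ₐ[ℂ] ℂ}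
    (hχ : M.HasInfChar χ) : IsOddOperator (M.diracMod P β) (M.halfMod P) := by
  obtain ⟨m, l, ⟨b⟩⟩ := R.exists_orthonormalBases
  obtain ⟨h, hiso, hskew⟩ := M.exists_invariantForm P b
  have hT := M.isSymm_sqOp P b hiso hskew
  obtain ⟨c, hc⟩ := M.diracOp_sq P β b hχ
  have hker : ∀ v, M.diracOp P β (M.diracOp P β (M.diracOp P β (M.diracOp P β v))) = 0 →
      M.diracOp P β (M.diracOp P β v) = 0 := by
    intro v hv
    rw [hc, hc] at hv
    rw [hc]
    exact hT.eq_zero_of_sub_smul_sq c hv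
  have hdecomp : ∀ v, ∃ y z, M.diracOp P β (M.diracOp P β y) = 0 ∧
      v = y + M.diracOp P β (M.diracOp P β z) := by
    intro v
    obtain ⟨F, _, hK, hv⟩ := M.exists_mem_tensorSub P v
    obtain ⟨y, z, hy, hz⟩ := hT.exists_add_of_mem c (fun _ => M.sqOp_mem P b hK) hv
    rw [← hc] at hy hz
    exact ⟨y, z, hy, hz⟩
  exact
    { odd := fun i v hv => M.diracOp_mem_half P β i hv
      decomp := fun i v => exists_add_of_half P i v
      disjoint := fun i v h1 h2 => eq_zero_of_mem_half P i h1 h2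
      ker_sq := hker
      sq_decomp := hdecomp }

end GKModule
end RealReductiveGroup

end DiracIndex

end

theorem proposition3p1 {n : ℕ} {G : Type*} [Group G] [TopologicalSpace G] [IsTopologicalGroup G]
    (R : DiracIndex.RealReductiveGroup n G) (_hR : R.EqualRank)
    (P : DiracIndex.Polarization R.Bp) {ι : Type*} [Fintype ι] [DecidableEq ι]
    (β : R.DualBases ι) :
    (∀ (X : Type*) [AddCommGroup X] [Module ℂ X] (M : R.GKModule X),
      M.FiniteLength → (∃ χ, M.HasInfChar χ) →
      DiracIndex.VirtualEq (M.tensorHalfSpin P 0) (M.tensorHalfSpin P 1)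
        (M.cohomologyHalfRep P β 0) (M.cohomologyHalfRep P β 1)) ∧
    (∀ (U V W : Type*) [AddCommGroup U] [Module ℂ U] [AddCommGroup V] [Module ℂ V]
      [AddCommGroup W] [Module ℂ W] (MU : R.GKModule U) (MV : R.GKModule V) (MW : R.GKModule W)
      (f : U →ₗ[ℂ] V) (g : V →ₗ[ℂ] W),
      DiracIndex.RealReductiveGroup.IsGKHom MU MV f →
      DiracIndex.RealReductiveGroup.IsGKHom MV MW g →
      Function.Injective f → Function.Exact f g → Function.Surjective g →
      MU.FiniteLength → MV.FiniteLength → MW.FiniteLength → ∀ χ, MV.HasInfChar χ →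
      MU.HasInfChar χ ∧ MW.HasInfChar χ ∧
      DiracIndex.VirtualEq (MV.cohomologyHalfRep P β 0) (MV.cohomologyHalfRep P β 1)
        ((MU.cohomologyHalfRep P β 0).prod (MW.cohomologyHalfRep P β 0))
        ((MU.cohomologyHalfRep P β 1).prod (MW.cohomologyHalfRep P β 1))) := by
  refine ⟨fun X _ _ M _ hχ => ?_,
    fun U V W _ _ _ _ _ _ MU MV MW f g hf hg hi he hs _ _ _ χ hχ => ?_⟩
  · obtain ⟨χ, hχ⟩ := hχ
    have := M.isSemisimpleModule_tensorSpin P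
    exact M.virtualEq_of_isOddOperator P β (M.isOddOperator P β hχ)
  · have hU : MU.HasInfChar χ := .of_injective hf hi hχ
    have hW : MW.HasInfChar χ := .of_surjective hg hs hχ
    have := MU.isSemisimpleModule_tensorSpin P
    have := MV.isSemisimpleModule_tensorSpin P
    have := MW.isSemisimpleModule_tensorSpin P
    exact ⟨hU, hW, DiracIndex.RealReductiveGroup.GKModule.virtualEq_of_isOddExact P β
      (DiracIndex.RealReductiveGroup.GKModule.isOddExact P β hf hg hi he hs
        (MU.isOddOperator P β hU) (MV.isOddOperator P β hχ) (MW.isOddOperator P β hW))⟩
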